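/- **Setting.** Let $\Omega\subset\mathbb R^2$ be bounded and open, let $D\subset\Omega$ (the observation region) be measurable, and let $\varepsilon,\gamma,\mu>0$. Let $H^1_0(\Omega)^2$ be the closure of $C_c^\infty(\Omega)^2$ in the $H^1$ norm, $V=\{\psi\in H^1_0(\Omega)^2:\operatorname{div}\psi=0\}$, and let $H$ be the space of $\psi\in L^2(\Omega)^2$ with $\operatorname{div}\psi=0$ in $\Omega$ and $\psi\cdot n=0$ on $\partial\Omega$ in the weak sense, i.e. $\int_\Omega\psi\cdot\nabla q\,dx=0$ for all $q\in H^1(\Omega)$. Let $c_P,c_L>0$ be constants such that for all $v\in H^1_0(\Omega)^2$ $$\|v\|_{L^2}\le c_P\|\nabla v\|_{L^2},\qquad \|v\|_{L^4}\le\sqrt{c_L}\,\|v\|_{L^2}^{1/2}\|\nabla v\|_{L^2}^{1/2}.$$ **Data.** Let $\alpha,\beta:\mathbb R\to[0,\infty)$ be Lipschitz continuous with $\alpha(1)=\beta(1)=0$ and $\alpha(-1),\beta(-1)>0$. Let $u_d\in L^2(D)^2$, $u_0\in H$, $f_s\in L^2(\Omega)^2$, and let $f$ belong to $L^2(0,T;L^2(\Omega)^2)$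 for every $T>0$. Assume $$2c_P^2c_L\|f_s\|_{L^2}<\mu^2,$$ and that there is $K>0$ such that for all $T>0$ $$\int_0^T e^{\lambda t}\|f(t)-f_s\|_{L^2}^2\,dt\le K,\qquad \lambda=\frac{\mu^4-2c_L^2c_P^4\|f_s\|_{L^2}^2}{c_P^2\mu^3}.$$ **States.** Let $\Phi_{ad}=\{\varphi\in H^1(\Omega):|\varphi|\le1\text{ a.e.}\}$, and put $a_\varphi(u,v)=\mu\int_\Omega\nabla u:\nabla v\,dx+\int_\Omega\alpha(\varphi)\,u\cdot v\,dx$ and $b(u,v,w)=\int_\Omega[(u\cdot\nabla)v]\cdot w\,dx$. For $\varphi\in\Phi_{ad}$: * a stationary state for $\varphi$ is $v\in V$ with $a_\varphi(v,\psi)+b(v,v,\psi)=(f_s,\psi)_{L^2}$ for all $\psi\in V$; * for $T>0$, a time-dependent state for $\varphi$ is $u\in L^2(0,T;V)$ with $\partial_tu\in L^2(0,T;V^*)$ such that $\langle\partial_tu(t),\psi\rangle+a_\varphi(u(t),\psi)+b(u(t),u(t),\psi)=(f(t),\psi)_{L^2}$ for a.e. $t\in(0,T)$ and all $\psi\in V$,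 and $u(0)=u_0$ (for the representative of $u$ that is continuous from $[0,T]$ to $L^2(\Omega)^2$). **Objectives.** With $\Psi(s)=(1-s^2)/2$ on $[-1,1]$ and $c_0=\frac12\int_{-1}^1\sqrt{2\Psi(s)}\,ds$, let $$\mathbb E_\varepsilon(\varphi)=\frac1{2c_0}\int_\Omega\Big(\frac\varepsilon2|\nabla\varphi|^2+\frac1\varepsilon\Psi(\varphi)\Big)dx,$$ $$J_T(u,\varphi)=\frac1T\int_0^T\Big[\int_\Omega\tfrac{\varphi+1}2|u-u_d|^2\chi_D\,dx+\int_\Omega\beta(\varphi)|u|^2\,dx\Big]dt+\gamma\,\mathbb E_\varepsilon(\varphi),$$ $$J_s(v,\varphi)=\int_\Omega\tfrac{\varphi+1}2|v-u_d|^2\chi_D\,dx+\int_\Omega\beta(\varphi)|v|^2\,dx+\gamma\,\mathbb E_\varepsilon(\varphi).$$ A design $\varphi^T\in\Phi_{ad}$ with time-dependent state $u^T$ is a global minimizer of the time-dependent problem if $J_T(u^T,\varphi^T)\le J_T(u,\varphi)$ for all $\varphi\in\Phi_{ad}$ and all time-dependent states $u$ for $\varphi$; a global minimizer $\varphi^s$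 of the stationary problem, with stationary state $v^s$, is defined in the same way through $J_s$. Write $J_T(\varphi^T)=J_T(u^T,\varphi^T)$ and $J_s(\varphi^s)=J_s(v^s,\varphi^s)$. **Theorem.** There is a constant $c>0$, independent of $T$, such that for every $T>0$ and all global minimizers $\varphi^T$ of the time-dependent problem and $\varphi^s$ of the stationary problem $$|J_T(\varphi^T)-J_s(\varphi^s)|\le c\Big(\frac1{\sqrt T}+\frac1T\Big).$$ -/

import Mathlib

open MeasureTheory Set
open scoped ContDiff InnerProductSpace

noncomputable section

namespace PhaseFieldNS

/-- The plane with its Euclidean norm. -/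
abbrev Plane : Type := EuclideanSpace ℝ (Fin 2)

/-- `2 × 2` matrices with the Frobenius norm; the entry `(i, j)` of a velocity gradient is
`∂ⱼ uᵢ`. -/
abbrev Mat2 : Type := EuclideanSpace ℝ (Fin 2 × Fin 2)

/-- The Lebesgue space `L²(D; F)`. -/
abbrev L2 (D : Set Plane) (F : Type) [NormedAddCommGroup F] : Type :=
  Lp F 2 ((volume : Measure Plane).restrict D)

/-- Smooth functions with compact support in `D`. -/
structure IsTestFunction {F : Type} [NormedAddCommGroup F] [NormedSpace ℝ F]
    (D : Set Plane) (η : Plane → F) : Prop where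
  smooth : ContDiff ℝ ∞ η
  compact : HasCompactSupport η
  support : tsupport η ⊆ D

/-- The partial derivative `∂ⱼ η` of a smooth function. -/
def partialD {F : Type} [NormedAddCommGroup F] [NormedSpace ℝ F]
    (j : Fin 2) (η : Plane → F) (x : Plane) : F :=
  fderiv ℝ η x (EuclideanSpace.single j 1)

/-- The gradient matrix of a smooth vector field. -/
def velocityGrad (ψ : Plane → Plane) (x : Plane) : Mat2 :=
  WithLp.toLp 2 fun ij : Fin 2 × Fin 2 => partialD ij.2 ψ x ij.1

/-- The Sobolev space `H¹(Ω)` of scalar functions; an element is recorded as the pair of the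
function and its weak gradient. -/
def H1 (Ω : Set Plane) : Set (L2 Ω ℝ × L2 Ω Plane) :=
  {q | ∀ η : Plane → ℝ, IsTestFunction Ω η → ∀ j : Fin 2,
    ∫ x in Ω, q.1 x * partialD j η x = - ∫ x in Ω, q.2 x j * η x}

/-- Pairs of an `L²` vector field and an `L²` matrix field, with the norm
`(‖u‖² + ‖G‖²)^(1/2)`, which is the `H¹` norm when `G` is the gradient of `u`. -/
abbrev FieldPair (Ω : Set Plane) : Type := WithLp 2 (L2 Ω Plane × L2 Ω Mat2)

/-- The space `H¹₀(Ω; ℝ²)`: the closure in the `H¹` norm of the smooth vector fields with compact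
support in `Ω`. An element is recorded as the pair of the field and its gradient. (The pairs
`(ψ, ∇ψ)` already form a linear subspace, so the span adds nothing.) -/
def H10 (Ω : Set Plane) : Submodule ℝ (FieldPair Ω) :=
  (Submodule.span ℝ {p : FieldPair Ω | ∃ ψ : Plane → Plane, IsTestFunction Ω ψ ∧
    p.fst =ᵐ[volume.restrict Ω] ψ ∧
    p.snd =ᵐ[volume.restrict Ω] velocityGrad ψ}).topologicalClosure

/-- The pairs whose matrix field has vanishing trace almost everywhere. -/
def traceFree (Ω : Set Plane) : Submodule ℝ (FieldPair Ω) where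
  carrier := {p | ∀ᵐ x ∂((volume : Measure Plane).restrict Ω), ∑ i : Fin 2, p.snd x (i, i) = 0}
  zero_mem' := by
    show ∀ᵐ x ∂((volume : Measure Plane).restrict Ω),
      ∑ i : Fin 2, ((0 : L2 Ω Mat2) : Plane → Mat2) x (i, i) = 0
    filter_upwards [Lp.coeFn_zero Mat2 2 ((volume : Measure Plane).restrict Ω)] with x hx
    simp only [hx, Pi.zero_apply, PiLp.zero_apply, Finset.sum_const_zero]
  add_mem' := by
    intro p q hp hq
    show ∀ᵐ x ∂((volume : Measure Plane).restrict Ω),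
      ∑ i : Fin 2, ((p.snd + q.snd : L2 Ω Mat2) : Plane → Mat2) x (i, i) = 0
    filter_upwards [hp, hq, Lp.coeFn_add p.snd q.snd] with x h1 h2 hx
    simp only [hx, Pi.add_apply, PiLp.add_apply, Finset.sum_add_distrib, h1, h2, add_zero]
  smul_mem' := by
    intro c p hp
    show ∀ᵐ x ∂((volume : Measure Plane).restrict Ω),
      ∑ i : Fin 2, ((c • p.snd : L2 Ω Mat2) : Plane → Mat2) x (i, i) = 0
    filter_upwards [hp, Lp.coeFn_smul c p.snd] with x h1 hx
    simp only [hx, Pi.smul_apply, PiLp.smul_apply, ← Finset.smul_sum, h1, smul_zero]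

/-- The space `V` of the divergence-free fields in `H¹₀(Ω; ℝ²)`. -/
def V (Ω : Set Plane) : Submodule ℝ (FieldPair Ω) := H10 Ω ⊓ traceFree Ω

/-- The space `H` of the `L²` fields with vanishing divergence in `Ω` and vanishing normal
component on the boundary, both in the weak sense: Green's formula `∫ ψ · ∇q = 0` for all
`q ∈ H¹(Ω)`. -/
def H (Ω : Set Plane) : Set (L2 Ω Plane) :=
  {ψ | ∀ q ∈ H1 Ω, ∫ x in Ω, ⟪ψ x, q.2 x⟫_ℝ = 0}

/-- `c` is a constant in the Poincaré inequality `‖v‖ ≤ c ‖∇v‖` on `H¹₀(Ω; ℝ²)`. -/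
def IsPoincareConstant (Ω : Set Plane) (c : ℝ) : Prop :=
  0 < c ∧ ∀ v ∈ H10 Ω, ‖v.fst‖ ≤ c * ‖v.snd‖

/-- `c` is a constant in the Ladyzhenskaya inequality
`‖v‖_{L⁴} ≤ √c ‖v‖^{1/2} ‖∇v‖^{1/2}` on `H¹₀(Ω; ℝ²)`. -/
def IsLadyzhenskayaConstant (Ω : Set Plane) (c : ℝ) : Prop :=
  0 < c ∧ ∀ v ∈ H10 Ω, eLpNorm v.fst 4 (volume.restrict Ω) ≤
    ENNReal.ofReal (√c * (√‖v.fst‖ * √‖v.snd‖))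

/-- The admissible designs `φ ∈ H¹(Ω)`, `|φ| ≤ 1` almost everywhere. -/
def Admissible (Ω : Set Plane) : Set (L2 Ω ℝ × L2 Ω Plane) :=
  {φ | φ ∈ H1 Ω ∧ ∀ᵐ x ∂((volume : Measure Plane).restrict Ω), |φ.1 x| ≤ 1}

/-- The assumptions on the functions that describe the porous medium. -/
structure IsPorousCoefficient (α : ℝ → ℝ) : Prop where
  nonneg : ∀ s, 0 ≤ α s
  lipschitz : ∃ L, LipschitzWith L α
  fluid : α 1 = 0
  obstacle : 0 < α (-1)

/-- The bilinear form `a_φ(u, v) = μ ∫ ∇u : ∇v + ∫ α(φ) u · v`. -/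
def aForm {Ω : Set Plane} (μ : ℝ) (α : ℝ → ℝ) (φ : L2 Ω ℝ) (u v : FieldPair Ω) : ℝ :=
  μ * (∫ x in Ω, ⟪u.snd x, v.snd x⟫_ℝ) + ∫ x in Ω, α (φ x) * ⟪u.fst x, v.fst x⟫_ℝ

/-- The trilinear form `b(u, v, w) = ∫ [(u · ∇) v] · w`. -/
def bForm {Ω : Set Plane} (u v w : FieldPair Ω) : ℝ :=
  ∫ x in Ω, ∑ i : Fin 2, (∑ j : Fin 2, u.fst x j * v.snd x (i, j)) * w.fst x i

/-- `v ∈ V` is the state of the stationary problem for the design `φ`, that is, a weak solution of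
the stationary Navier-Stokes equations with force `f_s`. -/
def IsStationaryState {Ω : Set Plane} (μ : ℝ) (α : ℝ → ℝ) (f_s : L2 Ω Plane) (φ : L2 Ω ℝ)
    (v : V Ω) : Prop :=
  ∀ ψ : V Ω, aForm μ α φ v ψ + bForm (v : FieldPair Ω) v ψ = ∫ x in Ω, ⟪f_s x, ψ.1.fst x⟫_ℝ

/-- `du : (0, T) → V*` is the weak time derivative of `u : (0, T) → V`, where `u(t)` acts on `V`
through the `L²` inner product. -/
def IsWeakTimeDeriv {Ω : Set Plane} (T : ℝ) (u : ℝ → V Ω) (du : ℝ → StrongDual ℝ (V Ω)) : Prop :=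
  ∀ θ : ℝ → ℝ, ContDiff ℝ ∞ θ → HasCompactSupport θ → tsupport θ ⊆ Ioo 0 T → ∀ ψ : V Ω,
    ∫ t in Ioo 0 T, deriv θ t * ⟪(u t).1.fst, ψ.1.fst⟫_ℝ = - ∫ t in Ioo 0 T, θ t * du t ψ

/-- `u` is the state of the time-dependent problem on `(0, T)` for the design `φ`: it lies in
`L²(0, T; V)`, has a time derivative in `L²(0, T; V*)`, solves the Navier-Stokes equations weakly
for almost every time, and its representative in `C([0, T]; H)` takes the value `u₀` at `0`. -/
structure IsTimeState {Ω : Set Plane} (μ : ℝ) (α : ℝ → ℝ) (f : ℝ → L2 Ω Plane)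
    (u₀ : L2 Ω Plane) (T : ℝ) (φ : L2 Ω ℝ) (u : ℝ → V Ω) : Prop where
  memLp : MemLp u 2 (volume.restrict (Ioo 0 T))
  equation : ∃ du : ℝ → StrongDual ℝ (V Ω),
    MemLp du 2 (volume.restrict (Ioo 0 T)) ∧ IsWeakTimeDeriv T u du ∧
    ∀ᵐ t ∂((volume : Measure ℝ).restrict (Ioo 0 T)), ∀ ψ : V Ω,
      du t ψ + aForm μ α φ (u t) ψ + bForm (u t : FieldPair Ω) (u t) ψ =
        ∫ x in Ω, ⟪f t x, ψ.1.fst x⟫_ℝ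
  initial : ∃ w : ℝ → L2 Ω Plane, ContinuousOn w (Icc 0 T) ∧
    (∀ᵐ t ∂((volume : Measure ℝ).restrict (Ioo 0 T)), w t = (u t).1.fst) ∧ w 0 = u₀

/-- The double-obstacle potential on `[-1, 1]`, where admissible designs take their values. -/
def potential (s : ℝ) : ℝ := (1 - s ^ 2) / 2

/-- The normalization `c₀ = ½ ∫ √(2Ψ)` over `[-1, 1]`. -/
def potentialConst : ℝ := 1 / 2 * ∫ s in (-1 : ℝ)..1, √(2 * potential s)

/-- The Ginzburg-Landau energy of a design. -/
def energy {Ω : Set Plane} (ε : ℝ) (φ : L2 Ω ℝ × L2 Ω Plane) : ℝ :=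
  1 / (2 * potentialConst) *
    ∫ x in Ω, (ε / 2 * ‖φ.2 x‖ ^ 2 + 1 / ε * potential (φ.1 x))

/-- The tracking and penalty terms at a fixed time:
`∫ (φ + 1)/2 |v - u_d|² χ_D + ∫ β(φ) |v|²`. -/
def runningCost {Ω D : Set Plane} (β : ℝ → ℝ) (u_d : L2 D Plane) (φ : L2 Ω ℝ)
    (v : L2 Ω Plane) : ℝ :=
  (∫ x in Ω, D.indicator (fun y => (φ y + 1) / 2 * ‖v y - u_d y‖ ^ 2) x) +
    ∫ x in Ω, β (φ x) * ‖v x‖ ^ 2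

/-- The objective `J_T(u, φ)` of the time-dependent problem. -/
def JT {Ω D : Set Plane} (ε γ : ℝ) (β : ℝ → ℝ) (u_d : L2 D Plane) (T : ℝ)
    (u : ℝ → V Ω) (φ : L2 Ω ℝ × L2 Ω Plane) : ℝ :=
  1 / T * (∫ t in Ioo 0 T, runningCost β u_d φ.1 (u t).1.fst) + γ * energy ε φ

/-- The objective `J_s(v, φ)` of the stationary problem. -/
def Js {Ω D : Set Plane} (ε γ : ℝ) (β : ℝ → ℝ) (u_d : L2 D Plane)
    (v : V Ω) (φ : L2 Ω ℝ × L2 Ω Plane) : ℝ :=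
  runningCost β u_d φ.1 v.1.fst + γ * energy ε φ

/-- The design `φ`, with its state `u`, is a global minimizer of the time-dependent problem. -/
structure IsTimeMinimizer {Ω D : Set Plane} (ε γ μ : ℝ) (α β : ℝ → ℝ) (u_d : L2 D Plane)
    (f : ℝ → L2 Ω Plane) (u₀ : L2 Ω Plane) (T : ℝ)
    (φ : L2 Ω ℝ × L2 Ω Plane) (u : ℝ → V Ω) : Prop where
  admissible : φ ∈ Admissible Ω
  state : IsTimeState μ α f u₀ T φ.1 u
  minimal : ∀ φ' ∈ Admissible Ω, ∀ u', IsTimeState μ α f u₀ T φ'.1 u' →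
    JT ε γ β u_d T u φ ≤ JT ε γ β u_d T u' φ'

/-- The design `φ`, with its state `v`, is a global minimizer of the stationary problem. -/
structure IsStationaryMinimizer {Ω D : Set Plane} (ε γ μ : ℝ) (α β : ℝ → ℝ) (u_d : L2 D Plane)
    (f_s : L2 Ω Plane) (φ : L2 Ω ℝ × L2 Ω Plane) (v : V Ω) : Prop where
  admissible : φ ∈ Admissible Ω
  state : IsStationaryState μ α f_s φ.1 v
  minimal : ∀ φ' ∈ Admissible Ω, ∀ v', IsStationaryState μ α f_s φ'.1 v' →
    Js ε γ β u_d v φ ≤ Js ε γ β u_d v' φ'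

/-- The exponential weight `(μ⁴ - 2 c_L² c_P⁴ F²) / (c_P² μ³)`, with `F` the norm of the stationary
force. -/
def decayRate (μ c_P c_L F : ℝ) : ℝ :=
  (μ ^ 4 - 2 * c_L ^ 2 * c_P ^ 4 * F ^ 2) / (c_P ^ 2 * μ ^ 3)

end PhaseFieldNS

end

open PhaseFieldNS

/-!
For a fixed design the difference of a time-dependent state `u` and a stationary state `v` satisfies
a dissipative equation: tested with `u - v`, the smallness of `f_s` lets the viscosity absorb the
advection of `v`, and what remains bounds `∫₀ᵀ ‖u - v‖²` independently of `T`. As the running cost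
is quadratic in the state, Jensen's inequality puts its mean over `(0, T)` within
`O(1 / √T + 1 / T)` of its value at `v`, uniformly in the design. To compare the two minimal values,
`φᵀ` competes in the stationary problem and `φˢ` in the time-dependent one.

For this both problems need a state for the design that is optimal for the other one. The stationary
state is the fixed point of a contraction. For the time-dependent state, the state `uᵀ` that `φᵀ`
comes with is continued along the segment from the Brinkman term of `φᵀ` to that of `φˢ`. The
perturbation starts from zero, so the linearized equations have zero initial value; identifying `V`
with its dual turns them into equations between operators on `L²(0, T; V)` that are built from
the Volterra operator `ρ ↦ ∫₀ᵗ ρ`, and the accretivity of that operator gives their solvability.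
-/

noncomputable section

namespace PhaseFieldNS

/-- Lebesgue measure on the time interval `(a, b)`. -/
abbrev timeMeasure (a b : ℝ) : Measure ℝ := volume.restrict (Ioo a b)

/-- The Bochner space `L²(a, b; E)`. -/
abbrev TimeL2 (a b : ℝ) (E : Type*) [NormedAddCommGroup E] : Type _ := Lp E 2 (timeMeasure a b)

section IntervalIntegrals

variable {E : Type*} [NormedAddCommGroup E] {a b s t : ℝ}

theorem intervalIntegrable_of_integrable_Ioo {f : ℝ → E} (hf : Integrable f (timeMeasure a b))
    (hs : s ∈ Icc a b) (ht : t ∈ Icc a b) : IntervalIntegrable f volume s t := by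
  have h : IntegrableOn f (Icc a b) := by rwa [integrableOn_Icc_iff_integrableOn_Ioo]
  exact (h.mono_set (uIcc_subset_Icc hs ht)).intervalIntegrable

theorem TimeL2.integrable (ρ : TimeL2 a b E) : Integrable ρ (timeMeasure a b) :=
  (Lp.memLp ρ).integrable one_le_two

theorem TimeL2.intervalIntegrable (ρ : TimeL2 a b E) (hs : s ∈ Icc a b) (ht : t ∈ Icc a b) :
    IntervalIntegrable ρ volume s t :=
  intervalIntegrable_of_integrable_Ioo ρ.integrable hs ht

theorem ae_timeMeasure_mono {p : ℝ → Prop} (h : ∀ᵐ r ∂(timeMeasure a b), p r) (hs : a ≤ s)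
    (ht : t ≤ b) : ∀ᵐ r ∂(timeMeasure s t), p r :=
  ae_restrict_of_ae_restrict_of_subset (Ioo_subset_Ioo hs ht) h

variable [NormedSpace ℝ E]

theorem integral_Ioo_eq_intervalIntegral (f : ℝ → E) (h : s ≤ t) :
    ∫ r in Ioo s t, f r = ∫ r in s..t, f r := by
  rw [intervalIntegral.integral_of_le h, integral_Ioc_eq_integral_Ioo]

theorem intervalIntegral_congr_timeMeasure {f g : ℝ → E} (h : f =ᵐ[timeMeasure a b] g)
    (hs : a ≤ s) (hst : s ≤ t) (ht : t ≤ b) : ∫ r in s..t, f r = ∫ r in s..t, g r := by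
  rw [← integral_Ioo_eq_intervalIntegral _ hst, ← integral_Ioo_eq_intervalIntegral _ hst]
  exact integral_congr_ae (ae_timeMeasure_mono h hs ht)

end IntervalIntegrals

theorem integral_norm_le_mul_norm {X E : Type*} [MeasurableSpace X] {m : Measure X}
    [IsFiniteMeasure m] [NormedAddCommGroup E] (f : Lp E 2 m) :
    ∫ x, ‖f x‖ ∂m ≤ m.real univ ^ (2⁻¹ : ℝ) * ‖f‖ := by
  have hL1 : ∫ x, ‖f x‖ ∂m = (eLpNorm f 1 m).toReal := by
    rw [eLpNorm_one_eq_lintegral_enorm,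
      integral_norm_eq_lintegral_enorm (Lp.aestronglyMeasurable f)]
  rw [hL1, Lp.norm_def, mul_comm, measureReal_def, ENNReal.toReal_rpow, ← ENNReal.toReal_mul]
  refine ENNReal.toReal_mono ?_ ((eLpNorm_le_eLpNorm_mul_rpow_measure_univ one_le_two
    (Lp.aestronglyMeasurable f)).trans_eq (by norm_num))
  exact ENNReal.mul_ne_top (Lp.eLpNorm_ne_top f)
    (ENNReal.rpow_ne_top_of_nonneg (by norm_num) (measure_ne_top _ _))

section Primitive

variable {E : Type*} [NormedAddCommGroup E] [NormedSpace ℝ E] {a b t : ℝ}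

/-- The primitive of `ρ` that vanishes at `a`. -/
def primitive (a : ℝ) (ρ : ℝ → E) (t : ℝ) : E := ∫ s in a..t, ρ s

theorem continuousOn_primitive {ρ : ℝ → E} (hρ : Integrable ρ (timeMeasure a b)) :
    ContinuousOn (primitive a ρ) (Icc a b) := by
  rcases le_or_gt a b with hab | hab
  · rw [← uIcc_of_le hab]
    refine intervalIntegral.continuousOn_primitive_interval ?_
    rwa [uIcc_of_le hab, integrableOn_Icc_iff_integrableOn_Ioo]
  · simp only [Icc_eq_empty (not_le.2 hab), continuousOn_empty]

theorem primitive_congr {f g : ℝ → E} (h : f =ᵐ[timeMeasure a b] g) (ht : t ∈ Icc a b) :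
    primitive a f t = primitive a g t :=
  intervalIntegral_congr_timeMeasure h le_rfl ht.1 ht.2

theorem norm_primitive_le {ρ : ℝ → E} (hρ : Integrable ρ (timeMeasure a b)) (ht : t ∈ Icc a b) :
    ‖primitive a ρ t‖ ≤ ∫ s in Ioo a b, ‖ρ s‖ := by
  refine (intervalIntegral.norm_integral_le_integral_norm ht.1).trans ?_
  rw [← integral_Ioo_eq_intervalIntegral _ ht.1]
  exact setIntegral_mono_set hρ.norm (Filter.Eventually.of_forall fun _ => norm_nonneg _)
    (Ioo_subset_Ioo_right ht.2).eventuallyLE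

theorem memLp_primitive (ρ : TimeL2 a b E) : MemLp (primitive a ρ) 2 (timeMeasure a b) := by
  refine MemLp.of_bound ?_ (∫ s in Ioo a b, ‖ρ s‖) ?_
  · exact ((continuousOn_primitive ρ.integrable).mono Ioo_subset_Icc_self).aestronglyMeasurable
      measurableSet_Ioo
  · filter_upwards [ae_restrict_mem measurableSet_Ioo] with t ht
    exact norm_primitive_le ρ.integrable (Ioo_subset_Icc_self ht)

theorem primitive_add (ρ σ : TimeL2 a b E) (ht : t ∈ Icc a b) :
    primitive a (ρ + σ : TimeL2 a b E) t = primitive a ρ t + primitive a σ t := by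
  have ha : a ∈ Icc a b := left_mem_Icc.2 (ht.1.trans ht.2)
  rw [primitive_congr (Lp.coeFn_add ρ σ) ht]
  exact intervalIntegral.integral_add (ρ.intervalIntegrable ha ht) (σ.intervalIntegrable ha ht)

theorem primitive_smul (c : ℝ) (ρ : TimeL2 a b E) (ht : t ∈ Icc a b) :
    primitive a (c • ρ : TimeL2 a b E) t = c • primitive a ρ t := by
  rw [primitive_congr (Lp.coeFn_smul c ρ) ht]
  exact intervalIntegral.integral_smul c ρ

theorem primitive_sub (ρ σ : TimeL2 a b E) (ht : t ∈ Icc a b) :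
    primitive a (ρ - σ : TimeL2 a b E) t = primitive a ρ t - primitive a σ t := by
  rw [sub_eq_add_neg, ← neg_one_smul ℝ σ, primitive_add _ _ ht, primitive_smul _ _ ht,
    neg_one_smul, ← sub_eq_add_neg]

theorem map_primitive [CompleteSpace E] {F : Type*} [NormedAddCommGroup F] [NormedSpace ℝ F]
    [CompleteSpace F] (L : E →L[ℝ] F) (ρ : TimeL2 a b E) (ht : t ∈ Icc a b) :
    L (primitive a ρ t) = primitive a (fun s => L (ρ s)) t :=
  (L.intervalIntegral_comp_comm
    (ρ.intervalIntegrable (left_mem_Icc.2 (ht.1.trans ht.2)) ht)).symm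

/-- The Volterra operator `ρ ↦ (t ↦ ∫ₐᵗ ρ)` on `L²(a, b; E)`. -/
def volterra (a b : ℝ) (E : Type*) [NormedAddCommGroup E] [NormedSpace ℝ E] :
    TimeL2 a b E →L[ℝ] TimeL2 a b E :=
  LinearMap.mkContinuous
    { toFun := fun ρ => (memLp_primitive ρ).toLp
      map_add' := by
        intro ρ σ
        rw [← MemLp.toLp_add, MemLp.toLp_eq_toLp_iff]
        filter_upwards [ae_restrict_mem measurableSet_Ioo] with t ht
        exact primitive_add ρ σ (Ioo_subset_Icc_self ht)
      map_smul' := by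
        intro c ρ
        rw [RingHom.id_apply, ← MemLp.toLp_const_smul, MemLp.toLp_eq_toLp_iff]
        filter_upwards [ae_restrict_mem measurableSet_Ioo] with t ht
        exact primitive_smul c ρ (Ioo_subset_Icc_self ht) }
    ((measureUnivNNReal (timeMeasure a b) : ℝ) ^ (2 : ENNReal).toReal⁻¹ *
      (timeMeasure a b).real univ ^ (2⁻¹ : ℝ)) (by
      intro ρ
      rw [mul_assoc]
      refine Lp.norm_le_of_ae_bound (by positivity) ?_
      filter_upwards [(memLp_primitive ρ).coeFn_toLp, ae_restrict_mem measurableSet_Ioo]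
        with t hρ ht
      rw [LinearMap.coe_mk, AddHom.coe_mk, hρ]
      exact (norm_primitive_le ρ.integrable (Ioo_subset_Icc_self ht)).trans
        (integral_norm_le_mul_norm ρ))

theorem coeFn_volterra (ρ : TimeL2 a b E) :
    volterra a b E ρ =ᵐ[timeMeasure a b] primitive a ρ :=
  (memLp_primitive ρ).coeFn_toLp

theorem volterra_compLpL [CompleteSpace E] {F : Type*} [NormedAddCommGroup F] [NormedSpace ℝ F]
    [CompleteSpace F] (L : E →L[ℝ] F) (ρ : TimeL2 a b E) :
    L.compLpL 2 _ (volterra a b E ρ) = volterra a b F (L.compLpL 2 _ ρ) := by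
  refine Lp.ext ?_
  filter_upwards [L.coeFn_compLpL (p := 2) (volterra a b E ρ), coeFn_volterra ρ,
    coeFn_volterra (L.compLpL 2 _ ρ), ae_restrict_mem measurableSet_Ioo] with t h1 h2 h3 ht
  rw [h1, h2, h3, primitive_congr (L.coeFn_compLpL (p := 2) ρ) (Ioo_subset_Icc_self ht),
    map_primitive L ρ (Ioo_subset_Icc_self ht)]

theorem ae_eq_zero_of_primitive_eq_zero [CompleteSpace E] {ρ : ℝ → E}
    (hρ : Integrable ρ (timeMeasure a b)) (h : primitive a ρ =ᵐ[timeMeasure a b] 0) :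
    ρ =ᵐ[timeMeasure a b] 0 := by
  rcases le_or_gt b a with hab | hab
  · simp [timeMeasure, Ioo_eq_empty (not_lt.2 hab), Filter.EventuallyEq]
  have hI : IntervalIntegrable ρ volume a b :=
    intervalIntegrable_of_integrable_Ioo hρ (left_mem_Icc.2 hab.le) (right_mem_Icc.2 hab.le)
  have hzero : EqOn (primitive a ρ) 0 (Ioo a b) :=
    Measure.eqOn_open_of_ae_eq h isOpen_Ioo
      ((continuousOn_primitive hρ).mono Ioo_subset_Icc_self) continuousOn_const
  rw [Filter.EventuallyEq, ae_restrict_iff' measurableSet_Ioo]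
  filter_upwards [hI.ae_hasDerivAt_integral] with x hx hxI
  have hderiv := hx (Ioo_subset_Icc_self.trans Icc_subset_uIcc hxI) a left_mem_uIcc
  have hderiv_zero : HasDerivAt (fun x => ∫ s in a..x, ρ s) 0 x := by
    refine (hasDerivAt_const x (0 : E)).congr_of_eventuallyEq ?_
    filter_upwards [isOpen_Ioo.mem_nhds hxI] with y hy using hzero hy
  exact hderiv.unique hderiv_zero

theorem volterra_injective [CompleteSpace E] : Function.Injective (volterra a b E) := by
  rw [injective_iff_map_eq_zero]
  intro ρ hρ
  rw [Lp.eq_zero_iff_ae_eq_zero] at hρ ⊢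
  exact ae_eq_zero_of_primitive_eq_zero ρ.integrable ((coeFn_volterra ρ).symm.trans hρ)

theorem absolutelyContinuousOnInterval_of_dist_le {X Y : Type*} [PseudoMetricSpace X]
    [PseudoMetricSpace Y] {f : ℝ → X} {g : ℝ → Y} (hg : AbsolutelyContinuousOnInterval g a b)
    (h : ∀ x ∈ uIcc a b, ∀ y ∈ uIcc a b, dist (f x) (f y) ≤ dist (g x) (g y)) :
    AbsolutelyContinuousOnInterval f a b := by
  rw [absolutelyContinuousOnInterval_iff] at hg ⊢
  intro ε hε
  obtain ⟨δ, hδ, hsum⟩ := hg ε hε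
  refine ⟨δ, hδ, fun I hI hlen => (Finset.sum_le_sum fun i hi => ?_).trans_lt (hsum I hI hlen)⟩
  exact h _ (hI.1 i hi).1 _ (hI.1 i hi).2

theorem absolutelyContinuousOnInterval_primitive {ρ : ℝ → E}
    (hρ : IntervalIntegrable ρ volume a b) :
    AbsolutelyContinuousOnInterval (primitive a ρ) a b := by
  refine absolutelyContinuousOnInterval_of_dist_le
    (hρ.norm.absolutelyContinuousOnInterval_intervalIntegral (c := a) left_mem_uIcc) ?_
  intro x hx y hy
  have hax : IntervalIntegrable ρ volume a x := hρ.mono_set (uIcc_subset_uIcc left_mem_uIcc hx)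
  have hay : IntervalIntegrable ρ volume a y := hρ.mono_set (uIcc_subset_uIcc left_mem_uIcc hy)
  rw [dist_eq_norm, Real.dist_eq,
    intervalIntegral.integral_interval_sub_left hax.norm hay.norm, primitive, primitive,
    intervalIntegral.integral_interval_sub_left hax hay]
  exact intervalIntegral.norm_integral_le_abs_integral_norm

end Primitive

section EnergyIdentity

variable {E : Type*} [NormedAddCommGroup E] [InnerProductSpace ℝ E] {a b t : ℝ}

theorem intervalIntegrable_inner_of_continuousOn {ρ σ : ℝ → E}
    (hρ : IntervalIntegrable ρ volume a b) (hσ : ContinuousOn σ (uIcc a b)) :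
    IntervalIntegrable (fun s => ⟪ρ s, σ s⟫_ℝ) volume a b := by
  obtain ⟨C, hC⟩ := isCompact_uIcc.exists_bound_of_continuousOn hσ
  rw [intervalIntegrable_iff] at hρ ⊢
  refine (hρ.norm.mul_const C).mono' ?_ ?_
  · exact hρ.aestronglyMeasurable.inner
      ((hσ.mono uIoc_subset_uIcc).aestronglyMeasurable measurableSet_uIoc)
  · filter_upwards [ae_restrict_mem measurableSet_uIoc] with s hs
    refine (norm_inner_le_norm _ _).trans ?_
    gcongr
    exact hC s (uIoc_subset_uIcc hs)

theorem inner_eq_intervalIntegral (hab : a ≤ b) (ρ σ : TimeL2 a b E) :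
    ⟪ρ, σ⟫_ℝ = ∫ s in a..b, ⟪ρ s, σ s⟫_ℝ := by
  rw [L2.inner_def, integral_Ioo_eq_intervalIntegral _ hab]

variable [CompleteSpace E]

theorem norm_primitive_sq {ρ : ℝ → E} (hρ : Integrable ρ (timeMeasure a b)) (ht : t ∈ Icc a b) :
    ‖primitive a ρ t‖ ^ 2 = 2 * ∫ s in a..t, ⟪ρ s, primitive a ρ s⟫_ℝ := by
  have hI : IntervalIntegrable ρ volume a t :=
    intervalIntegrable_of_integrable_Ioo hρ (left_mem_Icc.2 (ht.1.trans ht.2)) ht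
  have hJ : IntervalIntegrable (fun s => ⟪ρ s, primitive a ρ s⟫_ℝ) volume a t := by
    refine intervalIntegrable_inner_of_continuousOn hI ((continuousOn_primitive hρ).mono ?_)
    rw [uIcc_of_le ht.1]
    exact Icc_subset_Icc_right ht.2
  let defect : ℝ → ℝ := fun s =>
    ‖primitive a ρ s‖ * ‖primitive a ρ s‖ - 2 * ∫ r in a..s, ⟪ρ r, primitive a ρ r⟫_ℝ
  have hnorm : AbsolutelyContinuousOnInterval (fun s => ‖primitive a ρ s‖) a t :=
    absolutelyContinuousOnInterval_of_dist_le (absolutelyContinuousOnInterval_primitive hI)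
      fun _ _ _ _ => (dist_norm_norm_le _ _).trans_eq (dist_eq_norm _ _).symm
  have hdefect : AbsolutelyContinuousOnInterval defect a t :=
    (hnorm.fun_mul hnorm).fun_sub
      ((hJ.absolutelyContinuousOnInterval_intervalIntegral (c := a) left_mem_uIcc).const_mul 2)
  have hderiv : ∀ᵐ x, x ∈ uIcc a t → HasDerivAt defect 0 x := by
    filter_upwards [hI.ae_hasDerivAt_integral, hJ.ae_hasDerivAt_integral] with x h1 h2 hx
    have hprim : HasDerivAt (primitive a ρ) (ρ x) x := h1 hx a left_mem_uIcc
    have hint := (h2 hx a left_mem_uIcc).const_mul 2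
    refine (((hprim.inner ℝ hprim).sub hint).congr_deriv ?_).congr_of_eventuallyEq ?_
    · rw [real_inner_comm (primitive a ρ x)]
      ring
    · refine Filter.Eventually.of_forall fun s => ?_
      simp only [defect, Pi.sub_apply, real_inner_self_eq_norm_mul_norm]
  obtain ⟨C, hC⟩ := hdefect.const_of_ae_hasDerivAt_zero hderiv
  have hconst : defect t = defect a := (hC t right_mem_uIcc).trans (hC a left_mem_uIcc).symm
  simp only [defect, primitive, intervalIntegral.integral_same, norm_zero] at hconst ⊢
  linarith

end EnergyIdentity

section Accretive

open Filter Topology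

variable {X : Type*} [NormedAddCommGroup X] [InnerProductSpace ℝ X]

/-- A bounded operator with nonnegative quadratic form. -/
def IsAccretive (S : X →L[ℝ] X) : Prop := ∀ x, 0 ≤ ⟪S x, x⟫_ℝ

namespace IsAccretive

variable {S : X →L[ℝ] X} {η : ℝ}

theorem isCoercive_add_smul_id (hS : IsAccretive S) (hη : 0 < η) :
    IsCoercive ((innerSL ℝ).comp (S + η • ContinuousLinearMap.id ℝ X) : X →L[ℝ] X →L[ℝ] ℝ) := by
  refine ⟨η, hη, fun x => ?_⟩
  change η * ‖x‖ * ‖x‖ ≤ ⟪S x + η • x, x⟫_ℝ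
  rw [inner_add_left, real_inner_smul_left, real_inner_self_eq_norm_mul_norm]
  linarith [hS x]

theorem orthogonal_range_le_ker (hS : IsAccretive S) : S.rangeᗮ ≤ S.ker := by
  intro x hx
  have horth : ∀ y, ⟪S y, x⟫_ℝ = 0 := fun y => hx _ ⟨y, rfl⟩
  have hbound : ∀ s ∈ Ioi (0 : ℝ), ‖S x‖ ^ 2 ≤ s * ⟪S (S x), S x⟫_ℝ := by
    intro s hs
    have h := hS (x - s • S x)
    simp only [map_sub, map_smul, inner_sub_left, inner_sub_right, real_inner_smul_left,
      real_inner_smul_right, horth, real_inner_self_eq_norm_sq] at h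
    exact le_of_mul_le_mul_left (by linarith) hs
  have hlim : Tendsto (fun s : ℝ => s * ⟪S (S x), S x⟫_ℝ) (𝓝[>] 0) (𝓝 0) := by
    simpa only [zero_mul, id] using
      (tendsto_id.mul_const ⟪S (S x), S x⟫_ℝ).mono_left (nhdsWithin_le_nhds (a := (0 : ℝ)))
  have hsq : ‖S x‖ ^ 2 ≤ 0 := ge_of_tendsto hlim (eventually_mem_nhdsWithin.mono hbound)
  exact norm_eq_zero.1 (pow_eq_zero_iff two_ne_zero |>.1 (le_antisymm hsq (sq_nonneg _)))

variable [CompleteSpace X]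

/-- The isomorphism `S + η` for an accretive `S`; its inverse is the resolvent of `-S`. -/
def shiftEquiv (hS : IsAccretive S) (hη : 0 < η) : X ≃L[ℝ] X :=
  (hS.isCoercive_add_smul_id hη).continuousLinearEquivOfBilin

theorem shiftEquiv_apply (hS : IsAccretive S) (hη : 0 < η) (x : X) :
    hS.shiftEquiv hη x = S x + η • x := by
  refine ext_inner_right ℝ fun y => ?_
  rw [shiftEquiv, IsCoercive.continuousLinearEquivOfBilin_apply]
  rfl

theorem map_shiftEquiv_symm_add (hS : IsAccretive S) (hη : 0 < η) (x : X) :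
    S ((hS.shiftEquiv hη).symm x) + η • (hS.shiftEquiv hη).symm x = x := by
  rw [← shiftEquiv_apply hS hη, ContinuousLinearEquiv.apply_symm_apply]

theorem map_shiftEquiv_symm_of_commute (hS : IsAccretive S) (hη : 0 < η) {L : X →L[ℝ] X}
    (hL : ∀ x, L (S x) = S (L x)) (x : X) :
    L ((hS.shiftEquiv hη).symm x) = (hS.shiftEquiv hη).symm (L x) := by
  rw [ContinuousLinearEquiv.eq_symm_apply, shiftEquiv_apply, ← hL, ← map_smul, ← map_add,
    map_shiftEquiv_symm_add]

theorem norm_map_shiftEquiv_symm_le (hS : IsAccretive S) (hη : 0 < η) (x : X) :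
    ‖S ((hS.shiftEquiv hη).symm x)‖ ≤ ‖x‖ := by
  set y := (hS.shiftEquiv hη).symm x
  have hexpand : ‖x‖ ^ 2 = ‖S y‖ ^ 2 + 2 * (η * ⟪S y, y⟫_ℝ) + ‖η • y‖ ^ 2 := by
    rw [← real_inner_smul_right, ← norm_add_sq_real, map_shiftEquiv_symm_add]
  have hcross : 0 ≤ η * ⟪S y, y⟫_ℝ := mul_nonneg hη.le (hS y)
  exact le_of_sq_le_sq (by linarith [sq_nonneg ‖η • y‖]) (norm_nonneg x)

theorem dist_map_shiftEquiv_symm_le (hS : IsAccretive S) (hη : 0 < η) (y : X) :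
    dist (S ((hS.shiftEquiv hη).symm (S y))) (S y) ≤ η * ‖y‖ := by
  have hcomm := hS.map_shiftEquiv_symm_of_commute hη (L := S) (fun _ => rfl) y
  rw [dist_comm, dist_eq_norm, sub_eq_of_eq_add' (hS.map_shiftEquiv_symm_add hη (S y)).symm,
    ← hcomm, norm_smul, Real.norm_of_nonneg hη.le]
  exact mul_le_mul_of_nonneg_left (hS.norm_map_shiftEquiv_symm_le hη y) hη.le

theorem denseRange (hS : IsAccretive S) (hinj : Function.Injective S) : DenseRange S := by
  have horth : S.rangeᗮ = ⊥ := by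
    rw [eq_bot_iff, ← LinearMap.ker_eq_bot.2 hinj]
    exact hS.orthogonal_range_le_ker
  have hdense := S.range.dense_iff_topologicalClosure_eq_top.2
    (Submodule.topologicalClosure_eq_top_iff.2 horth)
  exact hdense

theorem exists_approximation (hS : IsAccretive S) (hinj : Function.Injective S) :
    ∃ R : ℕ → X →L[ℝ] X, (∀ x, Tendsto (fun n => S (R n x)) atTop (𝓝 x)) ∧
      ∀ L : X →L[ℝ] X, (∀ x, L (S x) = S (L x)) → ∀ n x, L (R n x) = R n (L x) := by
  let R : ℕ → X →L[ℝ] X := fun n => (hS.shiftEquiv (Nat.one_div_pos_of_nat (n := n))).symm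
  refine ⟨R, ?_, fun L hL n => hS.map_shiftEquiv_symm_of_commute _ hL⟩
  have hequi : Equicontinuous fun n x => S (R n x) := by
    refine (LipschitzWith.uniformEquicontinuous _ 1 fun n => ?_).equicontinuous
    refine LipschitzWith.of_dist_le_mul fun x y => ?_
    rw [NNReal.coe_one, one_mul, dist_eq_norm, dist_eq_norm, ← map_sub, ← map_sub]
    exact hS.norm_map_shiftEquiv_symm_le _ _
  intro x
  refine (hS.denseRange hinj).induction_on (p := fun x => Tendsto (fun n => S (R n x)) atTop (𝓝 x))
    x (hequi.isClosed_setOfPred_tendsto continuous_id) fun y => ?_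
  refine tendsto_iff_dist_tendsto_zero.2 (squeeze_zero (fun _ => dist_nonneg)
    (fun n => hS.dist_map_shiftEquiv_symm_le _ y) ?_)
  simpa only [zero_mul] using tendsto_one_div_add_atTop_nhds_zero_nat.mul_const ‖y‖

end IsAccretive

theorem isAccretive_volterra {E : Type*} [NormedAddCommGroup E] [InnerProductSpace ℝ E]
    [CompleteSpace E] {a b : ℝ} : IsAccretive (volterra a b E) := by
  intro ρ
  rcases lt_or_ge b a with hab | hab
  · simp [L2.inner_def, timeMeasure, Ioo_eq_empty (not_lt.2 hab.le)]
  have hsq := norm_primitive_sq ρ.integrable (right_mem_Icc.2 hab)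
  have hinner : ⟪volterra a b E ρ, ρ⟫_ℝ = ∫ s in a..b, ⟪ρ s, primitive a ρ s⟫_ℝ := by
    rw [real_inner_comm, inner_eq_intervalIntegral hab]
    refine intervalIntegral_congr_timeMeasure (a := a) (b := b) ?_ le_rfl hab le_rfl
    filter_upwards [coeFn_volterra ρ] with s hs
    rw [hs]
  linarith [sq_nonneg ‖primitive a ρ b‖]

/-- Douglas' range inclusion: the functional `P† x ↦ ⟪g, S† x⟫` is well defined and bounded on the
range of `P†`, and a Hahn–Banach extension of it represents the solution. -/
theorem range_le_range_of_norm_adjoint_le {X Y Z : Type*}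
    [NormedAddCommGroup X] [InnerProductSpace ℝ X] [CompleteSpace X]
    [NormedAddCommGroup Y] [InnerProductSpace ℝ Y] [CompleteSpace Y]
    [NormedAddCommGroup Z] [InnerProductSpace ℝ Z] [CompleteSpace Z]
    {S : Y →L[ℝ] X} {P : Z →L[ℝ] X} {k : ℝ}
    (h : ∀ x, ‖S.adjoint x‖ ≤ k * ‖P.adjoint x‖) : S.range ≤ P.range := by
  rintro _ ⟨g, rfl⟩
  obtain ⟨s, hs⟩ := P.adjoint.toLinearMap.rangeRestrict.exists_rightInverse_of_surjective
    (LinearMap.range_rangeRestrict _)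
  have hPs : ∀ y, P.adjoint (s y) = y := fun y => congrArg Subtype.val (LinearMap.congr_fun hs y)
  let ℓ : StrongDual ℝ P.adjoint.range :=
    LinearMap.mkContinuous ((innerSL ℝ g).toLinearMap ∘ₗ S.adjoint.toLinearMap ∘ₗ s) (‖g‖ * k)
      fun y => by
        calc ‖⟪g, S.adjoint (s y)⟫_ℝ‖ ≤ ‖g‖ * ‖S.adjoint (s y)‖ := norm_inner_le_norm _ _
          _ ≤ ‖g‖ * (k * ‖P.adjoint (s y)‖) := by gcongr; exact h _
          _ = ‖g‖ * k * ‖y‖ := by rw [hPs, mul_assoc, Submodule.coe_norm]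
  obtain ⟨m, hm, -⟩ := exists_extension_norm_eq _ ℓ
  refine ⟨(InnerProductSpace.toDual ℝ Z).symm m, ext_inner_right ℝ fun x => ?_⟩
  let y : P.adjoint.range := ⟨P.adjoint x, x, rfl⟩
  have hwell : S.adjoint (s y) = S.adjoint x := by
    have hzero : P.adjoint (s y - x) = 0 := by rw [map_sub, hPs, sub_self]
    have hle := h (s y - x)
    rwa [hzero, norm_zero, mul_zero, norm_le_zero_iff, map_sub, sub_eq_zero] at hle
  have hext : m (P.adjoint x) = ⟪g, S.adjoint (s y)⟫_ℝ := hm y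
  change ⟪P _, x⟫_ℝ = ⟪S g, x⟫_ℝ
  rw [← ContinuousLinearMap.adjoint_inner_right, InnerProductSpace.toDual_symm_apply, hext, hwell,
    ContinuousLinearMap.adjoint_inner_right]

end Accretive

section LionsMagenes

open Filter Topology

variable {E : Type*} [NormedAddCommGroup E] [InnerProductSpace ℝ E]
  {G : Type*} [NormedAddCommGroup G] [InnerProductSpace ℝ G] {a b t : ℝ}

theorem intervalIntegrable_inner (f g : TimeL2 a b E) {s t : ℝ} (hs : s ∈ Icc a b)
    (ht : t ∈ Icc a b) : IntervalIntegrable (fun s => ⟪f s, g s⟫_ℝ) volume s t :=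
  intervalIntegrable_of_integrable_Ioo (L2.integrable_inner f g) hs ht

theorem intervalIntegral_inner_eq (f g : TimeL2 a b E) (ht : t ∈ Icc a b) :
    ∫ s in a..t, ⟪f s, g s⟫_ℝ =
      ⟪LpToLpRestrictCLM ℝ E ℝ (timeMeasure a b) 2 (Ioo a t) f,
        LpToLpRestrictCLM ℝ E ℝ (timeMeasure a b) 2 (Ioo a t) g⟫_ℝ := by
  rw [← integral_Ioo_eq_intervalIntegral _ ht.1, L2.inner_def,
    ← Measure.restrict_restrict_of_subset (Ioo_subset_Ioo_right ht.2)]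
  refine integral_congr_ae ?_
  filter_upwards [LpToLpRestrictCLM_coeFn ℝ (Ioo a t) f,
    LpToLpRestrictCLM_coeFn ℝ (Ioo a t) g] with s hf hg
  rw [hf, hg]

theorem abs_intervalIntegral_inner_le (f g : TimeL2 a b E) (ht : t ∈ Icc a b) :
    |∫ s in a..t, ⟪f s, g s⟫_ℝ| ≤ ‖f‖ * ‖g‖ := by
  rw [intervalIntegral_inner_eq f g ht]
  exact (abs_real_inner_le_norm _ _).trans (mul_le_mul (norm_Lp_toLp_restrict_le _ f)
    (norm_Lp_toLp_restrict_le _ g) (norm_nonneg _) (norm_nonneg _))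

theorem tendsto_intervalIntegral_inner {κ : Type*} {l : Filter κ} {f g : κ → TimeL2 a b E}
    {f₀ g₀ : TimeL2 a b E} (hf : Tendsto f l (𝓝 f₀)) (hg : Tendsto g l (𝓝 g₀))
    (ht : t ∈ Icc a b) :
    Tendsto (fun k => ∫ s in a..t, ⟪f k s, g k s⟫_ℝ) l (𝓝 (∫ s in a..t, ⟪f₀ s, g₀ s⟫_ℝ)) := by
  simp only [intervalIntegral_inner_eq _ _ ht]
  exact (((ContinuousLinearMap.continuous _).tendsto f₀).comp hf).inner
    (((ContinuousLinearMap.continuous _).tendsto g₀).comp hg)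

theorem ae_eq_map_of_tendsto_map_primitive {ι : E →L[ℝ] G} {ρ : ℕ → TimeL2 a b E} {z : TimeL2 a b E}
    {ζ : ℝ → G}
    (hz : Tendsto (fun n => volterra a b E (ρ n)) atTop (𝓝 z))
    (hζ : ∀ t ∈ Icc a b, Tendsto (fun n => ι (primitive a (ρ n) t)) atTop (𝓝 (ζ t))) :
    ∀ᵐ t ∂(timeMeasure a b), ζ t = ι (z t) := by
  let L := ι.compLpL 2 (timeMeasure a b)
  have hL : Tendsto (fun n => L (volterra a b E (ρ n))) atTop (𝓝 (L z)) :=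
    (L.continuous.tendsto z).comp hz
  obtain ⟨k, hk, hae⟩ := (tendstoInMeasure_of_tendsto_Lp hL).exists_seq_tendsto_ae
  have hprim : ∀ᵐ t ∂(timeMeasure a b), ∀ n,
      L (volterra a b E (ρ n)) t = ι (primitive a (ρ n) t) := by
    rw [ae_all_iff]
    intro n
    filter_upwards [ι.coeFn_compLpL (p := 2) (volterra a b E (ρ n)), coeFn_volterra (ρ n)]
      with t h₁ h₂
    rw [h₁, h₂]
  filter_upwards [hae, hprim, ι.coeFn_compLpL (p := 2) z, ae_restrict_mem measurableSet_Ioo]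
    with t hlim hprim hzt ht
  rw [hzt] at hlim
  exact tendsto_nhds_unique ((hζ t (Ioo_subset_Icc_self ht)).comp hk.tendsto_atTop)
    (hlim.congr fun n => hprim _)

variable [CompleteSpace E] [CompleteSpace G]

/-- The pointwise Gram operator `ι† ι` on `L²(a, b; E)`. If `ι` embeds `V` into `H`, it is the
identification of a function with values in `V` with one in `V*`, through the pivot space `H`. -/
def gram (a b : ℝ) (ι : E →L[ℝ] G) : TimeL2 a b E →L[ℝ] TimeL2 a b E :=
  (ι.adjoint.comp ι).compLpL 2 (timeMeasure a b)

theorem inner_coeFn_gram (ι : E →L[ℝ] G) (f : TimeL2 a b E) :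
    ∀ᵐ t ∂(timeMeasure a b), ∀ v, ⟪gram a b ι f t, v⟫_ℝ = ⟪ι (f t), ι v⟫_ℝ := by
  filter_upwards [(ι.adjoint.comp ι).coeFn_compLpL (p := 2) f] with t h v
  rw [gram, h, ContinuousLinearMap.comp_apply, ContinuousLinearMap.adjoint_inner_left]

theorem gram_volterra (ι : E →L[ℝ] G) (f : TimeL2 a b E) :
    gram a b ι (volterra a b E f) = volterra a b E (gram a b ι f) :=
  volterra_compLpL _ _

theorem inner_gram (ι : E →L[ℝ] G) (f g : TimeL2 a b E) :
    ⟪gram a b ι f, g⟫_ℝ =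
      ⟪ι.compLpL 2 (timeMeasure a b) f, ι.compLpL 2 (timeMeasure a b) g⟫_ℝ := by
  rw [L2.inner_def, L2.inner_def]
  refine integral_congr_ae ?_
  filter_upwards [inner_coeFn_gram ι f, ι.coeFn_compLpL (p := 2) f, ι.coeFn_compLpL (p := 2) g]
    with t hgram hf hg
  rw [hgram, hf, hg]

theorem norm_map_primitive_sq (ι : E →L[ℝ] G) (ρ : TimeL2 a b E) (ht : t ∈ Icc a b) :
    ‖ι (primitive a ρ t)‖ ^ 2 =
      2 * ∫ s in a..t, ⟪gram a b ι ρ s, volterra a b E ρ s⟫_ℝ := by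
  rw [map_primitive ι ρ ht, norm_primitive_sq (ι.integrable_comp ρ.integrable) ht]
  congr 1
  refine intervalIntegral_congr_timeMeasure (a := a) (b := b) ?_ le_rfl ht.1 ht.2
  filter_upwards [inner_coeFn_gram ι ρ, coeFn_volterra ρ, ae_restrict_mem measurableSet_Ioo]
    with s hgram hvolterra hs
  rw [hgram, hvolterra, map_primitive ι ρ (Ioo_subset_Icc_self hs)]

theorem norm_map_primitive_sq_le (ι : E →L[ℝ] G) (ρ : TimeL2 a b E) (ht : t ∈ Icc a b) :
    ‖ι (primitive a ρ t)‖ ^ 2 ≤ 2 * (‖gram a b ι ρ‖ * ‖volterra a b E ρ‖) := by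
  rw [norm_map_primitive_sq ι ρ ht]
  gcongr
  exact (le_abs_self _).trans (abs_intervalIntegral_inner_le _ _ ht)

section Limit

variable {ι : E →L[ℝ] G} {ρ : ℕ → TimeL2 a b E} {z g : TimeL2 a b E}

theorem uniformCauchySeqOn_map_primitive (hz : CauchySeq fun n => volterra a b E (ρ n))
    (hg : CauchySeq fun n => gram a b ι (ρ n)) :
    UniformCauchySeqOn (fun n t => ι (primitive a (ρ n) t)) atTop (Icc a b) := by
  rw [Metric.uniformCauchySeqOn_iff]
  intro ε hε
  obtain ⟨N₁, h₁⟩ := Metric.cauchySeq_iff.1 hz (ε / 2) (half_pos hε)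
  obtain ⟨N₂, h₂⟩ := Metric.cauchySeq_iff.1 hg (ε / 2) (half_pos hε)
  refine ⟨max N₁ N₂, fun m hm n hn t ht => lt_of_pow_lt_pow_left₀ 2 hε.le ?_⟩
  have hzmn := h₁ m (le_of_max_le_left hm) n (le_of_max_le_left hn)
  have hgmn := h₂ m (le_of_max_le_right hm) n (le_of_max_le_right hn)
  rw [dist_eq_norm, ← map_sub] at hzmn hgmn ⊢
  rw [← primitive_sub _ _ ht]
  calc ‖ι (primitive a (ρ m - ρ n : TimeL2 a b E) t)‖ ^ 2
      ≤ 2 * (‖gram a b ι (ρ m - ρ n)‖ * ‖volterra a b E (ρ m - ρ n)‖) :=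
        norm_map_primitive_sq_le ι _ ht
    _ ≤ 2 * (ε / 2 * (ε / 2)) := by gcongr
    _ < ε ^ 2 := by linarith [sq_nonneg ε, pow_pos hε 2]

theorem exists_continuous_representative_of_tendsto (hab : a ≤ b)
    (hz : Tendsto (fun n => volterra a b E (ρ n)) atTop (𝓝 z))
    (hg : Tendsto (fun n => gram a b ι (ρ n)) atTop (𝓝 g)) :
    ∃ ζ : ℝ → G, ContinuousOn ζ (Icc a b) ∧ ζ a = 0 ∧ (∀ᵐ t ∂(timeMeasure a b), ζ t = ι (z t)) ∧
      ∀ t ∈ Icc a b, ‖ζ t‖ ^ 2 = 2 * ∫ s in a..t, ⟪g s, z s⟫_ℝ := by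
  have hcauchy := uniformCauchySeqOn_map_primitive hz.cauchySeq hg.cauchySeq
  have hlim : ∀ t ∈ Icc a b, ∃ l, Tendsto (fun n => ι (primitive a (ρ n) t)) atTop (𝓝 l) :=
    fun t ht => cauchySeq_tendsto_of_complete (hcauchy.cauchy_map ht)
  choose! ζ hζ using hlim
  refine ⟨ζ, ?_, ?_, ae_eq_map_of_tendsto_map_primitive hz hζ, fun t ht => ?_⟩
  · exact (hcauchy.tendstoUniformlyOn_of_tendsto hζ).continuousOn (Frequently.of_forall fun n =>
      ι.continuous.comp_continuousOn (continuousOn_primitive (ρ n).integrable))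
  · refine tendsto_nhds_unique (hζ a (left_mem_Icc.2 hab)) ?_
    simp only [primitive, intervalIntegral.integral_same, map_zero, tendsto_const_nhds_iff]
  · refine tendsto_nhds_unique (((hζ t ht).norm).pow 2)
      (((tendsto_intervalIntegral_inner hg hz ht).const_mul 2).congr fun n => ?_)
    rw [norm_map_primitive_sq ι _ ht]

end Limit

/-- `h` says that `d/dt (ι† ι z) = g` with zero initial value. With `R n` an approximation of the
identity through the Volterra operator `S`, commuting with `ι† ι`, the functions `R n z` satisfy
`S (R n z) → z` and `ι† ι (R n z) = S (R n g) → g`. -/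
theorem exists_continuous_representative (hab : a ≤ b) (ι : E →L[ℝ] G) {z g : TimeL2 a b E}
    (h : gram a b ι z = volterra a b E g) :
    ∃ ζ : ℝ → G, ContinuousOn ζ (Icc a b) ∧ ζ a = 0 ∧ (∀ᵐ t ∂(timeMeasure a b), ζ t = ι (z t)) ∧
      ∀ t ∈ Icc a b, ‖ζ t‖ ^ 2 = 2 * ∫ s in a..t, ⟪g s, z s⟫_ℝ := by
  obtain ⟨R, hR, hcomm⟩ :=
    (isAccretive_volterra (E := E) (a := a) (b := b)).exists_approximation volterra_injective
  refine exists_continuous_representative_of_tendsto (ρ := fun n => R n z) hab (hR z) ?_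
  refine (hR g).congr fun n => ?_
  rw [hcomm (gram a b ι) (gram_volterra ι), h, hcomm (volterra a b E) fun _ => rfl]

end LionsMagenes

section Parabolic

theorem le_inv_mul_of_mul_sq_le {c N x : ℝ} (hc : 0 < c) (hN : 0 ≤ N) (hx : 0 ≤ x)
    (h : c * x ^ 2 ≤ N * x) : x ≤ c⁻¹ * N := by
  rw [inv_mul_eq_div, le_div_iff₀ hc, mul_comm]
  rcases hx.eq_or_lt with rfl | hx
  · rwa [mul_zero]
  · exact le_of_mul_le_mul_right (by linarith) hx

variable {E : Type*} [NormedAddCommGroup E] [InnerProductSpace ℝ E] {a b c : ℝ} {A : E →L[ℝ] E}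

theorem inner_compLpL_ge (hA : ∀ v, c * ‖v‖ ^ 2 ≤ ⟪A v, v⟫_ℝ) (z : TimeL2 a b E) :
    c * ‖z‖ ^ 2 ≤ ⟪A.compLpL 2 (timeMeasure a b) z, z⟫_ℝ := by
  rw [← real_inner_self_eq_norm_sq, L2.inner_def, L2.inner_def, ← integral_const_mul]
  refine integral_mono_ae ((L2.integrable_inner z z).const_mul c) (L2.integrable_inner _ _) ?_
  filter_upwards [A.coeFn_compLpL (p := 2) z] with t ht
  simp only [ht, real_inner_self_eq_norm_sq]
  exact hA _

variable [CompleteSpace E] {G : Type*} [NormedAddCommGroup G] [InnerProductSpace ℝ G]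
  [CompleteSpace G]

/-- The operator `ι† ι + ∫ₐᵗ A` on `L²(a, b; E)`: the equation `ι† ι z' + A z = g` with zero
initial value reads `parabolicOperator a b ι A z = volterra a b E g`. -/
def parabolicOperator (a b : ℝ) (ι : E →L[ℝ] G) (A : E →L[ℝ] E) :
    TimeL2 a b E →L[ℝ] TimeL2 a b E :=
  gram a b ι + (volterra a b E).comp (A.compLpL 2 _)

theorem parabolicOperator_eq_iff {ι : E →L[ℝ] G} {g z : TimeL2 a b E} :
    parabolicOperator a b ι A z = volterra a b E g ↔
      gram a b ι z = volterra a b E (g - A.compLpL 2 _ z) := by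
  rw [map_sub, ← eq_sub_iff_add_eq.symm]
  rfl

theorem inner_gram_adjoint_volterra_nonneg (ι : E →L[ℝ] G) (x : TimeL2 a b E) :
    0 ≤ ⟪gram a b ι ((volterra a b E).adjoint x), x⟫_ℝ := by
  rw [inner_gram, real_inner_comm, ← inner_gram, ContinuousLinearMap.adjoint_inner_right,
    ← gram_volterra, inner_gram, volterra_compLpL]
  exact isAccretive_volterra _

theorem norm_adjoint_volterra_le (ι : E →L[ℝ] G) (hc : 0 < c)
    (hA : ∀ v, c * ‖v‖ ^ 2 ≤ ⟪A v, v⟫_ℝ) (x : TimeL2 a b E) :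
    ‖(volterra a b E).adjoint x‖ ≤ c⁻¹ * ‖(parabolicOperator a b ι A).adjoint x‖ := by
  set y := (volterra a b E).adjoint x with hy
  refine le_inv_mul_of_mul_sq_le hc (norm_nonneg _) (norm_nonneg _) ?_
  calc c * ‖y‖ ^ 2 ≤ ⟪gram a b ι y, x⟫_ℝ + ⟪A.compLpL 2 _ y, y⟫_ℝ := by
        linarith [inner_gram_adjoint_volterra_nonneg ι x, inner_compLpL_ge hA y]
    _ = ⟪y, (parabolicOperator a b ι A).adjoint x⟫_ℝ := by
        rw [ContinuousLinearMap.adjoint_inner_right (parabolicOperator a b ι A), hy,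
          ContinuousLinearMap.adjoint_inner_right (volterra a b E), ← inner_add_left]
        rfl
    _ ≤ ‖(parabolicOperator a b ι A).adjoint x‖ * ‖y‖ := by
        rw [mul_comm]
        exact real_inner_le_norm _ _

theorem norm_le_of_parabolicOperator_eq (hab : a ≤ b) (ι : E →L[ℝ] G) (hc : 0 < c)
    (hA : ∀ v, c * ‖v‖ ^ 2 ≤ ⟪A v, v⟫_ℝ) {g z : TimeL2 a b E}
    (h : parabolicOperator a b ι A z = volterra a b E g) : ‖z‖ ≤ c⁻¹ * ‖g‖ := by
  obtain ⟨ζ, -, -, -, henergy⟩ :=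
    exists_continuous_representative hab ι (parabolicOperator_eq_iff.1 h)
  have hfinal := henergy b (right_mem_Icc.2 hab)
  rw [← inner_eq_intervalIntegral hab, inner_sub_left] at hfinal
  refine le_inv_mul_of_mul_sq_le hc (norm_nonneg _) (norm_nonneg _) ?_
  linarith [inner_compLpL_ge (a := a) (b := b) hA z, real_inner_le_norm g z, sq_nonneg ‖ζ b‖]

theorem exists_parabolic_solution_operator (hab : a ≤ b) (ι : E →L[ℝ] G) (hc : 0 < c)
    (hA : ∀ v, c * ‖v‖ ^ 2 ≤ ⟪A v, v⟫_ℝ) :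
    ∃ P : TimeL2 a b E →L[ℝ] TimeL2 a b E, ∀ g,
      gram a b ι (P g) = volterra a b E (g - A.compLpL 2 _ (P g)) := by
  set K := parabolicOperator a b ι A
  have hinj : Function.Injective K := by
    rw [injective_iff_map_eq_zero]
    intro z hz
    have h := norm_le_of_parabolicOperator_eq (g := 0) hab ι hc hA (by rw [hz, map_zero])
    rwa [norm_zero, mul_zero, norm_le_zero_iff] at h
  have hrange : ∀ g, volterra a b E g ∈ K.range := fun g =>
    range_le_range_of_norm_adjoint_le (norm_adjoint_volterra_le ι hc hA) ⟨g, rfl⟩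
  let P := (LinearEquiv.ofInjective K.toLinearMap hinj).symm.toLinearMap ∘ₗ
    (volterra a b E).toLinearMap.codRestrict K.range hrange
  have hP : ∀ g, K (P g) = volterra a b E g := fun g =>
    congrArg Subtype.val ((LinearEquiv.ofInjective K.toLinearMap hinj).apply_symm_apply
      ⟨volterra a b E g, hrange g⟩)
  exact ⟨P.mkContinuous c⁻¹ fun g => norm_le_of_parabolicOperator_eq hab ι hc hA (hP g),
    fun g => parabolicOperator_eq_iff.1 (hP g)⟩

end Parabolic

section Continuation

open Metric

theorem unit_interval_induction {Q : ℝ → Prop} {δ : ℝ} (hδ : 0 < δ) (h0 : Q 0)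
    (hstep : ∀ s ∈ Icc (0 : ℝ) 1, Q s → ∀ s' ∈ Icc (0 : ℝ) 1, |s' - s| ≤ δ → Q s') : Q 1 := by
  obtain ⟨n, hn⟩ := exists_nat_one_div_lt hδ
  have hn0 : (0 : ℝ) < n + 1 := by positivity
  have hQ : ∀ k : ℕ, k ≤ n + 1 → Q (k / (n + 1)) := by
    intro k
    induction k with
    | zero => simpa using h0
    | succ k ih =>
      intro hk
      have hk' : (k : ℝ) + 1 ≤ n + 1 := by exact_mod_cast hk
      have hdist : |((k + 1 : ℕ) : ℝ) / (n + 1) - k / (n + 1)| ≤ δ := by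
        rw [← sub_div, Nat.cast_succ, add_sub_cancel_left, abs_of_pos (by positivity)]
        exact hn.le
      refine hstep _ ⟨by positivity, ?_⟩ (ih (by lia)) _ ⟨by positivity, ?_⟩ hdist
      · rw [div_le_one hn0]; linarith
      · rwa [Nat.cast_succ, div_le_one hn0]
  have h1 := hQ (n + 1) le_rfl
  rwa [Nat.cast_succ, div_self hn0.ne'] at h1

variable {X Y : Type*} [NormedAddCommGroup X] [NormedSpace ℝ X] [NormedAddCommGroup Y]
  [NormedSpace ℝ Y]

/-- The operator `v ↦ D v + B(p, v) + B(v, q)`. For `p = q` it is the derivative at `p` of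
`v ↦ D v + B(v, v)`. -/
def linearization (D : Y →L[ℝ] X) (B : Y →L[ℝ] Y →L[ℝ] X) (p q : Y) : Y →L[ℝ] X :=
  D + B p + B.flip q

/-- The left-hand side of the equation `g + D u + B(u, u) = y`, in which the unknown `g`
determines `u = p₀ + P g`. -/
def quadraticMap (P : X →L[ℝ] Y) (D : Y →L[ℝ] X) (B : Y →L[ℝ] Y →L[ℝ] X) (p₀ : Y) (g : X) : X :=
  g + D (p₀ + P g) + B (p₀ + P g) (p₀ + P g)

variable {P : X →L[ℝ] Y} {D D' : Y →L[ℝ] X} {B : Y →L[ℝ] Y →L[ℝ] X} {p₀ : Y} {g : X} {M ε : ℝ}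

theorem norm_linearization_le (p q : Y) :
    ‖linearization D B p q‖ ≤ ‖D‖ + ‖B‖ * ‖p‖ + ‖B‖ * ‖q‖ := by
  refine norm_add₃_le.trans ?_
  gcongr
  · exact B.le_opNorm p
  · exact (B.flip.le_opNorm q).trans_eq (by rw [ContinuousLinearMap.opNorm_flip])

theorem norm_le_mul_norm_add_smul {W : Y →L[ℝ] X} {s : ℝ} (hs : s ∈ Icc (0 : ℝ) 1) {x : X}
    (h : ‖P x‖ ≤ M * ‖x + s • W (P x)‖) : ‖x‖ ≤ (1 + ‖W‖ * M) * ‖x + s • W (P x)‖ := by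
  calc ‖x‖ = ‖x + s • W (P x) - s • W (P x)‖ := by rw [add_sub_cancel_right]
    _ ≤ ‖x + s • W (P x)‖ + ‖s • W (P x)‖ := norm_sub_le _ _
    _ ≤ ‖x + s • W (P x)‖ + 1 * (‖W‖ * (M * ‖x + s • W (P x)‖)) := by
        rw [norm_smul, Real.norm_of_nonneg hs.1]
        gcongr
        · exact hs.2
        · exact (W.le_opNorm _).trans (by gcongr)
    _ = (1 + ‖W‖ * M) * ‖x + s • W (P x)‖ := by ring

theorem quadraticMap_sub_sub (x y : X) :
    quadraticMap P D' B p₀ x - quadraticMap P D' B p₀ y -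
        (x - y + linearization D B (p₀ + P g) (p₀ + P g) (P (x - y))) =
      (D' - D) (P (x - y)) + (B (P (x - g)) (P (x - y)) + B (P (x - y)) (P (y - g))) := by
  simp only [quadraticMap, linearization, map_add, map_sub, _root_.add_apply, _root_.sub_apply,
    ContinuousLinearMap.flip_apply]
  abel

theorem norm_quadraticMap_sub_sub_le {x y : X} (hx : x ∈ closedBall g ε)
    (hy : y ∈ closedBall g ε) :
    ‖quadraticMap P D' B p₀ x - quadraticMap P D' B p₀ y -
        (x - y + linearization D B (p₀ + P g) (p₀ + P g) (P (x - y)))‖ ≤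
      (‖D' - D‖ * ‖P‖ + 2 * (‖B‖ * ‖P‖ ^ 2) * ε) * ‖x - y‖ := by
  rw [mem_closedBall, dist_eq_norm] at hx hy
  have hε : 0 ≤ ε := (norm_nonneg _).trans hx
  have hP : ‖P (x - y)‖ ≤ ‖P‖ * ‖x - y‖ := P.le_opNorm _
  have hPx : ‖P (x - g)‖ ≤ ‖P‖ * ε := (P.le_opNorm _).trans (by gcongr)
  have hPy : ‖P (y - g)‖ ≤ ‖P‖ * ε := (P.le_opNorm _).trans (by gcongr)
  rw [quadraticMap_sub_sub]
  calc _ ≤ ‖(D' - D) (P (x - y))‖ + (‖B (P (x - g)) (P (x - y))‖ + ‖B (P (x - y)) (P (y - g))‖) :=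
        norm_add_le_of_le le_rfl (norm_add_le _ _)
    _ ≤ ‖D' - D‖ * (‖P‖ * ‖x - y‖) + (‖B‖ * (‖P‖ * ε) * (‖P‖ * ‖x - y‖) +
          ‖B‖ * (‖P‖ * ‖x - y‖) * (‖P‖ * ε)) := by
        gcongr
        · exact (D' - D).le_opNorm_of_le hP
        · exact (B.le_opNorm₂ _ _).trans (by gcongr)
        · exact (B.le_opNorm₂ _ _).trans (by gcongr)
    _ = (‖D' - D‖ * ‖P‖ + 2 * (‖B‖ * ‖P‖ ^ 2) * ε) * ‖x - y‖ := by ring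

theorem add_linearization_eq_of_quadraticMap_eq
    (hg : quadraticMap P D' B p₀ g = D p₀ + B p₀ p₀) :
    g + linearization D' B (p₀ + P g) p₀ (P g) = (D - D') p₀ := by
  rw [← sub_eq_zero] at hg ⊢
  rw [← hg]
  simp only [quadraticMap, linearization, map_add, _root_.add_apply, _root_.sub_apply,
    ContinuousLinearMap.flip_apply]
  abel

theorem norm_segment_le {D₀ D₁ : Y →L[ℝ] X} {l : ℝ} (hl : l ∈ Icc (0 : ℝ) 1) :
    ‖(1 - l) • D₀ + l • D₁‖ ≤ ‖D₀‖ + ‖D₁‖ := by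
  refine (norm_add_le _ _).trans (add_le_add ?_ ?_) <;> rw [norm_smul]
  · rw [Real.norm_of_nonneg (by linarith [hl.2])]
    exact mul_le_of_le_one_left (norm_nonneg _) (by linarith [hl.1])
  · rw [Real.norm_of_nonneg hl.1]
    exact mul_le_of_le_one_left (norm_nonneg _) hl.2

theorem norm_le_of_quadraticMap_segment_eq {D₀ D₁ : Y →L[ℝ] X} {l : ℝ} (hl : l ∈ Icc (0 : ℝ) 1)
    (hM : 0 ≤ M)
    (h : ‖P g‖ ≤ M * ‖g + linearization ((1 - l) • D₀ + l • D₁) B (p₀ + P g) p₀ (P g)‖)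
    (hg : quadraticMap P ((1 - l) • D₀ + l • D₁) B p₀ g = D₀ p₀ + B p₀ p₀) :
    ‖p₀ + P g‖ ≤ ‖p₀‖ + M * (‖D₁ - D₀‖ * ‖p₀‖) := by
  rw [add_linearization_eq_of_quadraticMap_eq hg,
    show D₀ - ((1 - l) • D₀ + l • D₁) = -(l • (D₁ - D₀)) by module, _root_.neg_apply, norm_neg,
    _root_.smul_apply, norm_smul, Real.norm_of_nonneg hl.1] at h
  exact norm_add_le_of_le le_rfl (h.trans (mul_le_mul_of_nonneg_left
    ((mul_le_of_le_one_left (norm_nonneg _) hl.2).trans ((D₁ - D₀).le_opNorm _)) hM))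

variable [CompleteSpace X]

theorem exists_eq_of_norm_sub_sub_le {f : X → X} {L : X →L[ℝ] X} {M c ε : ℝ} (hM : 0 < M)
    (hL : Function.Surjective L) (hbelow : ∀ h, ‖h‖ ≤ M * ‖L h‖) (hc : 0 ≤ c) (hε : 0 ≤ ε) {g : X}
    (happrox : ∀ x ∈ closedBall g ε, ∀ y ∈ closedBall g ε,
      ‖f x - f y - L (x - y)‖ ≤ c * ‖x - y‖)
    (y : X) (hy : ‖y - f g‖ ≤ (M⁻¹ - c) * ε) : ∃ x, f x = y := by
  let R : L.NonlinearRightInverse :=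
    { toFun := Function.surjInv hL
      nnnorm := ⟨M, hM.le⟩
      bound' := fun y => by
        have h := hbelow (Function.surjInv hL y)
        rwa [Function.surjInv_eq hL] at h
      right_inv' := Function.surjInv_eq hL }
  have hf : ApproximatesLinearOn f L (closedBall g ε) ⟨c, hc⟩ :=
    fun x hx y hy => happrox x hx y hy
  have hmem : y ∈ closedBall (f g) (((R.nnnorm : ℝ)⁻¹ - (⟨c, hc⟩ : NNReal)) * ε) := by
    rw [mem_closedBall, dist_eq_norm]
    exact hy
  obtain ⟨x, -, hx⟩ := hf.surjOn_closedBall_of_nonlinearRightInverse R hε Subset.rfl hmem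
  exact ⟨x, hx⟩

theorem surjective_id_add_of_norm_le {T : X →L[ℝ] X} {M : ℝ} (hM : 0 < M)
    (h : ∀ s ∈ Icc (0 : ℝ) 1, ∀ x, ‖x‖ ≤ M * ‖x + s • T x‖) :
    Function.Surjective (ContinuousLinearMap.id ℝ X + T) := by
  obtain ⟨δ, hδ, hδT⟩ := exists_pos_mul_lt (half_pos (inv_pos.2 hM)) ‖T‖
  have hend := unit_interval_induction
    (Q := fun s => Function.Surjective (ContinuousLinearMap.id ℝ X + s • T)) hδ
    (by simpa using Function.surjective_id) ?_
  · simpa using hend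
  intro s hs hsurj s' _ hss y
  refine exists_eq_of_norm_sub_sub_le (f := ContinuousLinearMap.id ℝ X + s' • T)
    (L := ContinuousLinearMap.id ℝ X + s • T) (c := M⁻¹ / 2) (ε := 2 * M * ‖y‖) (g := 0) hM hsurj
    (h s hs) (by positivity) (by positivity) (fun x _ z _ => ?_) y (le_of_eq ?_)
  · calc ‖(ContinuousLinearMap.id ℝ X + s' • T) x - (ContinuousLinearMap.id ℝ X + s' • T) z -
          (ContinuousLinearMap.id ℝ X + s • T) (x - z)‖ = ‖(s' - s) • T (x - z)‖ := by
          rw [← map_sub, ← _root_.sub_apply, add_sub_add_left_eq_sub, ← sub_smul,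
            _root_.smul_apply]
      _ ≤ δ * (‖T‖ * ‖x - z‖) := by
          rw [norm_smul, Real.norm_eq_abs]
          gcongr
          exact T.le_opNorm _
      _ ≤ M⁻¹ / 2 * ‖x - z‖ := by
          rw [← mul_assoc, mul_comm δ]
          gcongr
  · rw [map_zero, sub_zero]
    field_simp
    ring

theorem exists_quadraticMap_eq (hM : 0 < M)
    (hlin : ∀ s ∈ Icc (0 : ℝ) 1, ∀ h,
      ‖h‖ ≤ M * ‖h + s • linearization D B (p₀ + P g) (p₀ + P g) (P h)‖)
    (hε : 0 ≤ ε) (hsmall : ‖D' - D‖ * ‖P‖ + 2 * (‖B‖ * ‖P‖ ^ 2) * ε ≤ M⁻¹ / 2) {y : X}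
    (hy : ‖y - quadraticMap P D' B p₀ g‖ ≤ M⁻¹ / 2 * ε) : ∃ x, quadraticMap P D' B p₀ x = y := by
  let T : X →L[ℝ] X := (linearization D B (p₀ + P g) (p₀ + P g)).comp P
  refine exists_eq_of_norm_sub_sub_le (L := ContinuousLinearMap.id ℝ X + T) (c := M⁻¹ / 2) hM
    (surjective_id_add_of_norm_le hM hlin) (fun h => ?_) (by positivity) hε (fun x hx z hz => ?_) y
    (hy.trans_eq (by ring))
  · change ‖h‖ ≤ M * ‖h + linearization D B (p₀ + P g) (p₀ + P g) (P h)‖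
    simpa only [one_smul] using hlin 1 (right_mem_Icc.2 zero_le_one) h
  · exact (norm_quadraticMap_sub_sub_le hx hz).trans (by gcongr)

theorem exists_quadraticMap_eq_of_norm_sub_le (hM : 0 < M)
    (hlin : ∀ s ∈ Icc (0 : ℝ) 1, ∀ h,
      ‖h‖ ≤ M * ‖h + s • linearization D B (p₀ + P g) (p₀ + P g) (P h)‖)
    (hε : 0 ≤ ε) (hεB : 2 * (‖B‖ * ‖P‖ ^ 2) * ε ≤ M⁻¹ / 4) {d R : ℝ} (hd : ‖D' - D‖ ≤ d)
    (hdP : d * ‖P‖ ≤ M⁻¹ / 4) (hR : ‖p₀ + P g‖ ≤ R) (hdR : d * R ≤ M⁻¹ / 2 * ε) {y : X}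
    (hg : quadraticMap P D B p₀ g = y) : ∃ x, quadraticMap P D' B p₀ x = y := by
  have hdP' : ‖D' - D‖ * ‖P‖ ≤ d * ‖P‖ := by gcongr
  have hdiff : y - quadraticMap P D' B p₀ g = -((D' - D) (p₀ + P g)) := by
    rw [← hg]
    simp only [quadraticMap, _root_.sub_apply]
    abel
  refine exists_quadraticMap_eq hM hlin hε (by linarith) ?_
  rw [hdiff, norm_neg]
  exact ((D' - D).le_of_opNorm_le_of_le hd hR).trans hdR

/-- The method of continuity along the segment from `D₀` to `D₁`, at whose left end `0` is a
solution. The hypothesis is an a priori estimate for all linearized equations: at `q = p₀` it bounds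
the solutions along the segment, at `p = q` the inverse of the derivative at a solution, so that
the length of the steps along the segment does not shrink. -/
theorem exists_quadraticMap_eq_of_apriori (D₀ D₁ : Y →L[ℝ] X)
    (hapriori : ∀ R : ℝ, ∃ M : ℝ, 0 < M ∧ ∀ l ∈ Icc (0 : ℝ) 1, ∀ s ∈ Icc (0 : ℝ) 1, ∀ p q : Y,
      ‖q‖ ≤ R → ∀ h : X,
        ‖P h‖ ≤ M * ‖h + s • linearization ((1 - l) • D₀ + l • D₁) B p q (P h)‖) :
    ∃ g : X, quadraticMap P D₁ B p₀ g = D₀ p₀ + B p₀ p₀ := by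
  let D : ℝ → Y →L[ℝ] X := fun l => (1 - l) • D₀ + l • D₁
  have hDsub : ∀ l l', D l' - D l = (l' - l) • (D₁ - D₀) := fun l l' => by module
  obtain ⟨M₀, hM₀, hest₀⟩ := hapriori ‖p₀‖
  set R := ‖p₀‖ + M₀ * (‖D₁ - D₀‖ * ‖p₀‖)
  have hbound : ∀ l ∈ Icc (0 : ℝ) 1, ∀ g, quadraticMap P (D l) B p₀ g = D₀ p₀ + B p₀ p₀ →
      ‖p₀ + P g‖ ≤ R := by
    intro l hl g hg
    have h := hest₀ l hl 1 (right_mem_Icc.2 zero_le_one) (p₀ + P g) p₀ le_rfl g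
    rw [one_smul] at h
    exact norm_le_of_quadraticMap_segment_eq hl hM₀.le h hg
  obtain ⟨M₁, hM₁, hest₁⟩ := hapriori R
  set M := 1 + (‖D₀‖ + ‖D₁‖ + ‖B‖ * R + ‖B‖ * R) * M₁ with hM
  have hM0 : 0 < M := by positivity
  have hlin : ∀ l ∈ Icc (0 : ℝ) 1, ∀ u : Y, ‖u‖ ≤ R → ∀ s ∈ Icc (0 : ℝ) 1, ∀ h : X,
      ‖h‖ ≤ M * ‖h + s • linearization (D l) B u u (P h)‖ := by
    intro l hl u hu s hs h
    refine (norm_le_mul_norm_add_smul hs (hest₁ l hl s hs u u hu h)).trans ?_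
    rw [hM]
    gcongr
    refine (norm_linearization_le u u).trans ?_
    gcongr
    exact norm_segment_le hl
  obtain ⟨ε, hε, hεB⟩ :=
    exists_pos_mul_lt (show 0 < M⁻¹ / 4 by positivity) (2 * (‖B‖ * ‖P‖ ^ 2))
  obtain ⟨δ, hδ, hδP⟩ :=
    exists_pos_mul_lt (show 0 < M⁻¹ / 4 by positivity) (‖D₁ - D₀‖ * ‖P‖)
  obtain ⟨δ', hδ', hδR⟩ :=
    exists_pos_mul_lt (show 0 < M⁻¹ / 2 * ε by positivity) (‖D₁ - D₀‖ * R)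
  have hend := unit_interval_induction
    (Q := fun l => ∃ g, quadraticMap P (D l) B p₀ g = D₀ p₀ + B p₀ p₀) (lt_min hδ hδ')
    ⟨0, by simp [D, quadraticMap]⟩ ?_
  · simpa [D] using hend
  rintro l hl ⟨g, hg⟩ l' - hll
  have hstep : ‖D l' - D l‖ ≤ min δ δ' * ‖D₁ - D₀‖ := by
    rw [hDsub, norm_smul, Real.norm_eq_abs]
    gcongr
  refine exists_quadraticMap_eq_of_norm_sub_le hM0 (hlin l hl _ (hbound l hl g hg)) hε.le hεB.le
    hstep ?_ (hbound l hl g hg) ?_ hg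
  · calc min δ δ' * ‖D₁ - D₀‖ * ‖P‖ ≤ δ * ‖D₁ - D₀‖ * ‖P‖ := by gcongr; exact min_le_left _ _
      _ ≤ M⁻¹ / 4 := by linarith
  · calc min δ δ' * ‖D₁ - D₀‖ * R ≤ δ' * ‖D₁ - D₀‖ * R := by gcongr; exact min_le_right _ _
      _ ≤ M⁻¹ / 2 * ε := by linarith

end Continuation

section Gronwall

variable {a b : ℝ} {y k : ℝ → ℝ}

theorem intervalIntegral_mul_le {s t m : ℝ} (hst : s ≤ t) (hk : IntervalIntegrable k volume s t)
    (hk0 : ∀ r, 0 ≤ k r) (hy : ContinuousOn y (Icc s t)) (hym : ∀ r ∈ Icc s t, y r ≤ m) :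
    ∫ r in s..t, k r * y r ≤ (∫ r in s..t, k r) * m := by
  rw [← intervalIntegral.integral_mul_const]
  refine intervalIntegral.integral_mono_on hst (hk.mul_continuousOn ?_) (hk.mul_const m)
    fun r hr => mul_le_mul_of_nonneg_left (hym r hr) (hk0 r)
  rwa [uIcc_of_le hst]

theorem add_intervalIntegral_le_two_mul {A s t : ℝ} (hy : ContinuousOn y (Icc a b))
    (hy0 : ∀ t ∈ Icc a b, 0 ≤ y t) (hk : Integrable k (timeMeasure a b)) (hk0 : ∀ t, 0 ≤ k t)
    (h : ∀ t ∈ Icc a b, y t ≤ A + ∫ s in a..t, k s * y s) (hs : s ∈ Icc a b) (ht : t ∈ Icc a b)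
    (hst : s ≤ t) (hhalf : ∫ r in s..t, k r ≤ 1 / 2) :
    A + ∫ r in a..t, k r * y r ≤ 2 * (A + ∫ r in a..s, k r * y r) := by
  have hkI : ∀ {s t}, s ∈ Icc a b → t ∈ Icc a b → IntervalIntegrable k volume s t :=
    fun hs ht => intervalIntegrable_of_integrable_Ioo hk hs ht
  have hkyI : ∀ {s t}, s ∈ Icc a b → t ∈ Icc a b →
      IntervalIntegrable (fun r => k r * y r) volume s t := fun hs ht =>
    (hkI hs ht).mul_continuousOn (hy.mono (uIcc_subset_Icc hs ht))
  have ha : a ∈ Icc a b := left_mem_Icc.2 (hs.1.trans hs.2)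
  have hsub : Icc s t ⊆ Icc a b := Icc_subset_Icc hs.1 ht.2
  obtain ⟨t₀, ht₀, hmax⟩ := isCompact_Icc.exists_isMaxOn (nonempty_Icc.2 hst) (hy.mono hsub)
  have hle : ∀ τ ∈ Icc s t, ∫ r in s..τ, k r * y r ≤ 1 / 2 * y t₀ := fun τ hτ => by
    have hm : 0 ≤ y t₀ := hy0 t₀ (hsub ht₀)
    have hkτ : ∫ r in s..τ, k r ≤ 1 / 2 := (intervalIntegral.integral_mono_interval le_rfl hτ.1
      hτ.2 (Filter.Eventually.of_forall hk0) (hkI hs ht)).trans hhalf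
    refine (intervalIntegral_mul_le hτ.1 (hkI hs (hsub hτ)) hk0
      (hy.mono (Icc_subset_Icc hs.1 (hsub hτ).2))
      fun r hr => hmax ⟨hr.1, hr.2.trans hτ.2⟩).trans ?_
    gcongr
  have hsplit : ∀ τ ∈ Icc a b, ∫ r in a..τ, k r * y r =
      (∫ r in a..s, k r * y r) + ∫ r in s..τ, k r * y r := fun τ hτ =>
    (intervalIntegral.integral_add_adjacent_intervals (hkyI ha hs) (hkyI hs hτ)).symm
  have hy₀ := h t₀ (hsub ht₀)
  rw [hsplit t₀ (hsub ht₀)] at hy₀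
  rw [hsplit t ht]
  linarith [hle t₀ ht₀, hle t (right_mem_Icc.2 hst)]

/-- Gronwall's inequality with a kernel that is merely integrable. The bound doubles on each of the
`n` consecutive intervals carrying mass `1 / 2` of the kernel. -/
theorem gronwall_doubling {A : ℝ} (hy : ContinuousOn y (Icc a b)) (hy0 : ∀ t ∈ Icc a b, 0 ≤ y t)
    (hk : Integrable k (timeMeasure a b)) (hk0 : ∀ t, 0 ≤ k t)
    (h : ∀ t ∈ Icc a b, y t ≤ A + ∫ s in a..t, k s * y s) (n : ℕ) {t : ℝ} (ht : t ∈ Icc a b)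
    (hn : ∫ s in a..t, k s ≤ n / 2) : A + ∫ s in a..t, k s * y s ≤ 2 ^ n * A := by
  induction n generalizing t with
  | zero =>
    have ha : a ∈ Icc a b := left_mem_Icc.2 (ht.1.trans ht.2)
    have hyt := hy.mono (Icc_subset_Icc_right ht.2)
    obtain ⟨m, hm, hmax⟩ := isCompact_Icc.exists_isMaxOn (nonempty_Icc.2 ht.1) hyt
    have hle := intervalIntegral_mul_le ht.1 (intervalIntegrable_of_integrable_Ioo hk ha ht) hk0
      hyt fun r hr => hmax hr
    have hnonpos : (∫ s in a..t, k s) * y m ≤ 0 := mul_nonpos_of_nonpos_of_nonneg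
      (by simpa using hn) (hy0 m ⟨hm.1, hm.2.trans ht.2⟩)
    linarith
  | succ n ih =>
    have ha : a ∈ Icc a b := left_mem_Icc.2 (ht.1.trans ht.2)
    have hA : 0 ≤ A := by simpa using (hy0 a ha).trans (h a ha)
    rw [pow_succ']
    rcases le_or_gt (∫ s in a..t, k s) (n / 2) with hle | hgt
    · have hpos : 0 ≤ (2 : ℝ) ^ n * A := by positivity
      linarith [ih ht hle]
    · obtain ⟨s, hs, hks⟩ := intermediate_value_Icc ht.1
        ((continuousOn_primitive hk).mono (Icc_subset_Icc_right ht.2))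
        (show (n : ℝ) / 2 ∈ Icc (primitive a k a) (primitive a k t) from
          ⟨by simp only [primitive, intervalIntegral.integral_same]; positivity, hgt.le⟩)
      have hs' : s ∈ Icc a b := ⟨hs.1, hs.2.trans ht.2⟩
      have hkI : ∀ {t}, t ∈ Icc a b → IntervalIntegrable k volume a t :=
        fun ht => intervalIntegrable_of_integrable_Ioo hk ha ht
      have hhalf : ∫ r in s..t, k r ≤ 1 / 2 := by
        rw [← intervalIntegral.integral_interval_sub_left (hkI ht) (hkI hs')]
        change (∫ r in a..t, k r) - primitive a k s ≤ 1 / 2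
        rw [hks]
        push_cast at hn
        linarith
      linarith [ih hs' hks.le, add_intervalIntegral_le_two_mul hy hy0 hk hk0 h hs' ht hs.2 hhalf]

theorem gronwall_energy {A c : ℝ} {η : ℝ → ℝ} (hab : a ≤ b) (hc : 0 ≤ c)
    (hy : ContinuousOn y (Icc a b)) (hy0 : ∀ t ∈ Icc a b, 0 ≤ y t)
    (hk : Integrable k (timeMeasure a b)) (hk0 : ∀ t, 0 ≤ k t) (hη : ∀ t, 0 ≤ η t)
    (h : ∀ t ∈ Icc a b, y t + c * ∫ s in a..t, η s ≤ A + ∫ s in a..t, k s * y s) {n : ℕ}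
    (hn : ∫ s in a..b, k s ≤ n / 2) :
    (∀ t ∈ Icc a b, y t ≤ 2 ^ n * A) ∧ c * ∫ s in a..b, η s ≤ 2 ^ n * A := by
  have ha : a ∈ Icc a b := left_mem_Icc.2 hab
  have hb : b ∈ Icc a b := right_mem_Icc.2 hab
  have hη0 : ∀ t ∈ Icc a b, 0 ≤ c * ∫ s in a..t, η s := fun t ht =>
    mul_nonneg hc (intervalIntegral.integral_nonneg ht.1 fun s _ => hη s)
  have hgron : ∀ t ∈ Icc a b, A + ∫ s in a..t, k s * y s ≤ 2 ^ n * A := fun t ht =>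
    gronwall_doubling hy hy0 hk hk0 (fun t ht => by linarith [h t ht, hη0 t ht]) n ht <|
      (intervalIntegral.integral_mono_interval le_rfl ht.1 ht.2 (Filter.Eventually.of_forall hk0)
        (intervalIntegrable_of_integrable_Ioo hk ha hb)).trans hn
  exact ⟨fun t ht => by linarith [h t ht, hη0 t ht, hgron t ht],
    by linarith [h b hb, hy0 b hb, hgron b hb]⟩

end Gronwall

section EnergySpace

section LTwo

variable {α E F F' : Type*} [MeasurableSpace α] {μ : Measure α} [NormedAddCommGroup E]
  [InnerProductSpace ℝ E] [NormedAddCommGroup F] [NormedAddCommGroup F']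

theorem norm_sq_eq_integral (f : Lp E 2 μ) : ‖f‖ ^ 2 = ∫ t, ‖f t‖ ^ 2 ∂μ := by
  rw [← real_inner_self_eq_norm_sq, L2.inner_def]
  simp only [real_inner_self_eq_norm_sq]

theorem integrable_norm_sq (f : Lp F 2 μ) : Integrable (fun t => ‖f t‖ ^ 2) μ :=
  (memLp_two_iff_integrable_sq_norm (Lp.aestronglyMeasurable f)).1 (Lp.memLp f)

theorem integral_norm_mul_norm_le (f : Lp F 2 μ) (g : Lp F' 2 μ) :
    ∫ t, ‖f t‖ * ‖g t‖ ∂μ ≤ ‖f‖ * ‖g‖ := by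
  have hf := (Lp.memLp f).norm
  have hg := (Lp.memLp g).norm
  calc ∫ t, ‖f t‖ * ‖g t‖ ∂μ = ⟪hf.toLp _, hg.toLp _⟫_ℝ := by
        rw [L2.inner_def]
        refine integral_congr_ae ?_
        filter_upwards [hf.coeFn_toLp, hg.coeFn_toLp] with t hft hgt
        rw [hft, hgt, real_inner_eq_re_inner]
        simp [mul_comm]
    _ ≤ ‖hf.toLp _‖ * ‖hg.toLp _‖ := real_inner_le_norm _ _
    _ = ‖f‖ * ‖g‖ := by
        rw [Lp.norm_toLp, Lp.norm_toLp, eLpNorm_norm, eLpNorm_norm, Lp.norm_def, Lp.norm_def]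

theorem ae_norm_le_norm_top (f : Lp F ⊤ μ) : ∀ᵐ t ∂μ, ‖f t‖ ≤ ‖f‖ := by
  filter_upwards [ae_le_eLpNormEssSup (f := f) (μ := μ)] with t ht
  rw [Lp.norm_def, ← toReal_enorm]
  exact ENNReal.toReal_mono (Lp.eLpNorm_ne_top f) (by rwa [eLpNorm_exponent_top])

end LTwo

variable {E G : Type*} [NormedAddCommGroup E] [InnerProductSpace ℝ E] [NormedAddCommGroup G]
  [InnerProductSpace ℝ G] {a b : ℝ} {ι : E →L[ℝ] G}

/-- The space `L²(a, b; E) ∩ L^∞(a, b; G)`, where `E` is mapped to `G` by `ι`, with the maximum of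
the two norms. An element is a pair `p`, and `p.1.1` is the underlying `E`-valued function. -/
def energySpace (a b : ℝ) (ι : E →L[ℝ] G) :
    Submodule ℝ (TimeL2 a b E × Lp G ⊤ (timeMeasure a b)) where
  carrier := {p | p.2 =ᵐ[timeMeasure a b] fun t => ι (p.1 t)}
  zero_mem' := by
    filter_upwards [Lp.coeFn_zero G ⊤ (timeMeasure a b), Lp.coeFn_zero E 2 (timeMeasure a b)]
      with t hG hE
    simp only [Prod.snd_zero, Prod.fst_zero, hG, hE, Pi.zero_apply, map_zero]
  add_mem' {p q} hp hq := by
    filter_upwards [hp, hq, Lp.coeFn_add p.1 q.1, Lp.coeFn_add p.2 q.2] with t hpt hqt hE hG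
    simp only [Prod.snd_add, Prod.fst_add, hG, hE, Pi.add_apply, map_add, hpt, hqt]
  smul_mem' c p hp := by
    filter_upwards [hp, Lp.coeFn_smul c p.1, Lp.coeFn_smul c p.2] with t hpt hE hG
    simp only [Prod.smul_snd, Prod.smul_fst, hG, hE, Pi.smul_apply, map_smul, hpt]

namespace energySpace

theorem ae_norm_map_le (p : energySpace a b ι) :
    ∀ᵐ t ∂(timeMeasure a b), ‖ι (p.1.1 t)‖ ≤ ‖p‖ := by
  filter_upwards [p.2, ae_norm_le_norm_top p.1.2] with t hpt hle
  rw [← hpt]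
  exact hle.trans (norm_snd_le p.1)

theorem norm_fst_le (p : energySpace a b ι) : ‖p.1.1‖ ≤ ‖p‖ :=
  _root_.norm_fst_le p.1

theorem norm_le {p : energySpace a b ι} {C : ℝ} (h₁ : ‖p.1.1‖ ≤ C)
    (h₂ : ∀ᵐ t ∂(timeMeasure a b), ‖ι (p.1.1 t)‖ ≤ C) : ‖p‖ ≤ C := by
  refine max_le h₁ ?_
  change ‖p.1.2‖ ≤ C
  rw [Lp.norm_def, eLpNorm_exponent_top]
  refine ENNReal.toReal_le_of_le_ofReal ((norm_nonneg _).trans h₁) (eLpNormEssSup_le_of_ae_bound ?_)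
  filter_upwards [p.2, h₂] with t hpt hle
  rwa [hpt]

theorem ext {p q : energySpace a b ι} (h : p.1.1 = q.1.1) : p = q := by
  refine Subtype.ext (Prod.ext h (Lp.ext ?_))
  filter_upwards [p.2, q.2] with t hp hq
  rw [hp, hq, h]

theorem exists_fst_eq {z : TimeL2 a b E} {C : ℝ}
    (h : ∀ᵐ t ∂(timeMeasure a b), ‖ι (z t)‖ ≤ C) : ∃ p : energySpace a b ι, p.1.1 = z := by
  have hm : MemLp (fun t => ι (z t)) ⊤ (timeMeasure a b) :=
    memLp_top_of_bound (ι.continuous.comp_aestronglyMeasurable (Lp.aestronglyMeasurable z)) C h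
  exact ⟨⟨(z, hm.toLp _), hm.coeFn_toLp⟩, rfl⟩

theorem exists_lift {X : Type*} [NormedAddCommGroup X] [NormedSpace ℝ X]
    (P : X →L[ℝ] TimeL2 a b E) {C : ℝ}
    (h : ∀ x, ∀ᵐ t ∂(timeMeasure a b), ‖ι (P x t)‖ ≤ C * ‖x‖) :
    ∃ Q : X →L[ℝ] energySpace a b ι, ∀ x, (Q x).1.1 = P x := by
  choose Q hQ using fun x => exists_fst_eq (h x)
  let L : X →ₗ[ℝ] energySpace a b ι :=
    { toFun := Q
      map_add' := fun x y => ext <| by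
        change _ = (Q x).1.1 + (Q y).1.1
        rw [hQ, hQ, hQ, map_add]
      map_smul' := fun r x => ext <| by
        change _ = r • (Q x).1.1
        rw [hQ, hQ, map_smul] }
  refine ⟨L.mkContinuous (max ‖P‖ C) fun x => norm_le ?_ ?_, hQ⟩
  · exact (congrArg norm (hQ x)).le.trans (P.le_of_opNorm_le (le_max_left _ _) x)
  · filter_upwards [h x] with t ht
    have hle : C * ‖x‖ ≤ max ‖P‖ C * ‖x‖ := by
      gcongr
      exact le_max_right _ _
    exact (congrArg (fun z : TimeL2 a b E => ‖ι (z t)‖) (hQ x)).le.trans (ht.trans hle)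

end energySpace

/-- Ladyzhenskaya's inequality and the orthogonality relation for the advection term of the planar
Navier–Stokes equations, `B u v` being the functional `w ↦ ∫ (u · ∇v) · w` on `E`. The space `G`
stands for `L²`, and the norm of `E` for that of the gradient. -/
structure IsAdvection (ι : E →L[ℝ] G) (B : E →L[ℝ] E →L[ℝ] E) (K : ℝ) : Prop where
  nonneg : 0 ≤ K
  norm_sq_le : ∀ u v, ‖B u v‖ ^ 2 ≤ K * ((‖ι u‖ * ‖u‖) * (‖ι v‖ * ‖v‖))
  inner_eq_zero : ∀ u v, ⟪B u v, v⟫_ℝ = 0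

variable {B : E →L[ℝ] E →L[ℝ] E} {K : ℝ}

theorem IsAdvection.ae_norm_sq_le (hB : IsAdvection ι B K) (p q : energySpace a b ι) :
    ∀ᵐ t ∂(timeMeasure a b), ‖B (p.1.1 t) (q.1.1 t)‖ ^ 2 ≤
      K * (‖p‖ * ‖q‖) * (‖p.1.1 t‖ * ‖q.1.1 t‖) := by
  filter_upwards [energySpace.ae_norm_map_le p, energySpace.ae_norm_map_le q] with t hp hq
  have hK := hB.nonneg
  calc _ ≤ K * ((‖p‖ * ‖p.1.1 t‖) * (‖q‖ * ‖q.1.1 t‖)) :=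
        (hB.norm_sq_le _ _).trans (by gcongr)
    _ = _ := by ring

theorem IsAdvection.memLp_two (hB : IsAdvection ι B K) (p q : energySpace a b ι) :
    MemLp (fun t => B (p.1.1 t) (q.1.1 t)) 2 (timeMeasure a b) := by
  have hmeas : AEStronglyMeasurable (fun t => B (p.1.1 t) (q.1.1 t)) (timeMeasure a b) :=
    B.aestronglyMeasurable_comp₂ (Lp.aestronglyMeasurable p.1.1) (Lp.aestronglyMeasurable q.1.1)
  refine (memLp_two_iff_integrable_sq_norm hmeas).2 <|
    ((MemLp.integrable_mul (Lp.memLp p.1.1).norm (Lp.memLp q.1.1).norm).const_mul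
      (K * (‖p‖ * ‖q‖))).mono' (hmeas.norm.pow 2) ?_
  filter_upwards [hB.ae_norm_sq_le p q] with t ht
  rwa [Real.norm_of_nonneg (by positivity)]

theorem IsAdvection.norm_toLp_le (hB : IsAdvection ι B K) (p q : energySpace a b ι) :
    ‖(hB.memLp_two p q).toLp _‖ ≤ √K * ‖p‖ * ‖q‖ := by
  have hK := hB.nonneg
  have hm := hB.memLp_two p q
  refine le_of_sq_le_sq ?_ (by positivity)
  calc ‖hm.toLp _‖ ^ 2 = ∫ t, ‖B (p.1.1 t) (q.1.1 t)‖ ^ 2 ∂(timeMeasure a b) := by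
        rw [norm_sq_eq_integral]
        refine integral_congr_ae ?_
        filter_upwards [hm.coeFn_toLp] with t ht
        rw [ht]
    _ ≤ ∫ t, K * (‖p‖ * ‖q‖) * (‖p.1.1 t‖ * ‖q.1.1 t‖) ∂(timeMeasure a b) :=
        integral_mono_ae ((memLp_two_iff_integrable_sq_norm hm.1).1 hm)
          ((MemLp.integrable_mul (Lp.memLp p.1.1).norm (Lp.memLp q.1.1).norm).const_mul _)
          (hB.ae_norm_sq_le p q)
    _ = K * (‖p‖ * ‖q‖) * ∫ t, ‖p.1.1 t‖ * ‖q.1.1 t‖ ∂(timeMeasure a b) := integral_const_mul _ _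
    _ ≤ K * (‖p‖ * ‖q‖) * (‖p‖ * ‖q‖) := by
        gcongr
        refine (integral_norm_mul_norm_le _ _).trans ?_
        gcongr
        · exact energySpace.norm_fst_le p
        · exact energySpace.norm_fst_le q
    _ = (√K * ‖p‖ * ‖q‖) ^ 2 := by rw [mul_pow, mul_pow, Real.sq_sqrt hK]; ring

theorem IsAdvection.exists_operator (hB : IsAdvection ι B K) (a b : ℝ) :
    ∃ Q : energySpace a b ι →L[ℝ] energySpace a b ι →L[ℝ] TimeL2 a b E, ∀ p q,
      Q p q =ᵐ[timeMeasure a b] fun t => B (p.1.1 t) (q.1.1 t) := by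
  have hadd : ∀ p q : energySpace a b ι, ∀ᵐ t ∂(timeMeasure a b),
      (p + q).1.1 t = p.1.1 t + q.1.1 t := fun p q => Lp.coeFn_add p.1.1 q.1.1
  have hsmul : ∀ (c : ℝ) (p : energySpace a b ι), ∀ᵐ t ∂(timeMeasure a b),
      (c • p).1.1 t = c • p.1.1 t := fun c p => Lp.coeFn_smul c p.1.1
  refine ⟨LinearMap.mkContinuous₂ (LinearMap.mk₂ ℝ (fun p q => (hB.memLp_two p q).toLp _)
    (fun p p' q => ?_) (fun c p q => ?_) (fun p q q' => ?_) fun c p q => ?_) (√K)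
    hB.norm_toLp_le, fun p q => (hB.memLp_two p q).coeFn_toLp⟩
  · rw [← MemLp.toLp_add, MemLp.toLp_eq_toLp_iff]
    filter_upwards [hadd p p'] with t ht
    rw [ht, Pi.add_apply, map_add, _root_.add_apply]
  · rw [← MemLp.toLp_const_smul, MemLp.toLp_eq_toLp_iff]
    filter_upwards [hsmul c p] with t ht
    rw [ht, Pi.smul_apply, map_smul, _root_.smul_apply]
  · rw [← MemLp.toLp_add, MemLp.toLp_eq_toLp_iff]
    filter_upwards [hadd q q'] with t ht
    rw [ht, Pi.add_apply, map_add]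
  · rw [← MemLp.toLp_const_smul, MemLp.toLp_eq_toLp_iff]
    filter_upwards [hsmul c q] with t ht
    rw [ht, Pi.smul_apply, map_smul]

end EnergySpace

section Perturbation

theorem young_quadratic {c K m x Q β : ℝ} (hc : 0 < c) (h : β ^ 2 ≤ K * ((x * m) * Q)) :
    β * m ≤ c / 4 * m ^ 2 + 8 * K ^ 2 / c ^ 3 * (Q ^ 2 * x ^ 2) := by
  have h₁ : β * m ≤ c / 8 * m ^ 2 + 2 / c * β ^ 2 := by
    have hsq : 0 ≤ (c / 4 * m - β) ^ 2 * (2 / c) := by positivity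
    have hexpand : (c / 4 * m - β) ^ 2 * (2 / c) = c / 8 * m ^ 2 + 2 / c * β ^ 2 - β * m := by
      field_simp; ring
    linarith
  have h₂ : 2 / c * β ^ 2 ≤ 2 / c * (K * ((x * m) * Q)) := by gcongr
  have h₃ : 2 / c * (K * ((x * m) * Q)) ≤ c / 8 * m ^ 2 + 8 * K ^ 2 / c ^ 3 * (Q ^ 2 * x ^ 2) := by
    have hsq : 0 ≤ (c / 4 * m - 2 / c * (K * x * Q)) ^ 2 * (2 / c) := by positivity
    have hexpand : (c / 4 * m - 2 / c * (K * x * Q)) ^ 2 * (2 / c) =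
        c / 8 * m ^ 2 + 8 * K ^ 2 / c ^ 3 * (Q ^ 2 * x ^ 2) - 2 / c * (K * ((x * m) * Q)) := by
      field_simp; ring
    linarith
  linarith

variable {E G : Type*} [NormedAddCommGroup E] [InnerProductSpace ℝ E] [NormedAddCommGroup G]
  [InnerProductSpace ℝ G] {a b c K R s : ℝ} {ι : E →L[ℝ] G} {A D : E →L[ℝ] E}
  {B : E →L[ℝ] E →L[ℝ] E}

theorem two_mul_inner_sub_le (hc : 0 < c) (hA : ∀ v, c * ‖v‖ ^ 2 ≤ ⟪A v, v⟫_ℝ)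
    (hD : ∀ v, 0 ≤ ⟪D v, v⟫_ℝ) (hB : IsAdvection ι B K) (hs : s ∈ Icc (0 : ℝ) 1) {h p q r v : E}
    (hr : r = h + s • (D v + B p v + B v q)) :
    2 * ⟪h - A v, v⟫_ℝ ≤ -c * ‖v‖ ^ 2 + 2 / c * ‖r‖ ^ 2 +
      16 * K ^ 2 / c ^ 3 * (‖ι q‖ * ‖q‖) ^ 2 * ‖ι v‖ ^ 2 := by
  have hinner : ⟪h - A v, v⟫_ℝ = ⟪r, v⟫_ℝ - s * ⟪D v, v⟫_ℝ - s * ⟪B v q, v⟫_ℝ - ⟪A v, v⟫_ℝ := by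
    rw [hr, inner_sub_left, inner_add_left, real_inner_smul_left, inner_add_left, inner_add_left,
      hB.inner_eq_zero]
    ring
  have hBv : -(s * ⟪B v q, v⟫_ℝ) ≤ ‖B v q‖ * ‖v‖ := by
    refine (neg_le_abs _).trans ?_
    rw [abs_mul, abs_of_nonneg hs.1]
    exact (mul_le_of_le_one_left (abs_nonneg _) hs.2).trans (abs_real_inner_le_norm _ _)
  have hrv : ⟪r, v⟫_ℝ ≤ c / 4 * ‖v‖ ^ 2 + 1 / c * ‖r‖ ^ 2 := by
    have hsq : 0 ≤ (c / 2 * ‖v‖ - ‖r‖) ^ 2 * (1 / c) := by positivity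
    have hexpand : (c / 2 * ‖v‖ - ‖r‖) ^ 2 * (1 / c) =
        c / 4 * ‖v‖ ^ 2 + 1 / c * ‖r‖ ^ 2 - ‖r‖ * ‖v‖ := by field_simp; ring
    linarith [real_inner_le_norm r v]
  calc 2 * ⟪h - A v, v⟫_ℝ ≤ 2 * (c / 4 * ‖v‖ ^ 2 + 1 / c * ‖r‖ ^ 2 +
        (c / 4 * ‖v‖ ^ 2 + 8 * K ^ 2 / c ^ 3 * ((‖ι q‖ * ‖q‖) ^ 2 * ‖ι v‖ ^ 2)) - c * ‖v‖ ^ 2) := by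
        rw [hinner]
        linarith [hA v, mul_nonneg hs.1 (hD v), young_quadratic hc (hB.norm_sq_le v q)]
    _ = _ := by ring

/-- The superposition operator `p ↦ D ∘ p` of `D : E →L[ℝ] E` on the energy space. -/
def energySpace.superposition (a b : ℝ) (ι : E →L[ℝ] G) :
    (E →L[ℝ] E) →ₗ[ℝ] energySpace a b ι →L[ℝ] TimeL2 a b E where
  toFun D := (D.compLpL 2 _).comp
    ((ContinuousLinearMap.fst ℝ _ _).comp (energySpace a b ι).subtypeL)
  map_add' D D' := by rw [ContinuousLinearMap.add_compLpL, ContinuousLinearMap.add_comp]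
  map_smul' c D := by
    rw [ContinuousLinearMap.smul_compLpL, ContinuousLinearMap.smul_comp, RingHom.id_apply]

theorem energySpace.coeFn_superposition (D : E →L[ℝ] E) (p : energySpace a b ι) :
    superposition a b ι D p =ᵐ[timeMeasure a b] fun t => D (p.1.1 t) :=
  D.coeFn_compLpL (p := 2) p.1.1

variable {Q : energySpace a b ι →L[ℝ] energySpace a b ι →L[ℝ] TimeL2 a b E}

theorem coeFn_linearization (hQ : ∀ p q, Q p q =ᵐ[timeMeasure a b] fun t => B (p.1.1 t) (q.1.1 t))
    (p q y : energySpace a b ι) :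
    linearization (energySpace.superposition a b ι D) Q p q y =ᵐ[timeMeasure a b] fun t =>
      D (y.1.1 t) + B (p.1.1 t) (y.1.1 t) + B (y.1.1 t) (q.1.1 t) := by
  filter_upwards [Lp.coeFn_add (energySpace.superposition a b ι D y + Q p y) (Q y q),
    Lp.coeFn_add (energySpace.superposition a b ι D y) (Q p y),
    energySpace.coeFn_superposition D y, hQ p y, hQ y q] with t h₁ h₂ hD hpy hyq
  refine h₁.trans ?_
  rw [Pi.add_apply, h₂, Pi.add_apply, hD, hpy, hyq]

theorem ae_eq_of_quadraticMap_eq {D₀ D₁ : E →L[ℝ] E}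
    (hQ : ∀ p q, Q p q =ᵐ[timeMeasure a b] fun t => B (p.1.1 t) (q.1.1 t))
    {P : TimeL2 a b E →L[ℝ] energySpace a b ι} {p : energySpace a b ι} {g : TimeL2 a b E}
    (hg : quadraticMap P (energySpace.superposition a b ι D₁) Q p g =
      energySpace.superposition a b ι D₀ p + Q p p) :
    ∀ᵐ t ∂(timeMeasure a b), g t + D₁ (p.1.1 t + (P g).1.1 t) +
        B (p.1.1 t + (P g).1.1 t) (p.1.1 t + (P g).1.1 t) =
      D₀ (p.1.1 t) + B (p.1.1 t) (p.1.1 t) := by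
  set S := energySpace.superposition a b ι
  set u := p + P g
  have hu : ∀ᵐ t ∂(timeMeasure a b), u.1.1 t = p.1.1 t + (P g).1.1 t := Lp.coeFn_add _ _
  filter_upwards [hu, Lp.ext_iff.1 hg, Lp.coeFn_add (g + S D₁ u) (Q u u), Lp.coeFn_add g (S D₁ u),
    Lp.coeFn_add (S D₀ p) (Q p p), energySpace.coeFn_superposition D₁ u,
    energySpace.coeFn_superposition D₀ p, hQ u u, hQ p p]
    with t hut hgt h₁ h₂ h₃ hD₁ hD₀ hQu hQp
  rw [← hut]
  refine Eq.trans ?_ ((h₁.symm.trans hgt).trans (h₃.trans ?_))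
  · rw [Pi.add_apply, h₂, Pi.add_apply, hD₁, hQu]
  · rw [Pi.add_apply, hD₀, hQp]

variable [CompleteSpace E] [CompleteSpace G]

theorem energy_inequality (hab : a ≤ b) (hc : 0 < c) (hA : ∀ v, c * ‖v‖ ^ 2 ≤ ⟪A v, v⟫_ℝ)
    (hD : ∀ v, 0 ≤ ⟪D v, v⟫_ℝ) (hB : IsAdvection ι B K) (hs : s ∈ Icc (0 : ℝ) 1)
    {h r y q : TimeL2 a b E} {p : ℝ → E} (hq : ∀ᵐ t ∂(timeMeasure a b), ‖ι (q t)‖ ≤ R)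
    (hy : gram a b ι y = volterra a b E (h - A.compLpL 2 _ y))
    (hr : ∀ᵐ t ∂(timeMeasure a b), r t = h t + s • (D (y t) + B (p t) (y t) + B (y t) (q t))) :
    ∃ ζ : ℝ → G, ContinuousOn ζ (Icc a b) ∧ (∀ᵐ t ∂(timeMeasure a b), ζ t = ι (y t)) ∧
      ∀ t ∈ Icc a b, ‖ζ t‖ ^ 2 + c * ∫ τ in a..t, ‖y τ‖ ^ 2 ≤ 2 / c * ‖r‖ ^ 2 +
        ∫ τ in a..t, 16 * K ^ 2 / c ^ 3 * R ^ 2 * ‖q τ‖ ^ 2 * ‖ζ τ‖ ^ 2 := by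
  obtain ⟨ζ, hζc, -, hζ, henergy⟩ := exists_continuous_representative hab ι hy
  refine ⟨ζ, hζc, hζ, fun t ht => ?_⟩
  have ha : a ∈ Icc a b := left_mem_Icc.2 hab
  have hsqI : ∀ x : TimeL2 a b E, IntervalIntegrable (fun τ => ‖x τ‖ ^ 2) volume a t := fun x =>
    intervalIntegrable_of_integrable_Ioo (integrable_norm_sq x) ha ht
  have hkI : IntervalIntegrable
      (fun τ => 16 * K ^ 2 / c ^ 3 * R ^ 2 * ‖q τ‖ ^ 2 * ‖ζ τ‖ ^ 2) volume a t :=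
    ((hsqI q).const_mul _).mul_continuousOn ((hζc.norm.pow 2).mono (uIcc_subset_Icc ha ht))
  have hpointwise : ∀ᵐ τ ∂(timeMeasure a b), 2 * ⟪(h - A.compLpL 2 _ y : TimeL2 a b E) τ, y τ⟫_ℝ ≤
      -c * ‖y τ‖ ^ 2 + 2 / c * ‖r τ‖ ^ 2 +
        16 * K ^ 2 / c ^ 3 * R ^ 2 * ‖q τ‖ ^ 2 * ‖ζ τ‖ ^ 2 := by
    filter_upwards [hr, hζ, hq, Lp.coeFn_sub h (A.compLpL 2 _ y), A.coeFn_compLpL (p := 2) y]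
      with τ hrτ hζτ hqτ hsub hAy
    rw [hsub, Pi.sub_apply, hAy, hζτ]
    refine (two_mul_inner_sub_le hc hA hD hB hs hrτ).trans ?_
    rw [mul_assoc (16 * K ^ 2 / c ^ 3) (R ^ 2), ← mul_pow]
    gcongr
  have hintegral := intervalIntegral.integral_mono_ae_restrict ht.1
    ((intervalIntegrable_inner (h - A.compLpL 2 _ y) y ha ht).const_mul 2)
    ((((hsqI y).const_mul (-c)).add ((hsqI r).const_mul (2 / c))).add hkI) (by
      rw [Filter.EventuallyLE, ← restrict_Ioo_eq_restrict_Icc]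
      exact ae_timeMeasure_mono hpointwise le_rfl ht.2)
  rw [intervalIntegral.integral_const_mul, ← henergy t ht,
    intervalIntegral.integral_add (((hsqI y).const_mul _).add ((hsqI r).const_mul _)) hkI,
    intervalIntegral.integral_add ((hsqI y).const_mul _) ((hsqI r).const_mul _),
    intervalIntegral.integral_const_mul, intervalIntegral.integral_const_mul] at hintegral
  have hrle : ∫ τ in a..t, ‖r τ‖ ^ 2 ≤ ‖r‖ ^ 2 := by
    have hle := (le_abs_self _).trans (abs_intervalIntegral_inner_le r r ht)
    simpa only [real_inner_self_eq_norm_sq, ← sq] using hle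
  have hrle' : 2 / c * ∫ τ in a..t, ‖r τ‖ ^ 2 ≤ 2 / c * ‖r‖ ^ 2 := by gcongr
  linarith

theorem exists_apriori_estimate (hab : a ≤ b) (hc : 0 < c) (hA : ∀ v, c * ‖v‖ ^ 2 ≤ ⟪A v, v⟫_ℝ)
    (hB : IsAdvection ι B K) (R : ℝ) :
    ∃ M : ℝ, 0 < M ∧ ∀ D : E →L[ℝ] E, (∀ v, 0 ≤ ⟪D v, v⟫_ℝ) → ∀ s ∈ Icc (0 : ℝ) 1,
      ∀ (p q y : energySpace a b ι) (h r : TimeL2 a b E), ‖q‖ ≤ R →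
        gram a b ι y.1.1 = volterra a b E (h - A.compLpL 2 _ y.1.1) →
        (∀ᵐ t ∂(timeMeasure a b), r t =
          h t + s • (D (y.1.1 t) + B (p.1.1 t) (y.1.1 t) + B (y.1.1 t) (q.1.1 t))) →
        ‖y‖ ≤ M * ‖r‖ := by
  set κ := 16 * K ^ 2 / c ^ 3 * R ^ 2
  obtain ⟨n, hn⟩ := exists_nat_gt (2 * (κ * R ^ 2))
  set L := 2 ^ n * (2 / c) with hL
  have _ : 0 < L := by positivity
  refine ⟨√(L / c + L), Real.sqrt_pos.2 (by positivity), fun D hD s hs p q y h r hq hy hr => ?_⟩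
  have hle_of_sq : ∀ x : ℝ, x ^ 2 ≤ (L / c + L) * ‖r‖ ^ 2 → x ≤ √(L / c + L) * ‖r‖ :=
    fun x hx => le_of_sq_le_sq (by rwa [mul_pow, Real.sq_sqrt (by positivity)]) (by positivity)
  have hqι : ∀ᵐ t ∂(timeMeasure a b), ‖ι (q.1.1 t)‖ ≤ R := by
    filter_upwards [energySpace.ae_norm_map_le q] with t ht using ht.trans hq
  obtain ⟨ζ, hζc, hζ, henergy⟩ := energy_inequality hab hc hA hD hB hs hqι hy hr
  have hkint : ∫ τ in a..b, κ * ‖q.1.1 τ‖ ^ 2 ≤ n / 2 := by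
    rw [intervalIntegral.integral_const_mul, ← integral_Ioo_eq_intervalIntegral _ hab,
      ← norm_sq_eq_integral]
    have hqR : κ * ‖q.1.1‖ ^ 2 ≤ κ * R ^ 2 := by
      gcongr
      exact (energySpace.norm_fst_le q).trans hq
    linarith
  obtain ⟨hsup, hint⟩ := gronwall_energy (y := fun t => ‖ζ t‖ ^ 2) hab hc.le (hζc.norm.pow 2)
    (fun _ _ => by positivity) ((integrable_norm_sq q.1.1).const_mul κ) (fun _ => by positivity)
    (fun _ => by positivity) henergy hkint
  have hsq : 0 ≤ L / c * ‖r‖ ^ 2 ∧ 0 ≤ L * ‖r‖ ^ 2 := ⟨by positivity, by positivity⟩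
  refine energySpace.norm_le (hle_of_sq _ ?_) ?_
  · rw [← integral_Ioo_eq_intervalIntegral _ hab, ← norm_sq_eq_integral, ← mul_assoc, ← hL,
      ← le_div_iff₀' hc, mul_div_right_comm] at hint
    linarith
  · filter_upwards [hζ, ae_restrict_mem measurableSet_Ioo] with t hζt ht
    have hle := hsup t (Ioo_subset_Icc_self ht)
    rw [hζt, ← mul_assoc, ← hL] at hle
    exact hle_of_sq _ (by linarith)

theorem ae_norm_map_sq_le (hab : a ≤ b) {f z : TimeL2 a b E}
    (h : gram a b ι z = volterra a b E f) :
    ∀ᵐ t ∂(timeMeasure a b), ‖ι (z t)‖ ^ 2 ≤ 2 * (‖f‖ * ‖z‖) := by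
  obtain ⟨ζ, -, -, hζ, henergy⟩ := exists_continuous_representative hab ι h
  filter_upwards [hζ, ae_restrict_mem measurableSet_Ioo] with t hζt ht
  have ht' := Ioo_subset_Icc_self ht
  rw [← hζt, henergy t ht']
  gcongr
  exact (le_abs_self _).trans (abs_intervalIntegral_inner_le f z ht')

theorem exists_parabolic_solution_operator_energySpace (hab : a ≤ b) (ι : E →L[ℝ] G) (hc : 0 < c)
    (hA : ∀ v, c * ‖v‖ ^ 2 ≤ ⟪A v, v⟫_ℝ) :
    ∃ P : TimeL2 a b E →L[ℝ] energySpace a b ι, ∀ g,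
      gram a b ι (P g).1.1 = volterra a b E (g - A.compLpL 2 _ (P g).1.1) := by
  obtain ⟨P, hP⟩ := exists_parabolic_solution_operator hab ι hc hA
  set S := ContinuousLinearMap.id ℝ (TimeL2 a b E) - (A.compLpL 2 _).comp P
  obtain ⟨Q, hQ⟩ := energySpace.exists_lift (ι := ι) P (C := √(2 * (‖S‖ * ‖P‖))) fun g => by
    filter_upwards [ae_norm_map_sq_le hab (hP g)] with t ht
    refine le_of_sq_le_sq (ht.trans ?_) (by positivity)
    rw [mul_pow, Real.sq_sqrt (by positivity)]
    calc 2 * (‖S g‖ * ‖P g‖) ≤ 2 * (‖S‖ * ‖g‖ * (‖P‖ * ‖g‖)) := by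
          gcongr <;> exact ContinuousLinearMap.le_opNorm _ _
      _ = _ := by ring
  exact ⟨Q, fun g => by rw [hQ]; exact hP g⟩

theorem exists_perturbed_solution (hab : a ≤ b) (hc : 0 < c) (hA : ∀ v, c * ‖v‖ ^ 2 ≤ ⟪A v, v⟫_ℝ)
    (hB : IsAdvection ι B K) {D₀ D₁ : E →L[ℝ] E} (hD₀ : ∀ v, 0 ≤ ⟪D₀ v, v⟫_ℝ)
    (hD₁ : ∀ v, 0 ≤ ⟪D₁ v, v⟫_ℝ) (p : energySpace a b ι) :
    ∃ g z : TimeL2 a b E, gram a b ι z = volterra a b E (g - A.compLpL 2 _ z) ∧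
      ∀ᵐ t ∂(timeMeasure a b), g t + D₁ (p.1.1 t + z t) + B (p.1.1 t + z t) (p.1.1 t + z t) =
        D₀ (p.1.1 t) + B (p.1.1 t) (p.1.1 t) := by
  obtain ⟨P, hP⟩ := exists_parabolic_solution_operator_energySpace hab ι hc hA
  obtain ⟨Q, hQ⟩ := hB.exists_operator a b
  set S := energySpace.superposition a b ι
  have hapriori : ∀ R : ℝ, ∃ M : ℝ, 0 < M ∧ ∀ l ∈ Icc (0 : ℝ) 1, ∀ s ∈ Icc (0 : ℝ) 1,
      ∀ u q : energySpace a b ι, ‖q‖ ≤ R → ∀ h : TimeL2 a b E,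
        ‖P h‖ ≤ M * ‖h + s • linearization ((1 - l) • S D₀ + l • S D₁) Q u q (P h)‖ := by
    intro R
    obtain ⟨M, hM, hest⟩ := exists_apriori_estimate hab hc hA hB R
    refine ⟨M, hM, fun l hl s hs u q hq h => ?_⟩
    have hseg : (1 - l) • S D₀ + l • S D₁ = S ((1 - l) • D₀ + l • D₁) := by
      rw [map_add, map_smul, map_smul]
    rw [hseg]
    refine hest ((1 - l) • D₀ + l • D₁) (fun v => ?_) s hs u q (P h) h _ hq (hP h) ?_
    · simp only [_root_.add_apply, _root_.smul_apply, inner_add_left, real_inner_smul_left]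
      exact add_nonneg (mul_nonneg (by linarith [hl.2]) (hD₀ v)) (mul_nonneg hl.1 (hD₁ v))
    · set W := linearization (S ((1 - l) • D₀ + l • D₁)) Q u q (P h) with hW
      filter_upwards [Lp.coeFn_add h (s • W), Lp.coeFn_smul s W, coeFn_linearization hQ u q (P h)]
        with t hadd hsmul hlin
      rw [hadd, Pi.add_apply, hsmul, Pi.smul_apply, hW, hlin]
  obtain ⟨g, hg⟩ := exists_quadraticMap_eq_of_apriori (p₀ := p) (S D₀) (S D₁) hapriori
  exact ⟨g, (P g).1.1, hP g, ae_eq_of_quadraticMap_eq hQ hg⟩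

end Perturbation

/-! ### The function spaces -/

section Spaces

variable {Ω : Set Plane}

/-- The trace of a matrix, as a continuous linear functional. -/
def traceL : Mat2 →L[ℝ] ℝ := ∑ i : Fin 2, EuclideanSpace.proj (i, i)

theorem traceL_apply (M : Mat2) : traceL M = ∑ i : Fin 2, M (i, i) := by
  simp [traceL]

theorem traceFree_eq_ker (Ω : Set Plane) : traceFree Ω =
    ((traceL.compLpL 2 (volume.restrict Ω)).comp
      (WithLp.sndL 2 ℝ (L2 Ω Plane) (L2 Ω Mat2))).ker := by
  ext p
  have htrace := traceL.coeFn_compLpL (p := 2) p.snd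
  change (∀ᵐ x ∂(volume.restrict Ω), ∑ i : Fin 2, p.snd x (i, i) = 0) ↔
    traceL.compLpL 2 (volume.restrict Ω) p.snd = 0
  rw [Lp.eq_zero_iff_ae_eq_zero]
  refine Filter.eventually_congr ?_
  filter_upwards [htrace] with x hx
  rw [hx, traceL_apply, Pi.zero_apply]

theorem isClosed_V (Ω : Set Plane) : IsClosed (V Ω : Set (FieldPair Ω)) := by
  refine (Submodule.isClosed_topologicalClosure _).inter ?_
  rw [traceFree_eq_ker]
  exact ContinuousLinearMap.isClosed_ker _

instance instCompleteSpaceV (Ω : Set Plane) : CompleteSpace (V Ω) :=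
  (isClosed_V Ω).completeSpace_coe

/-- The embedding of `V` in `L²`. -/
def embedL (Ω : Set Plane) : V Ω →L[ℝ] L2 Ω Plane := (WithLp.fstL 2 ℝ _ _).comp (V Ω).subtypeL

/-- The gradient on `V`. -/
def gradL (Ω : Set Plane) : V Ω →L[ℝ] L2 Ω Mat2 := (WithLp.sndL 2 ℝ _ _).comp (V Ω).subtypeL

theorem embedL_apply (v : V Ω) : embedL Ω v = v.1.fst := rfl

theorem gradL_apply (v : V Ω) : gradL Ω v = v.1.snd := rfl

theorem norm_gradL_le_one : ‖gradL Ω‖ ≤ 1 :=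
  ContinuousLinearMap.opNorm_le_bound _ zero_le_one fun v => by
    rw [one_mul]
    exact WithLp.norm_snd_le _ v.1

theorem IsPoincareConstant.norm_embedL_le {c_P : ℝ} (hP : IsPoincareConstant Ω c_P) (v : V Ω) :
    ‖embedL Ω v‖ ≤ c_P * ‖gradL Ω v‖ :=
  hP.2 v.1 v.2.1

theorem IsPoincareConstant.norm_sq_le {c_P : ℝ} (hP : IsPoincareConstant Ω c_P) (v : V Ω) :
    ‖v‖ ^ 2 ≤ (1 + c_P ^ 2) * ‖gradL Ω v‖ ^ 2 := by
  have hnorm : ‖v‖ ^ 2 = ‖embedL Ω v‖ ^ 2 + ‖gradL Ω v‖ ^ 2 :=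
    WithLp.prod_norm_sq_eq_of_L2 v.1
  have hsq : ‖embedL Ω v‖ ^ 2 ≤ (c_P * ‖gradL Ω v‖) ^ 2 := by
    gcongr
    exact hP.norm_embedL_le v
  linarith

theorem eq_zero_of_forall_mem_eq_zero {E F : Type*} [NormedAddCommGroup E] [NormedSpace ℝ E]
    [NormedAddCommGroup F] [NormedSpace ℝ F] {s : Set E}
    (L : (Submodule.span ℝ s).topologicalClosure →L[ℝ] F) (hL : ∀ p, p.1 ∈ s → L p = 0) :
    L = 0 := by
  let S := (Submodule.span ℝ s).topologicalClosure
  have hclosed : IsClosed (L.ker.map S.subtype : Set E) := by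
    rw [Submodule.map_coe]
    exact (Submodule.isClosed_topologicalClosure _).isClosedEmbedding_subtypeVal.isClosedMap _
      L.isClosed_ker
  have hker : S ≤ L.ker.map S.subtype :=
    Submodule.topologicalClosure_minimal _ (Submodule.span_le.2 fun p hp =>
      ⟨⟨p, Submodule.le_topologicalClosure _ (Submodule.subset_span hp)⟩, hL _ hp, rfl⟩) hclosed
  ext p
  obtain ⟨q, hq, hqp⟩ := hker p.2
  rw [← Subtype.ext hqp]
  exact hq

end Spaces

/-! ### Test functions -/

section TestFunctions

variable {Ω : Set Plane}

/-- The pairs `(ψ, ∇ψ)` with `ψ` a test field; `H10` is the closure of their span. -/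
def testPairs (Ω : Set Plane) : Set (FieldPair Ω) :=
  {p : FieldPair Ω | ∃ ψ : Plane → Plane, IsTestFunction Ω ψ ∧
    p.fst =ᵐ[volume.restrict Ω] ψ ∧ p.snd =ᵐ[volume.restrict Ω] velocityGrad ψ}

section

variable {F : Type} [NormedAddCommGroup F] [NormedSpace ℝ F] {η : Plane → F}

theorem IsTestFunction.differentiableAt (hη : IsTestFunction Ω η) (x : Plane) :
    DifferentiableAt ℝ η x :=
  (hη.smooth.differentiable (by simp)).differentiableAt

theorem IsTestFunction.continuous_partialD (hη : IsTestFunction Ω η) (j : Fin 2) :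
    Continuous (partialD j η) :=
  (hη.smooth.continuous_fderiv (by simp)).clm_apply continuous_const

end

theorem IsTestFunction.coord {η : Plane → Plane} (hη : IsTestFunction Ω η) (i : Fin 2) :
    IsTestFunction Ω (fun x => η x i) where
  smooth := (EuclideanSpace.proj (𝕜 := ℝ) i).contDiff.comp hη.smooth
  compact := hη.compact.comp_left (g := fun y : Plane => y i) rfl
  support := (tsupport_comp_subset (g := fun y : Plane => y i) rfl η).trans hη.support

theorem partialD_coord {η : Plane → Plane} (hη : IsTestFunction Ω η) (i j : Fin 2) (x : Plane) :
    partialD j (fun y => η y i) x = partialD j η x i := by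
  have hderiv : fderiv ℝ (fun y => η y i) x =
      (EuclideanSpace.proj (𝕜 := ℝ) i).comp (fderiv ℝ η x) :=
    ((EuclideanSpace.proj (𝕜 := ℝ) i).hasFDerivAt.comp x
      (hη.differentiableAt x).hasFDerivAt).fderiv
  rw [partialD, hderiv]
  rfl

theorem IsTestFunction.inner {ψ χ : Plane → Plane} (hψ : IsTestFunction Ω ψ)
    (hχ : IsTestFunction Ω χ) : IsTestFunction Ω (fun x => ⟪ψ x, χ x⟫_ℝ) where
  smooth := hψ.smooth.inner ℝ hχ.smooth
  compact := HasCompactSupport.intro hψ.compact fun x hx => by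
    rw [image_eq_zero_of_notMem_tsupport hx, inner_zero_left]
  support := (closure_mono fun x (hx : ⟪ψ x, χ x⟫_ℝ ≠ 0) => Function.mem_support.2
    fun hψx => hx (by rw [hψx, inner_zero_left])).trans hψ.support

theorem partialD_inner {ψ χ : Plane → Plane} (hψ : IsTestFunction Ω ψ)
    (hχ : IsTestFunction Ω χ) (j : Fin 2) (x : Plane) :
    partialD j (fun y => ⟪ψ y, χ y⟫_ℝ) x = ⟪ψ x, partialD j χ x⟫_ℝ + ⟪partialD j ψ x, χ x⟫_ℝ := by
  simp only [partialD]
  rw [fderiv_inner_apply ℝ (hψ.differentiableAt x) (hχ.differentiableAt x)]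

theorem integrable_mul_partialD {η q : Plane → ℝ} (hη : IsTestFunction Ω η)
    (hq : IsTestFunction Ω q) (j : Fin 2) : Integrable fun x => η x * partialD j q x :=
  (hη.smooth.continuous.mul (hq.continuous_partialD j)).integrable_of_hasCompactSupport
    hη.compact.mul_right

theorem integral_mul_partialD {η q : Plane → ℝ} (hη : IsTestFunction Ω η)
    (hq : IsTestFunction Ω q) (j : Fin 2) :
    ∫ x in Ω, η x * partialD j q x = -∫ x in Ω, q x * partialD j η x := by
  have hrestrict : ∀ {η q : Plane → ℝ}, IsTestFunction Ω η →
      ∫ x in Ω, η x * partialD j q x = ∫ x, η x * partialD j q x := fun hη =>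
    setIntegral_eq_integral_of_forall_compl_eq_zero fun x hx => by
      rw [image_eq_zero_of_notMem_tsupport fun h => hx (hη.support h), zero_mul]
  rw [hrestrict hη, hrestrict hq]
  simp only [mul_comm (q _)]
  refine integral_mul_fderiv_eq_neg_fderiv_mul_of_integrable ?_
    (integrable_mul_partialD hη hq j) ?_ (fun x _ => hη.differentiableAt x)
    (fun x _ => hq.differentiableAt x)
  · exact (integrable_mul_partialD hq hη j).congr (.of_forall fun x => mul_comm _ _)
  · exact (hη.smooth.continuous.mul hq.smooth.continuous).integrable_of_hasCompactSupport
      hη.compact.mul_right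

/-- The gradient of a smooth scalar function. -/
def scalarGrad (q : Plane → ℝ) (x : Plane) : Plane := WithLp.toLp 2 fun j => partialD j q x

/-- The matrix field `q I`, which represents `G ↦ ∫ q tr G`. -/
def scalarMat (q : Plane → ℝ) (x : Plane) : Mat2 :=
  WithLp.toLp 2 fun ij : Fin 2 × Fin 2 => if ij.1 = ij.2 then q x else 0

theorem inner_scalarGrad (q : Plane → ℝ) (x u : Plane) :
    ⟪scalarGrad q x, u⟫_ℝ = ∑ j : Fin 2, u j * partialD j q x := by
  simp [scalarGrad, PiLp.inner_apply]

theorem inner_scalarMat (q : Plane → ℝ) (x : Plane) (M : Mat2) :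
    ⟪scalarMat q x, M⟫_ℝ = ∑ i : Fin 2, q x * M (i, i) := by
  simp [scalarMat, PiLp.inner_apply, Fintype.sum_prod_type, Fin.sum_univ_two, mul_comm]

theorem memLp_of_continuous_of_hasCompactSupport {F : Type} [NormedAddCommGroup F] {g : Plane → F}
    (hg : Continuous g) (hsupp : HasCompactSupport g) :
    MemLp g 2 ((volume : Measure Plane).restrict Ω) :=
  (hg.memLp_of_hasCompactSupport hsupp).restrict Ω

variable {q : Plane → ℝ}

theorem memLp_scalarGrad (hq : IsTestFunction Ω q) :
    MemLp (scalarGrad q) 2 ((volume : Measure Plane).restrict Ω) := by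
  refine memLp_of_continuous_of_hasCompactSupport ((PiLp.continuous_toLp 2 _).comp
    (continuous_pi fun j => hq.continuous_partialD j)) ?_
  refine HasCompactSupport.intro hq.compact fun x hx => ?_
  have hderiv : fderiv ℝ q x = 0 := fderiv_of_notMem_tsupport ℝ hx
  ext j
  simp [scalarGrad, partialD, hderiv]

theorem memLp_scalarMat (hq : IsTestFunction Ω q) :
    MemLp (scalarMat q) 2 ((volume : Measure Plane).restrict Ω) := by
  refine memLp_of_continuous_of_hasCompactSupport ((PiLp.continuous_toLp 2 _).comp
    (continuous_pi fun ij => ?_)) ?_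
  · by_cases h : ij.1 = ij.2
    · simpa [h] using hq.smooth.continuous
    · simpa [h] using continuous_const
  · refine HasCompactSupport.intro hq.compact fun x hx => ?_
    ext ij
    simp [scalarMat, image_eq_zero_of_notMem_tsupport hx]

theorem integral_inner_scalarGrad_of_isTestFunction (hq : IsTestFunction Ω q) {ψ : Plane → Plane}
    (hψ : IsTestFunction Ω ψ) :
    ∫ x in Ω, ⟪scalarGrad q x, ψ x⟫_ℝ = -∫ x in Ω, ⟪scalarMat q x, velocityGrad ψ x⟫_ℝ := by
  simp only [inner_scalarGrad, inner_scalarMat]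
  have hdiv : ∀ x (i : Fin 2), velocityGrad ψ x (i, i) = partialD i (fun y => ψ y i) x :=
    fun x i => (partialD_coord hψ i i x).symm
  simp only [hdiv]
  rw [integral_finsetSum _ fun j _ => (integrable_mul_partialD (hψ.coord j) hq j).integrableOn,
    integral_finsetSum _ fun j _ => (integrable_mul_partialD hq (hψ.coord j) j).integrableOn,
    ← Finset.sum_neg_distrib]
  exact Finset.sum_congr rfl fun j _ => integral_mul_partialD (hψ.coord j) hq j

theorem integral_inner_eq_of_ae_eq {D : Set Plane} {F : Type} [NormedAddCommGroup F]
    [InnerProductSpace ℝ F] {g h : L2 D F} {g' h' : Plane → F} (hg : g =ᵐ[volume.restrict D] g')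
    (hh : h =ᵐ[volume.restrict D] h') : ⟪g, h⟫_ℝ = ∫ x in D, ⟪g' x, h' x⟫_ℝ := by
  rw [L2.inner_def]
  refine integral_congr_ae ?_
  filter_upwards [hg, hh] with x hgx hhx
  rw [hgx, hhx]

theorem green_H10 (hq : IsTestFunction Ω q) (p : H10 Ω) :
    ∫ x in Ω, ⟪scalarGrad q x, p.1.fst x⟫_ℝ = -∫ x in Ω, ⟪scalarMat q x, p.1.snd x⟫_ℝ := by
  have hgrad := (memLp_scalarGrad hq).coeFn_toLp
  have hmat := (memLp_scalarMat hq).coeFn_toLp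
  let L : H10 Ω →L[ℝ] ℝ :=
    ((innerSL ℝ (memLp_scalarGrad hq).toLp).comp (WithLp.fstL 2 ℝ _ _) +
      (innerSL ℝ (memLp_scalarMat hq).toLp).comp (WithLp.sndL 2 ℝ _ _)).comp (H10 Ω).subtypeL
  have hL : L = 0 := by
    refine eq_zero_of_forall_mem_eq_zero L ?_
    rintro p ⟨ψ, hψ, hfst, hsnd⟩
    change ⟪(memLp_scalarGrad hq).toLp, p.1.fst⟫_ℝ + ⟪(memLp_scalarMat hq).toLp, p.1.snd⟫_ℝ = 0
    rw [integral_inner_eq_of_ae_eq hgrad hfst, integral_inner_eq_of_ae_eq hmat hsnd,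
      integral_inner_scalarGrad_of_isTestFunction hq hψ, neg_add_cancel]
  rw [← integral_inner_eq_of_ae_eq hgrad .rfl, ← integral_inner_eq_of_ae_eq hmat .rfl]
  exact eq_neg_of_add_eq_zero_left (DFunLike.congr_fun hL p)

theorem integral_inner_scalarGrad_eq_zero (hq : IsTestFunction Ω q) (u : V Ω) :
    ∫ x in Ω, ⟪scalarGrad q x, u.1.fst x⟫_ℝ = 0 := by
  have htrace : ∀ᵐ x ∂((volume : Measure Plane).restrict Ω),
      ∑ i : Fin 2, u.1.snd x (i, i) = 0 := u.2.2
  rw [green_H10 hq ⟨u.1, u.2.1⟩, neg_eq_zero]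
  refine integral_eq_zero_of_ae ?_
  filter_upwards [htrace] with x hx
  rw [inner_scalarMat, ← Finset.mul_sum, hx, mul_zero, Pi.zero_apply]

end TestFunctions

/-! ### The trilinear form -/

section Trilinear

theorem norm_dyad (u w : Plane) :
    ‖(WithLp.toLp 2 fun ij : Fin 2 × Fin 2 => w ij.1 * u ij.2 : Mat2)‖ = ‖u‖ * ‖w‖ := by
  refine (sq_eq_sq₀ (norm_nonneg _) (by positivity)).1 ?_
  simp only [mul_pow, EuclideanSpace.real_norm_sq_eq, Fintype.sum_prod_type, Fin.sum_univ_two]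
  ring

/-- The dyadic product `w ⊗ u`, so that `[(u · ∇) v] · w = (w ⊗ u) : ∇v`. -/
def dyad : Plane →L[ℝ] Plane →L[ℝ] Mat2 :=
  LinearMap.mkContinuous₂
    (LinearMap.mk₂ ℝ (fun u w : Plane => WithLp.toLp 2 fun ij : Fin 2 × Fin 2 => w ij.1 * u ij.2)
      (fun u u' w => by ext ij; simp [mul_add])
      (fun c u w => by ext ij; simp [mul_left_comm])
      (fun u w w' => by ext ij; simp [add_mul])
      (fun c u w => by ext ij; simp [mul_assoc]))
    1 fun u w => by rw [one_mul]; exact (norm_dyad u w).le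

theorem dyad_apply (u w : Plane) (ij : Fin 2 × Fin 2) : dyad u w ij = w ij.1 * u ij.2 := rfl

theorem norm_dyad_le_one : ‖dyad‖ ≤ 1 :=
  LinearMap.mkContinuous₂_norm_le _ zero_le_one _

theorem inner_dyad (u w : Plane) (M : Mat2) :
    ⟪dyad u w, M⟫_ℝ = ∑ i : Fin 2, (∑ j : Fin 2, u j * M (i, j)) * w i := by
  simp only [PiLp.inner_apply, dyad_apply, Fintype.sum_prod_type, Finset.sum_mul,
    RCLike.inner_apply, conj_trivial]
  exact Finset.sum_congr rfl fun i _ => Finset.sum_congr rfl fun j _ => by ring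

instance holderTriple_four_four_two : ENNReal.HolderTriple 4 4 2 := by
  constructor
  rw [← two_mul, show (4 : ENNReal) = 2 * 2 by norm_num, ENNReal.mul_inv (by simp) (by simp),
    ← mul_assoc, ENNReal.mul_inv_cancel (by simp) (by simp), one_mul]

instance fact_one_le_four : Fact ((1 : ENNReal) ≤ 4) := ⟨by norm_num⟩

variable {Ω : Set Plane} {c_L : ℝ}

theorem IsLadyzhenskayaConstant.memLp_four (hL : IsLadyzhenskayaConstant Ω c_L) (v : H10 Ω) :
    MemLp v.1.fst 4 (volume.restrict Ω) :=
  ⟨Lp.aestronglyMeasurable _, (hL.2 v v.2).trans_lt ENNReal.ofReal_lt_top⟩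

theorem IsLadyzhenskayaConstant.norm_toLp_sq_le (hL : IsLadyzhenskayaConstant Ω c_L) (v : H10 Ω) :
    ‖(hL.memLp_four v).toLp‖ ^ 2 ≤ c_L * (‖v.1.fst‖ * ‖v.1.snd‖) := by
  have hnorm : ‖(hL.memLp_four v).toLp‖ ≤ √c_L * (√‖v.1.fst‖ * √‖v.1.snd‖) := by
    rw [Lp.norm_toLp]
    exact ENNReal.toReal_le_of_le_ofReal (by positivity) (hL.2 v v.2)
  calc _ ≤ (√c_L * (√‖v.1.fst‖ * √‖v.1.snd‖)) ^ 2 :=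
        pow_le_pow_left₀ ENNReal.toReal_nonneg hnorm 2
    _ = _ := by
        rw [mul_pow, mul_pow, Real.sq_sqrt hL.1.le, Real.sq_sqrt (norm_nonneg _),
          Real.sq_sqrt (norm_nonneg _)]

/-- The embedding of `H¹₀` in `L⁴` provided by the Ladyzhenskaya inequality. -/
def embedL4 (hL : IsLadyzhenskayaConstant Ω c_L) :
    H10 Ω →L[ℝ] Lp Plane 4 ((volume : Measure Plane).restrict Ω) :=
  LinearMap.mkContinuous
    { toFun := fun v => (hL.memLp_four v).toLp
      map_add' := fun v w => by
        rw [← MemLp.toLp_add, MemLp.toLp_eq_toLp_iff]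
        exact Lp.coeFn_add v.1.fst w.1.fst
      map_smul' := fun c v => by
        rw [RingHom.id_apply, ← MemLp.toLp_const_smul, MemLp.toLp_eq_toLp_iff]
        exact Lp.coeFn_smul c v.1.fst }
    √c_L fun v => by
      refine le_of_sq_le_sq ((hL.norm_toLp_sq_le v).trans ?_) (by positivity)
      rw [mul_pow, Real.sq_sqrt hL.1.le, sq ‖v‖]
      exact mul_le_mul_of_nonneg_left (mul_le_mul (WithLp.norm_fst_le _ v.1)
        (WithLp.norm_snd_le _ v.1) (norm_nonneg _) (norm_nonneg _)) hL.1.le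

theorem norm_embedL4_sq_le (hL : IsLadyzhenskayaConstant Ω c_L) (v : H10 Ω) :
    ‖embedL4 hL v‖ ^ 2 ≤ c_L * (‖v.1.fst‖ * ‖v.1.snd‖) :=
  hL.norm_toLp_sq_le v

theorem coeFn_embedL4 (hL : IsLadyzhenskayaConstant Ω c_L) (v : H10 Ω) :
    embedL4 hL v =ᵐ[volume.restrict Ω] v.1.fst :=
  (hL.memLp_four v).coeFn_toLp

/-- The momentum flux `w ⊗ u ∈ L²` of two fields in `H¹₀`. -/
def fluxL (hL : IsLadyzhenskayaConstant Ω c_L) : H10 Ω →L[ℝ] H10 Ω →L[ℝ] L2 Ω Mat2 :=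
  (dyad.holderL (volume.restrict Ω) 4 4 2).bilinearComp (embedL4 hL) (embedL4 hL)

theorem coeFn_fluxL (hL : IsLadyzhenskayaConstant Ω c_L) (u w : H10 Ω) :
    fluxL hL u w =ᵐ[volume.restrict Ω] fun x => dyad (u.1.fst x) (w.1.fst x) := by
  filter_upwards [dyad.coeFn_holder (r := 2) (embedL4 hL u) (embedL4 hL w), coeFn_embedL4 hL u,
    coeFn_embedL4 hL w] with x hx hux hwx
  rw [← hux, ← hwx]
  exact hx

theorem norm_fluxL_le (hL : IsLadyzhenskayaConstant Ω c_L) (u w : H10 Ω) :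
    ‖fluxL hL u w‖ ≤ ‖embedL4 hL u‖ * ‖embedL4 hL w‖ :=
  (dyad.norm_holder_apply_apply_le (r := 2) _ _).trans
    (mul_le_mul_of_nonneg_right (mul_le_of_le_one_left (norm_nonneg _) norm_dyad_le_one)
      (norm_nonneg _))

theorem norm_fluxL_sq_le (hL : IsLadyzhenskayaConstant Ω c_L) (u w : H10 Ω) :
    ‖fluxL hL u w‖ ^ 2 ≤ c_L ^ 2 * ((‖u.1.fst‖ * ‖u.1.snd‖) * (‖w.1.fst‖ * ‖w.1.snd‖)) := by
  have hc := hL.1.le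
  calc ‖fluxL hL u w‖ ^ 2 ≤ ‖embedL4 hL u‖ ^ 2 * ‖embedL4 hL w‖ ^ 2 := by
        rw [← mul_pow]
        gcongr
        exact norm_fluxL_le hL u w
    _ ≤ (c_L * (‖u.1.fst‖ * ‖u.1.snd‖)) * (c_L * (‖w.1.fst‖ * ‖w.1.snd‖)) := by
        gcongr
        exacts [norm_embedL4_sq_le hL u, norm_embedL4_sq_le hL w]
    _ = _ := by ring

theorem inner_fluxL (hL : IsLadyzhenskayaConstant Ω c_L) (u w : H10 Ω) (v : FieldPair Ω) :
    ⟪fluxL hL u w, v.snd⟫_ℝ = bForm u.1 v w.1 := by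
  rw [integral_inner_eq_of_ae_eq (coeFn_fluxL hL u w) .rfl]
  simp only [inner_dyad, bForm]

/-- The inclusion of `V` in `H¹₀`. -/
def inclL (Ω : Set Plane) : V Ω →L[ℝ] H10 Ω := (V Ω).subtypeL.codRestrict _ fun v => v.2.1

/-- The form `(w, v) ↦ b(u, v, w) + b(u, w, v)` on `H¹₀`. -/
def symmetrizedForm (hL : IsLadyzhenskayaConstant Ω c_L) (u : H10 Ω) :
    H10 Ω →L[ℝ] H10 Ω →L[ℝ] ℝ :=
  let G : H10 Ω →L[ℝ] L2 Ω Mat2 :=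
    (WithLp.sndL 2 ℝ (L2 Ω Plane) (L2 Ω Mat2)).comp (H10 Ω).subtypeL
  let b : H10 Ω →L[ℝ] H10 Ω →L[ℝ] ℝ := (innerSL ℝ).bilinearComp (fluxL hL u) G
  b + b.flip

theorem symmetrizedForm_apply (hL : IsLadyzhenskayaConstant Ω c_L) (u w v : H10 Ω) :
    symmetrizedForm hL u w v = ⟪fluxL hL u w, v.1.snd⟫_ℝ + ⟪fluxL hL u v, w.1.snd⟫_ℝ := rfl

theorem inner_dyad_add_inner_dyad {ψ χ : Plane → Plane} (hψ : IsTestFunction Ω ψ)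
    (hχ : IsTestFunction Ω χ) (x u : Plane) :
    ⟪dyad u (χ x), velocityGrad ψ x⟫_ℝ + ⟪dyad u (ψ x), velocityGrad χ x⟫_ℝ =
      ⟪scalarGrad (fun y => ⟪ψ y, χ y⟫_ℝ) x, u⟫_ℝ := by
  rw [inner_dyad, inner_dyad, inner_scalarGrad]
  simp only [partialD_inner hψ hχ]
  simp only [velocityGrad, Fin.sum_univ_two, PiLp.inner_apply, RCLike.inner_apply, conj_trivial]
  ring

theorem symmetrizedForm_testPairs (hL : IsLadyzhenskayaConstant Ω c_L) (u : V Ω) {w v : H10 Ω}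
    (hw : w.1 ∈ testPairs Ω) (hv : v.1 ∈ testPairs Ω) :
    symmetrizedForm hL (inclL Ω u) w v = 0 := by
  obtain ⟨χ, hχ, hχ_fst, hχ_snd⟩ := hw
  obtain ⟨ψ, hψ, hψ_fst, hψ_snd⟩ := hv
  rw [symmetrizedForm_apply, L2.inner_def, L2.inner_def,
    ← integral_add (L2.integrable_inner _ _) (L2.integrable_inner _ _),
    ← integral_inner_scalarGrad_eq_zero (hψ.inner hχ) u]
  refine integral_congr_ae ?_
  filter_upwards [hχ_fst, hχ_snd, hψ_fst, hψ_snd, coeFn_fluxL hL (inclL Ω u) w,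
    coeFn_fluxL hL (inclL Ω u) v] with x hχx hχx' hψx hψx' hux hux'
  rw [hux, hux', hχx, hχx', hψx, hψx']
  exact inner_dyad_add_inner_dyad hψ hχ x _

theorem symmetrizedForm_eq_zero (hL : IsLadyzhenskayaConstant Ω c_L) (u : V Ω) :
    symmetrizedForm hL (inclL Ω u) = 0 := by
  refine eq_zero_of_forall_mem_eq_zero (s := testPairs Ω) (F := H10 Ω →L[ℝ] ℝ) _ fun w hw => ?_
  exact eq_zero_of_forall_mem_eq_zero (s := testPairs Ω) (F := ℝ) _ fun v hv =>
    symmetrizedForm_testPairs hL u hw hv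

theorem bForm_skew (hL : IsLadyzhenskayaConstant Ω c_L) (u : V Ω) (v w : H10 Ω) :
    bForm u.1 v.1 w.1 = -bForm u.1 w.1 v.1 := by
  have hzero := DFunLike.congr_fun (DFunLike.congr_fun (symmetrizedForm_eq_zero hL u) w) v
  rw [symmetrizedForm_apply, inner_fluxL, inner_fluxL] at hzero
  exact eq_neg_of_add_eq_zero_left hzero

/-- The advection operator `(u, v) ↦ (u · ∇) v` with values in `V ≅ V*`. The derivative is moved
to the test function, as `-div (v ⊗ u)` is bounded by the `L⁴` norms of `u` and `v` alone. -/
def advection (hL : IsLadyzhenskayaConstant Ω c_L) : V Ω →L[ℝ] V Ω →L[ℝ] V Ω :=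
  -(ContinuousLinearMap.compL ℝ (V Ω) (L2 Ω Mat2) (V Ω) (gradL Ω).adjoint).comp
    ((fluxL hL).bilinearComp (inclL Ω) (inclL Ω))

theorem advection_apply (hL : IsLadyzhenskayaConstant Ω c_L) (u v : V Ω) :
    advection hL u v = -(gradL Ω).adjoint (fluxL hL (inclL Ω u) (inclL Ω v)) := rfl

theorem inner_advection (hL : IsLadyzhenskayaConstant Ω c_L) (u v w : V Ω) :
    ⟪advection hL u v, w⟫_ℝ = bForm u.1 v.1 w.1 := by
  rw [advection_apply, inner_neg_left, ContinuousLinearMap.adjoint_inner_left, gradL_apply,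
    inner_fluxL]
  exact (bForm_skew hL u (inclL Ω v) (inclL Ω w)).symm

theorem isAdvection_advection (hL : IsLadyzhenskayaConstant Ω c_L) :
    IsAdvection (embedL Ω) (advection hL) (c_L ^ 2) where
  nonneg := sq_nonneg _
  norm_sq_le u v := by
    have hadjoint : ‖advection hL u v‖ ≤ ‖fluxL hL (inclL Ω u) (inclL Ω v)‖ := by
      rw [advection_apply, norm_neg]
      refine ((gradL Ω).adjoint.le_of_opNorm_le ?_ _).trans_eq (one_mul _)
      rw [LinearIsometryEquiv.norm_map]
      exact norm_gradL_le_one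
    calc ‖advection hL u v‖ ^ 2 ≤ ‖fluxL hL (inclL Ω u) (inclL Ω v)‖ ^ 2 := by gcongr
      _ ≤ c_L ^ 2 * ((‖embedL Ω u‖ * ‖gradL Ω u‖) * (‖embedL Ω v‖ * ‖gradL Ω v‖)) :=
          norm_fluxL_sq_le hL _ _
      _ ≤ c_L ^ 2 * ((‖embedL Ω u‖ * ‖u‖) * (‖embedL Ω v‖ * ‖v‖)) := by
          gcongr
          exacts [WithLp.norm_snd_le _ u.1, WithLp.norm_snd_le _ v.1]
  inner_eq_zero u v := by
    rw [inner_advection]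
    exact self_eq_neg.1 (bForm_skew hL u (inclL Ω v) (inclL Ω v))

theorem abs_inner_advection_le {c_P : ℝ} (hP : IsPoincareConstant Ω c_P)
    (hL : IsLadyzhenskayaConstant Ω c_L) (u v w : V Ω) :
    |⟪advection hL u v, w⟫_ℝ| ≤ c_L * c_P * (‖gradL Ω u‖ * ‖gradL Ω w‖) * ‖gradL Ω v‖ := by
  have hc := hL.1.le
  have hflux : ‖fluxL hL (inclL Ω u) (inclL Ω w)‖ ≤
      c_L * c_P * (‖gradL Ω u‖ * ‖gradL Ω w‖) := by
    have hnonneg : 0 ≤ c_L * c_P := mul_nonneg hc hP.1.le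
    refine le_of_sq_le_sq ((norm_fluxL_sq_le hL _ _).trans ?_) (by positivity)
    calc _ = c_L ^ 2 * ((‖embedL Ω u‖ * ‖gradL Ω u‖) * (‖embedL Ω w‖ * ‖gradL Ω w‖)) := rfl
      _ ≤ c_L ^ 2 * ((c_P * ‖gradL Ω u‖ * ‖gradL Ω u‖) * (c_P * ‖gradL Ω w‖ * ‖gradL Ω w‖)) := by
          have := hP.1.le
          gcongr
          exacts [hP.norm_embedL_le u, hP.norm_embedL_le w]
      _ = _ := by ring
  rw [inner_advection]
  calc |bForm u.1 v.1 w.1| = |⟪fluxL hL (inclL Ω u) (inclL Ω w), v.1.snd⟫_ℝ| := by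
        rw [inner_fluxL]; rfl
    _ ≤ ‖fluxL hL (inclL Ω u) (inclL Ω w)‖ * ‖v.1.snd‖ := abs_real_inner_le_norm _ _
    _ ≤ _ := mul_le_mul_of_nonneg_right hflux (norm_nonneg _)

end Trilinear

/-! ### The operators of the state equation -/

section Operators

open scoped ENNReal

variable {X E : Type*} [MeasurableSpace X] {ν : Measure X} [NormedAddCommGroup E] [NormedSpace ℝ E]
  {θ : X → ℝ}

/-- Multiplication by a bounded function on `L²`. -/
def mulL (E : Type*) [NormedAddCommGroup E] [NormedSpace ℝ E] (hθ : MemLp θ ∞ ν) :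
    Lp E 2 ν →L[ℝ] Lp E 2 ν :=
  (ContinuousLinearMap.lsmul ℝ ℝ).holderL ν ∞ 2 2 hθ.toLp

theorem coeFn_mulL (hθ : MemLp θ ∞ ν) (f : Lp E 2 ν) : mulL E hθ f =ᵐ[ν] fun x => θ x • f x := by
  filter_upwards [(ContinuousLinearMap.lsmul ℝ ℝ : ℝ →L[ℝ] E →L[ℝ] E).coeFn_holder (r := 2)
    hθ.toLp f, hθ.coeFn_toLp] with x hx hθx
  rw [← hθx]
  exact hx

theorem norm_mulL_le (hθ : MemLp θ ∞ ν) {M : ℝ} (hM : ∀ᵐ x ∂ν, |θ x| ≤ M) (f : Lp E 2 ν) :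
    ‖mulL E hθ f‖ ≤ M * ‖f‖ := by
  refine Lp.norm_le_mul_norm_of_ae_le_mul ?_
  filter_upwards [hM, coeFn_mulL hθ f] with x hx hmul
  rw [hmul, norm_smul, Real.norm_eq_abs]
  gcongr

theorem IsPorousCoefficient.exists_bound {α : ℝ → ℝ} (hα : IsPorousCoefficient α) :
    ∃ M, 0 ≤ M ∧ ∀ s, |s| ≤ 1 → |α s| ≤ M := by
  obtain ⟨M, hM⟩ := (isCompact_Icc (a := (-1 : ℝ)) (b := 1)).exists_bound_of_continuousOn
    hα.lipschitz.choose_spec.continuous.continuousOn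
  exact ⟨M, (norm_nonneg _).trans (hM 0 (by norm_num)), fun s hs => hM s (abs_le.1 hs)⟩

variable {Ω : Set Plane} {α : ℝ → ℝ} {φ : L2 Ω ℝ × L2 Ω Plane}

theorem IsPorousCoefficient.memLp_top (hα : IsPorousCoefficient α) (hφ : φ ∈ Admissible Ω) :
    MemLp (fun x => α (φ.1 x)) ∞ (volume.restrict Ω) := by
  obtain ⟨L, hL⟩ := hα.lipschitz
  obtain ⟨M, -, hM⟩ := hα.exists_bound
  exact memLp_top_of_bound
    (hL.continuous.comp_aestronglyMeasurable (Lp.aestronglyMeasurable φ.1)) M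
    (hφ.2.mono fun x => hM _)

/-- The operator `-μ Δ` on `V`. -/
def diffusionL (Ω : Set Plane) (μ : ℝ) : V Ω →L[ℝ] V Ω := μ • (gradL Ω).adjoint.comp (gradL Ω)

theorem inner_diffusionL (μ : ℝ) (u v : V Ω) :
    ⟪diffusionL Ω μ u, v⟫_ℝ = μ * ⟪gradL Ω u, gradL Ω v⟫_ℝ := by
  rw [diffusionL, _root_.smul_apply, real_inner_smul_left, ContinuousLinearMap.comp_apply,
    ContinuousLinearMap.adjoint_inner_left]

theorem diffusionL_coercive {c_P μ : ℝ} (hμ : 0 ≤ μ) (hP : IsPoincareConstant Ω c_P) (v : V Ω) :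
    μ / (1 + c_P ^ 2) * ‖v‖ ^ 2 ≤ ⟪diffusionL Ω μ v, v⟫_ℝ := by
  rw [inner_diffusionL, real_inner_self_eq_norm_sq, div_mul_eq_mul_div,
    div_le_iff₀ (by positivity), mul_assoc]
  exact mul_le_mul_of_nonneg_left ((hP.norm_sq_le v).trans_eq (mul_comm _ _)) hμ

/-- The Brinkman term `α(φ) u`, as an operator on `V`. -/
def brinkmanL (hα : IsPorousCoefficient α) (hφ : φ ∈ Admissible Ω) : V Ω →L[ℝ] V Ω :=
  (embedL Ω).adjoint.comp ((mulL Plane (hα.memLp_top hφ)).comp (embedL Ω))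

theorem inner_brinkmanL (hα : IsPorousCoefficient α) (hφ : φ ∈ Admissible Ω) (u v : V Ω) :
    ⟪brinkmanL hα hφ u, v⟫_ℝ = ∫ x in Ω, α (φ.1 x) * ⟪u.1.fst x, v.1.fst x⟫_ℝ := by
  rw [brinkmanL, ContinuousLinearMap.comp_apply, ContinuousLinearMap.adjoint_inner_left,
    ContinuousLinearMap.comp_apply,
    integral_inner_eq_of_ae_eq (coeFn_mulL (hα.memLp_top hφ) (embedL Ω u)) .rfl]
  simp only [real_inner_smul_left, embedL_apply]

theorem inner_brinkmanL_self_nonneg (hα : IsPorousCoefficient α) (hφ : φ ∈ Admissible Ω) (v : V Ω) :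
    0 ≤ ⟪brinkmanL hα hφ v, v⟫_ℝ := by
  rw [inner_brinkmanL]
  exact integral_nonneg fun x => mul_nonneg (hα.nonneg _) real_inner_self_nonneg

theorem inner_adjoint_embedL (f : L2 Ω Plane) (ψ : V Ω) :
    ⟪(embedL Ω).adjoint f, ψ⟫_ℝ = ∫ x in Ω, ⟪f x, ψ.1.fst x⟫_ℝ := by
  rw [ContinuousLinearMap.adjoint_inner_left, L2.inner_def, embedL_apply]

theorem aForm_eq_inner (μ : ℝ) (hα : IsPorousCoefficient α) (hφ : φ ∈ Admissible Ω) (u v : V Ω) :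
    aForm μ α φ.1 u.1 v.1 = ⟪diffusionL Ω μ u + brinkmanL hα hφ u, v⟫_ℝ := by
  rw [inner_add_left, inner_diffusionL, inner_brinkmanL, aForm, L2.inner_def, gradL_apply,
    gradL_apply]

end Operators

/-! ### Small solutions of quadratic equations -/

section SmallData

open scoped NNReal

variable {E F : Type*} [NormedAddCommGroup E] [NormedAddCommGroup F] [NormedSpace ℝ F]

/-- The fixed point of an iterate that contracts the original norm is a fixed point of `S`. -/
theorem exists_fixedPoint_of_contracting [NormedSpace ℝ E] [CompleteSpace E]
    (N : E →L[ℝ] F) {k : ℝ} (hN : ∀ v, ‖v‖ ≤ k * ‖N v‖) (hk : 0 ≤ k) {q : ℝ}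
    (hq : 0 ≤ q) (hq_lt : q < 1) (S : E → E)
    (hS : ∀ v v', ‖N (S v - S v')‖ ≤ q * ‖N (v - v')‖) : ∃ v, S v = v := by
  have hiterate : ∀ n v v', ‖N (S^[n] v - S^[n] v')‖ ≤ q ^ n * ‖N (v - v')‖ := by
    intro n v v'
    induction n with
    | zero => simp
    | succ n ih =>
      rw [Function.iterate_succ_apply', Function.iterate_succ_apply', pow_succ', mul_assoc]
      exact (hS _ _).trans (mul_le_mul_of_nonneg_left ih hq)
  have hlipschitz : ∀ n v v', dist (S^[n] v) (S^[n] v') ≤ k * (q ^ n * ‖N‖) * dist v v' := by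
    intro n v v'
    rw [dist_eq_norm, dist_eq_norm, mul_assoc, mul_assoc]
    exact (hN _).trans (mul_le_mul_of_nonneg_left ((hiterate n v v').trans
      (mul_le_mul_of_nonneg_left (N.le_opNorm _) (pow_nonneg hq n))) hk)
  have htendsto : Filter.Tendsto (fun n => k * (q ^ n * ‖N‖)) Filter.atTop (nhds 0) := by
    simpa using ((tendsto_pow_atTop_nhds_zero_of_lt_one hq hq_lt).mul_const ‖N‖).const_mul k
  obtain ⟨n, hn⟩ := (htendsto.eventually (gt_mem_nhds one_pos)).exists
  let K : ℝ≥0 := ⟨k * (q ^ n * ‖N‖), by positivity⟩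
  have hcontracting : ContractingWith K S^[n] :=
    ⟨hn, LipschitzWith.of_dist_le_mul (hlipschitz n)⟩
  exact ⟨_, hcontracting.isFixedPt_fixedPoint_iterate⟩

variable [InnerProductSpace ℝ E]
  {N : E →L[ℝ] F} {μ κ m : ℝ} {A : E →L[ℝ] E} {B : E →L[ℝ] E →L[ℝ] E} {g : E}

theorem norm_le_of_coercive (hμ : 0 < μ) (hm : 0 ≤ m) (hA : ∀ w, μ * ‖N w‖ ^ 2 ≤ ⟪A w, w⟫_ℝ)
    (hg : ∀ w, ⟪g, w⟫_ℝ ≤ m * ‖N w‖) {w : E} (hw : A w = g) : ‖N w‖ ≤ μ⁻¹ * m :=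
  le_inv_mul_of_mul_sq_le hμ hm (norm_nonneg _) ((hA w).trans (hw ▸ hg w))

theorem norm_sub_le_of_linearized (hμ : 0 < μ) (hκ : 0 ≤ κ) (hm : 0 ≤ m)
    (hcoercive : ∀ v w, μ * ‖N w‖ ^ 2 ≤ ⟪(A + B v) w, w⟫_ℝ)
    (hB : ∀ u v w, |⟪B u v, w⟫_ℝ| ≤ κ * (‖N u‖ * ‖N w‖) * ‖N v‖)
    (hg : ∀ w, ⟪g, w⟫_ℝ ≤ m * ‖N w‖) {v v' w w' : E} (hw : (A + B v) w = g)
    (hw' : (A + B v') w' = g) : ‖N (w - w')‖ ≤ κ * m / μ ^ 2 * ‖N (v - v')‖ := by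
  have hdiff : (A + B v) (w - w') = -B (v - v') w' := by
    rw [map_sub (A + B v), hw, ← hw', map_sub B, _root_.sub_apply, _root_.add_apply,
      _root_.add_apply]
    abel
  have hbound := norm_le_of_coercive hμ hm (hcoercive v') hg hw'
  have henergy : μ * ‖N (w - w')‖ ^ 2 ≤
      κ * ‖N (v - v')‖ * (μ⁻¹ * m) * ‖N (w - w')‖ := by
    calc μ * ‖N (w - w')‖ ^ 2 ≤ -⟪B (v - v') w', w - w'⟫_ℝ := by
          rw [← inner_neg_left, ← hdiff]
          exact hcoercive v _
      _ ≤ κ * (‖N (v - v')‖ * ‖N (w - w')‖) * ‖N w'‖ := (neg_le_abs _).trans (hB _ _ _)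
      _ ≤ κ * (‖N (v - v')‖ * ‖N (w - w')‖) * (μ⁻¹ * m) := by gcongr
      _ = _ := by ring
  refine (le_inv_mul_of_mul_sq_le hμ (by positivity) (norm_nonneg _) henergy).trans_eq ?_
  field_simp

variable [CompleteSpace E]

theorem exists_eq_of_coercive {k : ℝ} (hμ : 0 < μ) (hk : 0 < k)
    (hN : ∀ v, ‖v‖ ≤ k * ‖N v‖) (hA : ∀ w, μ * ‖N w‖ ^ 2 ≤ ⟪A w, w⟫_ℝ) (g : E) :
    ∃ w, A w = g := by
  have hcoercive : IsCoercive ((innerSL ℝ).comp A : E →L[ℝ] E →L[ℝ] ℝ) := by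
    refine ⟨μ / k ^ 2, by positivity, fun w => le_trans ?_ (hA w)⟩
    rw [mul_assoc, ← sq, div_mul_eq_mul_div, mul_div_assoc]
    refine mul_le_mul_of_nonneg_left ?_ hμ.le
    rw [div_le_iff₀' (by positivity), ← mul_pow]
    exact pow_le_pow_left₀ (norm_nonneg _) (hN w) 2
  refine ⟨hcoercive.continuousLinearEquivOfBilin.symm g, ext_inner_right ℝ fun z => ?_⟩
  change ((innerSL ℝ).comp A : E →L[ℝ] E →L[ℝ] ℝ) _ z = _
  rw [← hcoercive.continuousLinearEquivOfBilin_apply, ContinuousLinearEquiv.apply_symm_apply]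

theorem exists_small_solution {k : ℝ} (hμ : 0 < μ) (hk : 0 < k) (hκ : 0 ≤ κ) (hm : 0 ≤ m)
    (hN : ∀ v, ‖v‖ ≤ k * ‖N v‖) (hA : ∀ w, μ * ‖N w‖ ^ 2 ≤ ⟪A w, w⟫_ℝ)
    (hB_skew : ∀ v w, ⟪B v w, w⟫_ℝ = 0)
    (hB : ∀ u v w, |⟪B u v, w⟫_ℝ| ≤ κ * (‖N u‖ * ‖N w‖) * ‖N v‖)
    (hg : ∀ w, ⟪g, w⟫_ℝ ≤ m * ‖N w‖) (hsmall : κ * m < μ ^ 2) : ∃ v, A v + B v v = g := by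
  have hcoercive : ∀ v w, μ * ‖N w‖ ^ 2 ≤ ⟪(A + B v) w, w⟫_ℝ := by
    intro v w
    rw [_root_.add_apply, inner_add_left, hB_skew, add_zero]
    exact hA w
  choose S hS using fun v => exists_eq_of_coercive hμ hk hN (hcoercive v) g
  obtain ⟨v, hv⟩ := exists_fixedPoint_of_contracting N hN hk.le (q := κ * m / μ ^ 2)
    (by positivity) ((div_lt_one (by positivity)).2 hsmall) S
    fun v v' => norm_sub_le_of_linearized hμ hκ hm hcoercive hB hg (hS v) (hS v')
  exact ⟨v, by simpa only [hv, _root_.add_apply] using hS v⟩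

end SmallData

section Stationary

variable {Ω : Set Plane} {c_P c_L μ : ℝ} {α : ℝ → ℝ} {φ : L2 Ω ℝ × L2 Ω Plane} {f_s : L2 Ω Plane}

theorem isStationaryState_iff (hL : IsLadyzhenskayaConstant Ω c_L) (hα : IsPorousCoefficient α)
    (hφ : φ ∈ Admissible Ω) {v : V Ω} : IsStationaryState μ α f_s φ.1 v ↔
      (diffusionL Ω μ + brinkmanL hα hφ) v + advection hL v v = (embedL Ω).adjoint f_s := by
  simp only [IsStationaryState, aForm_eq_inner μ hα hφ, ← inner_advection hL,
    ← inner_adjoint_embedL, ← inner_add_left]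
  exact ⟨ext_inner_right ℝ, fun h ψ => congrArg (⟪·, ψ⟫_ℝ) h⟩

theorem mul_norm_gradL_sq_le (μ : ℝ) (hα : IsPorousCoefficient α) (hφ : φ ∈ Admissible Ω)
    (w : V Ω) : μ * ‖gradL Ω w‖ ^ 2 ≤ ⟪(diffusionL Ω μ + brinkmanL hα hφ) w, w⟫_ℝ := by
  rw [_root_.add_apply, inner_add_left, inner_diffusionL, real_inner_self_eq_norm_sq]
  exact le_add_of_nonneg_right (inner_brinkmanL_self_nonneg hα hφ w)

theorem inner_adjoint_embedL_le (hP : IsPoincareConstant Ω c_P) (f : L2 Ω Plane) (w : V Ω) :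
    ⟪(embedL Ω).adjoint f, w⟫_ℝ ≤ c_P * ‖f‖ * ‖gradL Ω w‖ := by
  rw [ContinuousLinearMap.adjoint_inner_left]
  calc ⟪f, embedL Ω w⟫_ℝ ≤ ‖f‖ * (c_P * ‖gradL Ω w‖) :=
        (real_inner_le_norm _ _).trans
          (mul_le_mul_of_nonneg_left (hP.norm_embedL_le w) (norm_nonneg f))
    _ = _ := by ring

theorem IsStationaryState.norm_gradL_le (hμ : 0 < μ) (hP : IsPoincareConstant Ω c_P)
    (hL : IsLadyzhenskayaConstant Ω c_L) (hα : IsPorousCoefficient α) (hφ : φ ∈ Admissible Ω)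
    {v : V Ω} (hv : IsStationaryState μ α f_s φ.1 v) : ‖gradL Ω v‖ ≤ μ⁻¹ * (c_P * ‖f_s‖) := by
  refine le_inv_mul_of_mul_sq_le hμ (mul_nonneg hP.1.le (norm_nonneg _)) (norm_nonneg _) ?_
  refine le_trans ?_ (inner_adjoint_embedL_le hP f_s v)
  rw [← (isStationaryState_iff hL hα hφ).1 hv, inner_add_left,
    (isAdvection_advection hL).inner_eq_zero, add_zero]
  exact mul_norm_gradL_sq_le μ hα hφ v

theorem exists_stationaryState (hμ : 0 < μ) (hP : IsPoincareConstant Ω c_P)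
    (hL : IsLadyzhenskayaConstant Ω c_L) (hα : IsPorousCoefficient α)
    (hsmall : c_P ^ 2 * c_L * ‖f_s‖ < μ ^ 2) (hφ : φ ∈ Admissible Ω) :
    ∃ v : V Ω, IsStationaryState μ α f_s φ.1 v := by
  have hN : ∀ v : V Ω, ‖v‖ ≤ √(1 + c_P ^ 2) * ‖gradL Ω v‖ := by
    intro v
    refine le_of_sq_le_sq ?_ (by positivity)
    rw [mul_pow, Real.sq_sqrt (by positivity)]
    exact hP.norm_sq_le v
  simp only [isStationaryState_iff hL hα hφ]
  exact exists_small_solution hμ (by positivity) (mul_nonneg hL.1.le hP.1.le)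
    (mul_nonneg hP.1.le (norm_nonneg f_s)) hN (mul_norm_gradL_sq_le μ hα hφ)
    (isAdvection_advection hL).inner_eq_zero (abs_inner_advection_le hP hL)
    (inner_adjoint_embedL_le hP f_s) (by linarith)

end Stationary

/-! ### Weak time derivatives -/

section WeakDerivative

variable {a b : ℝ}

theorem eqOn_Icc_of_ae_eq_timeMeasure {X : Type*} [TopologicalSpace X] [T2Space X] (hab : a < b)
    {f h : ℝ → X} (hf : ContinuousOn f (Icc a b)) (hh : ContinuousOn h (Icc a b))
    (hfh : f =ᵐ[timeMeasure a b] h) : EqOn f h (Icc a b) :=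
  (Measure.eqOn_open_of_ae_eq (μ := volume) hfh isOpen_Ioo (hf.mono Ioo_subset_Icc_self)
    (hh.mono Ioo_subset_Icc_self)).of_subset_closure hf hh Ioo_subset_Icc_self
    (closure_Ioo hab.ne).ge

theorem eq_zero_of_notMem_of_tsupport_subset {s : Set ℝ} {θ : ℝ → ℝ} (hs : tsupport θ ⊆ s) {t : ℝ}
    (ht : t ∉ s) : θ t = 0 :=
  image_eq_zero_of_notMem_tsupport fun h => ht (hs h)

theorem integral_deriv_mul_primitive (hab : a ≤ b) {θ h : ℝ → ℝ} (hθ : ContDiff ℝ ∞ θ)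
    (hs : tsupport θ ⊆ Ioo a b) (hh : Integrable h (timeMeasure a b)) :
    ∫ t in Ioo a b, deriv θ t * primitive a h t = -∫ t in Ioo a b, θ t * h t := by
  have hI : IntervalIntegrable h volume a b :=
    intervalIntegrable_of_integrable_Ioo hh (left_mem_Icc.2 hab) (right_mem_Icc.2 hab)
  have hθ_ac : AbsolutelyContinuousOnInterval θ a b :=
    (hθ.of_le (by exact_mod_cast le_top)).contDiffOn.absolutelyContinuousOnInterval
  have hprim_ac : AbsolutelyContinuousOnInterval (primitive a h) a b :=
    hI.absolutelyContinuousOnInterval_intervalIntegral (c := a) left_mem_uIcc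
  have hparts := hθ_ac.integral_mul_deriv_eq_deriv_mul hprim_ac
  rw [eq_zero_of_notMem_of_tsupport_subset hs (t := a) (by simp),
    eq_zero_of_notMem_of_tsupport_subset hs (t := b) (by simp), zero_mul, zero_mul, sub_zero,
    zero_sub] at hparts
  have hderiv : ∫ t in a..b, θ t * deriv (primitive a h) t = ∫ t in a..b, θ t * h t := by
    refine intervalIntegral.integral_congr_ae ?_
    filter_upwards [hI.ae_hasDerivAt_integral] with x hx hxI
    exact congrArg (θ x * ·) (hx (uIoc_subset_uIcc hxI) a left_mem_uIcc).deriv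
  rw [integral_Ioo_eq_intervalIntegral _ hab, integral_Ioo_eq_intervalIntegral _ hab, ← hderiv,
    hparts, neg_neg]

theorem exists_Icc_of_isCompact_subset_Ioo {K : Set ℝ} (hK : IsCompact K) (hs : K ⊆ Ioo a b)
    (hab : a < b) : ∃ c d, a < c ∧ d < b ∧ K ⊆ Icc c d := by
  rcases K.eq_empty_or_nonempty with rfl | hne
  · exact ⟨b, a, hab, hab, empty_subset _⟩
  · obtain ⟨c, hc⟩ := hK.exists_isLeast hne
    obtain ⟨d, hd⟩ := hK.exists_isGreatest hne
    exact ⟨c, d, (hs hc.1).1, (hs hd.1).2, fun x hx => ⟨hc.2 hx, hd.2 hx⟩⟩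

theorem primitive_eq_zero_of_notMem_Icc {η : ℝ → ℝ} (hη : Continuous η) {c d : ℝ} (hac : a < c)
    (hdb : d < b) (hzero : ∀ t ∉ Icc c d, η t = 0) (hmean : ∫ t in a..b, η t = 0) {t : ℝ}
    (ht : t ∉ Icc c d) : primitive a η t = 0 := by
  have hintegral : ∀ {x y : ℝ}, (∀ s ∈ uIcc x y, s ∉ Icc c d) → ∫ s in x..y, η s = 0 := by
    intro x y hxy
    rw [intervalIntegral.integral_congr fun s hs => hzero s (hxy s hs)]
    exact intervalIntegral.integral_zero
  rcases lt_or_ge t c with htc | hct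
  · exact hintegral fun s hs hsI => absurd (hsI.1.trans hs.2) (not_le.2 (max_lt hac htc))
  · have hdt : d < t := lt_of_not_ge fun h => ht ⟨hct, h⟩
    have htb : ∫ s in t..b, η s = 0 :=
      hintegral fun s hs hsI => absurd (hs.1.trans hsI.2) (not_le.2 (lt_min hdt hdb))
    have hadd := intervalIntegral.integral_add_adjacent_intervals
      (hη.intervalIntegrable (μ := volume) a t) (hη.intervalIntegrable t b)
    rwa [htb, hmean, add_zero] at hadd

theorem exists_deriv_eq_of_integral_eq_zero (hab : a < b) {η : ℝ → ℝ} (hη : ContDiff ℝ ∞ η)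
    (hc : HasCompactSupport η) (hs : tsupport η ⊆ Ioo a b) (hmean : ∫ t in a..b, η t = 0) :
    ∃ θ : ℝ → ℝ, ContDiff ℝ ∞ θ ∧ HasCompactSupport θ ∧ tsupport θ ⊆ Ioo a b ∧ deriv θ = η := by
  obtain ⟨c, d, hac, hdb, hK⟩ := exists_Icc_of_isCompact_subset_Ioo hc hs hab
  have hderiv : ∀ t, HasDerivAt (primitive a η) (η t) t := fun t =>
    intervalIntegral.integral_hasDerivAt_right (hη.continuous.intervalIntegrable _ _)
      hη.continuous.aestronglyMeasurable.stronglyMeasurableAtFilter hη.continuous.continuousAt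
  have hderiv_eq : deriv (primitive a η) = η := funext fun t => (hderiv t).deriv
  have hsupp : tsupport (primitive a η) ⊆ Icc c d :=
    closure_minimal (Function.support_subset_iff'.2 fun t ht =>
      primitive_eq_zero_of_notMem_Icc hη.continuous hac hdb
        (fun s => eq_zero_of_notMem_of_tsupport_subset hK) hmean ht) isClosed_Icc
  refine ⟨primitive a η, ?_, isCompact_Icc.of_isClosed_subset (isClosed_tsupport _) hsupp,
    hsupp.trans (Icc_subset_Ioo hac hdb), hderiv_eq⟩
  rw [contDiff_infty_iff_deriv, hderiv_eq]
  exact ⟨fun t => (hderiv t).differentiableAt, hη⟩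

theorem exists_test_integral_eq_one (hab : a < b) : ∃ θ : ℝ → ℝ, ContDiff ℝ ∞ θ ∧
    HasCompactSupport θ ∧ tsupport θ ⊆ Ioo a b ∧ ∫ t in Ioo a b, θ t = 1 := by
  let χ : ContDiffBump ((a + b) / 2) := ⟨(b - a) / 8, (b - a) / 4, by linarith, by linarith⟩
  have hsupp : tsupport (χ.normed volume) ⊆ Ioo a b := by
    rw [χ.tsupport_normed_eq, Real.closedBall_eq_Icc]
    exact Icc_subset_Ioo (by simp only [χ]; linarith) (by simp only [χ]; linarith)
  refine ⟨χ.normed volume, χ.contDiff_normed, χ.hasCompactSupport_normed, hsupp, ?_⟩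
  rw [setIntegral_eq_integral_of_forall_compl_eq_zero
    fun t => eq_zero_of_notMem_of_tsupport_subset hsupp]
  exact χ.integral_normed

theorem integrableOn_Ioo_mul {θ g : ℝ → ℝ} (hθ : Continuous θ) (hg : ContinuousOn g (Icc a b)) :
    IntegrableOn (fun t => θ t * g t) (Ioo a b) :=
  (hθ.continuousOn.mul hg).integrableOn_Icc.mono_set Ioo_subset_Icc_self

/-- Subtracting `(∫ χ) θ₀` from `χ` leaves a test function of vanishing mean, hence a derivative. -/
theorem integral_mul_eq_integral_mul_of_integral_deriv_mul_eq_zero (hab : a < b) {k : ℝ → ℝ}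
    (hk : ContinuousOn k (Icc a b))
    (hweak : ∀ θ : ℝ → ℝ, ContDiff ℝ ∞ θ → HasCompactSupport θ → tsupport θ ⊆ Ioo a b →
      ∫ t in Ioo a b, deriv θ t * k t = 0)
    {θ₀ : ℝ → ℝ} (hθ₀ : ContDiff ℝ ∞ θ₀) (hc₀ : HasCompactSupport θ₀) (hs₀ : tsupport θ₀ ⊆ Ioo a b)
    (hone : ∫ t in Ioo a b, θ₀ t = 1)
    {χ : ℝ → ℝ} (hχ : ContDiff ℝ ∞ χ) (hc : HasCompactSupport χ) (hs : tsupport χ ⊆ Ioo a b) :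
    ∫ t in Ioo a b, χ t * k t = (∫ t in Ioo a b, χ t) * ∫ t in Ioo a b, θ₀ t * k t := by
  set I := ∫ t in Ioo a b, χ t
  have hsupp : tsupport (fun t => χ t - I * θ₀ t) ⊆ Ioo a b :=
    (tsupport_sub χ (fun t => I * θ₀ t)).trans (union_subset hs
      ((closure_mono (Function.support_mul_subset_right (fun _ => I) θ₀)).trans hs₀))
  have hint : ∀ {g : ℝ → ℝ}, Continuous g → IntegrableOn g (Ioo a b) := fun hg =>
    hg.integrableOn_Icc.mono_set Ioo_subset_Icc_self
  have hmean : ∫ t in a..b, (χ t - I * θ₀ t) = 0 := by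
    rw [← integral_Ioo_eq_intervalIntegral _ hab.le,
      integral_sub (hint hχ.continuous) ((hint hθ₀.continuous).const_mul I), integral_const_mul,
      hone, mul_one, sub_self]
  obtain ⟨θ, hθ, hθc, hθs, hderiv⟩ := exists_deriv_eq_of_integral_eq_zero hab
    (hχ.sub (contDiff_const.mul hθ₀)) (hc.sub hc₀.mul_left) hsupp hmean
  have hzero := hweak θ hθ hθc hθs
  simp only [hderiv, sub_mul, mul_assoc] at hzero
  rwa [integral_sub (integrableOn_Ioo_mul hχ.continuous hk)
    ((integrableOn_Ioo_mul hθ₀.continuous hk).const_mul I), integral_const_mul, sub_eq_zero]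
    at hzero

theorem exists_eqOn_const_of_integral_deriv_mul_eq_zero (hab : a < b) {k : ℝ → ℝ}
    (hk : ContinuousOn k (Icc a b))
    (hweak : ∀ θ : ℝ → ℝ, ContDiff ℝ ∞ θ → HasCompactSupport θ → tsupport θ ⊆ Ioo a b →
      ∫ t in Ioo a b, deriv θ t * k t = 0) : ∃ m, EqOn k (fun _ => m) (Icc a b) := by
  obtain ⟨θ₀, hθ₀, hc₀, hs₀, hone⟩ := exists_test_integral_eq_one hab
  let m := ∫ t in Ioo a b, θ₀ t * k t
  have hae : ∀ᵐ t ∂volume, t ∈ Ioo a b → k t - m = 0 := by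
    refine isOpen_Ioo.ae_eq_zero_of_integral_contDiff_smul_eq_zero
      (((hk.sub continuousOn_const).mono Ioo_subset_Icc_self).locallyIntegrableOn
        measurableSet_Ioo) fun χ hχ hc hs => ?_
    rw [← setIntegral_eq_integral_of_forall_compl_eq_zero (s := Ioo a b) fun t ht => by
      rw [eq_zero_of_notMem_of_tsupport_subset hs ht, zero_smul]]
    simp only [smul_eq_mul, mul_sub]
    rw [integral_sub (integrableOn_Ioo_mul hχ.continuous hk)
        (integrableOn_Ioo_mul hχ.continuous continuousOn_const), integral_mul_const,
      integral_mul_eq_integral_mul_of_integral_deriv_mul_eq_zero hab hk hweak hθ₀ hc₀ hs₀ hone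
        hχ hc hs, sub_self]
  refine ⟨m, eqOn_Icc_of_ae_eq_timeMeasure hab hk continuousOn_const ?_⟩
  rw [Filter.EventuallyEq, ae_restrict_iff' measurableSet_Ioo]
  filter_upwards [hae] with t ht hI
  exact sub_eq_zero.1 (ht hI)

theorem sub_eq_integral_of_weak_deriv (hab : a < b) {y h : ℝ → ℝ}
    (hy : ContinuousOn y (Icc a b)) (hh : Integrable h (timeMeasure a b))
    (hweak : ∀ θ : ℝ → ℝ, ContDiff ℝ ∞ θ → HasCompactSupport θ → tsupport θ ⊆ Ioo a b →
      ∫ t in Ioo a b, deriv θ t * y t = -∫ t in Ioo a b, θ t * h t) {t : ℝ} (ht : t ∈ Icc a b) :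
    y t - y a = ∫ s in a..t, h s := by
  have hprim := continuousOn_primitive hh
  obtain ⟨m, hm⟩ := exists_eqOn_const_of_integral_deriv_mul_eq_zero hab (hy.sub hprim)
    fun θ hθ hc hs => by
      have hθ' : Continuous (deriv θ) := hθ.continuous_deriv (by exact_mod_cast le_top)
      simp only [Pi.sub_apply, mul_sub]
      rw [integral_sub (integrableOn_Ioo_mul hθ' hy) (integrableOn_Ioo_mul hθ' hprim),
        hweak θ hθ hc hs, integral_deriv_mul_primitive hab.le hθ hs hh, sub_self]
  have hvalues := (hm ht).trans (hm (left_mem_Icc.2 hab.le)).symm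
  simp only [Pi.sub_apply, primitive, intervalIntegral.integral_same, sub_zero] at hvalues
  linarith

theorem integral_deriv_mul_of_sub_eq_integral (hab : a ≤ b) {y h : ℝ → ℝ}
    (hh : Integrable h (timeMeasure a b)) (hy : ∀ t ∈ Icc a b, y t - y a = ∫ s in a..t, h s)
    {θ : ℝ → ℝ} (hθ : ContDiff ℝ ∞ θ) (hs : tsupport θ ⊆ Ioo a b) :
    ∫ t in Ioo a b, deriv θ t * y t = -∫ t in Ioo a b, θ t * h t := by
  have hθ' : Continuous (deriv θ) := hθ.continuous_deriv (by exact_mod_cast le_top)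
  have hconst : ∫ t in Ioo a b, deriv θ t * y a = 0 := by
    rw [integral_mul_const, integral_Ioo_eq_intervalIntegral _ hab,
      intervalIntegral.integral_deriv_eq_sub
        (fun x _ => (hθ.differentiable (by simp)).differentiableAt) (hθ'.intervalIntegrable _ _),
      eq_zero_of_notMem_of_tsupport_subset hs (t := b) (by simp),
      eq_zero_of_notMem_of_tsupport_subset hs (t := a) (by simp), sub_zero, zero_mul]
  have hsplit : EqOn (fun t => deriv θ t * y t)
      (fun t => deriv θ t * primitive a h t + deriv θ t * y a) (Ioo a b) := fun t ht => by
    simp only [primitive, ← hy t (Ioo_subset_Icc_self ht)]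
    ring
  rw [setIntegral_congr_fun measurableSet_Ioo hsplit,
    integral_add (integrableOn_Ioo_mul hθ' (continuousOn_primitive hh))
      (integrableOn_Ioo_mul hθ' continuousOn_const), hconst, add_zero,
    integral_deriv_mul_primitive hab hθ hs hh]

end WeakDerivative

/-! ### Evolutions and the energy identity -/

section Evolution

variable {E : Type*} [NormedAddCommGroup E] [InnerProductSpace ℝ E]
  {G : Type*} [NormedAddCommGroup G] [InnerProductSpace ℝ G]
  {ι : E →L[ℝ] G} {a b s t : ℝ} {u g z k : ℝ → E} {w ζ : ℝ → G}

theorem integrable_inner_of_memLp {X F : Type*} [MeasurableSpace X] {m : Measure X}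
    [NormedAddCommGroup F] [InnerProductSpace ℝ F] {f h : X → F} (hf : MemLp f 2 m)
    (hh : MemLp h 2 m) : Integrable (fun x => ⟪f x, h x⟫_ℝ) m := by
  refine (L2.integrable_inner (𝕜 := ℝ) (hf.toLp f) (hh.toLp h)).congr ?_
  filter_upwards [hf.coeFn_toLp, hh.coeFn_toLp] with x hfx hhx
  rw [hfx, hhx]

theorem intervalIntegral_inner_const [CompleteSpace E] (hg : IntervalIntegrable g volume s t)
    (ψ : E) :
    ∫ r in s..t, ⟪g r, ψ⟫_ℝ = ⟪∫ r in s..t, g r, ψ⟫_ℝ := by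
  simp only [real_inner_comm ψ]
  exact (innerSL ℝ ψ).intervalIntegral_comp_comm hg

/-- `u ∈ L²(a, b; E)` has a time derivative in `L²(a, b; E*)`, where `E` acts on itself through the
inner product of `G`; the derivative is recorded as the function `g` with values in `E` that
represents it by Riesz' theorem, and `w` is the representative of `u` in `C([a, b]; G)`. -/
structure IsEvolution (ι : E →L[ℝ] G) (a b : ℝ) (u g : ℝ → E) (w : ℝ → G) : Prop where
  memLp_state : MemLp u 2 (timeMeasure a b)
  memLp_deriv : MemLp g 2 (timeMeasure a b)
  continuousOn : ContinuousOn w (Icc a b)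
  ae_eq : ∀ᵐ t ∂(timeMeasure a b), w t = ι (u t)
  inner_sub_initial : ∀ t ∈ Icc a b, ∀ ψ, ⟪w t - w a, ι ψ⟫_ℝ = ∫ r in a..t, ⟪g r, ψ⟫_ℝ

namespace IsEvolution

theorem intervalIntegrable_inner_const (h : IsEvolution ι a b u g w) (ψ : E) (hs : s ∈ Icc a b)
    (ht : t ∈ Icc a b) : IntervalIntegrable (fun r => ⟪g r, ψ⟫_ℝ) volume s t :=
  intervalIntegrable_of_integrable_Ioo ((h.memLp_deriv.integrable one_le_two).inner_const ψ) hs ht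

theorem intervalIntegrable_inner (h : IsEvolution ι a b u g w) (hs : s ∈ Icc a b)
    (ht : t ∈ Icc a b) : IntervalIntegrable (fun r => ⟪g r, u r⟫_ℝ) volume s t :=
  intervalIntegrable_of_integrable_Ioo (integrable_inner_of_memLp h.memLp_deriv h.memLp_state) hs ht

theorem add (h : IsEvolution ι a b u g w) (h' : IsEvolution ι a b z k ζ) :
    IsEvolution ι a b (fun t => u t + z t) (fun t => g t + k t) fun t => w t + ζ t where
  memLp_state := h.memLp_state.add h'.memLp_state
  memLp_deriv := h.memLp_deriv.add h'.memLp_deriv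
  continuousOn := h.continuousOn.add h'.continuousOn
  ae_eq := by
    filter_upwards [h.ae_eq, h'.ae_eq] with t hw hζ
    rw [hw, hζ, map_add]
  inner_sub_initial := by
    intro t ht ψ
    have ha := left_mem_Icc.2 (ht.1.trans ht.2)
    simp only [inner_add_left]
    rw [add_sub_add_comm, inner_add_left, h.inner_sub_initial t ht, h'.inner_sub_initial t ht,
      ← intervalIntegral.integral_add (h.intervalIntegrable_inner_const ψ ha ht)
        (h'.intervalIntegrable_inner_const ψ ha ht)]

theorem sub_const (h : IsEvolution ι a b u g w) (v : E) :
    IsEvolution ι a b (fun t => u t - v) g fun t => w t - ι v where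
  memLp_state := h.memLp_state.sub (memLp_const v)
  memLp_deriv := h.memLp_deriv
  continuousOn := h.continuousOn.sub continuousOn_const
  ae_eq := by
    filter_upwards [h.ae_eq] with t hw
    rw [hw, map_sub]
  inner_sub_initial := by
    intro t ht ψ
    rw [sub_sub_sub_cancel_right, h.inner_sub_initial t ht]

theorem restrict (h : IsEvolution ι a b u g w) (hs : s ∈ Icc a b) : IsEvolution ι s b u g w where
  memLp_state := h.memLp_state.mono_measure
    (Measure.restrict_mono (Ioo_subset_Ioo_left hs.1) le_rfl)
  memLp_deriv := h.memLp_deriv.mono_measure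
    (Measure.restrict_mono (Ioo_subset_Ioo_left hs.1) le_rfl)
  continuousOn := h.continuousOn.mono (Icc_subset_Icc_left hs.1)
  ae_eq := ae_timeMeasure_mono h.ae_eq hs.1 le_rfl
  inner_sub_initial := by
    intro t ht ψ
    have ht' : t ∈ Icc a b := ⟨hs.1.trans ht.1, ht.2⟩
    have ha := left_mem_Icc.2 (hs.1.trans hs.2)
    rw [← sub_sub_sub_cancel_right (w t) (w s) (w a), inner_sub_left, h.inner_sub_initial t ht',
      h.inner_sub_initial s hs, intervalIntegral.integral_interval_sub_left
        (h.intervalIntegrable_inner_const ψ ha ht') (h.intervalIntegrable_inner_const ψ ha hs)]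

variable [CompleteSpace E] [CompleteSpace G]

theorem gram_eq_volterra (h : IsEvolution ι a b u g w) (hw : w a = 0) :
    gram a b ι (h.memLp_state.toLp u) = volterra a b E (h.memLp_deriv.toLp g) := by
  refine Lp.ext ?_
  filter_upwards [inner_coeFn_gram ι (h.memLp_state.toLp u), h.memLp_state.coeFn_toLp,
    coeFn_volterra (h.memLp_deriv.toLp g), h.ae_eq, ae_restrict_mem measurableSet_Ioo]
    with t hgram hu hvolterra hwu ht
  have ht' := Ioo_subset_Icc_self ht
  refine ext_inner_right ℝ fun ψ => ?_
  rw [hgram, hu, hvolterra, primitive_congr h.memLp_deriv.coeFn_toLp ht', primitive, ← hwu,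
    ← sub_zero (w t), ← hw, h.inner_sub_initial t ht', intervalIntegral_inner_const]
  exact intervalIntegrable_of_integrable_Ioo (h.memLp_deriv.integrable one_le_two)
    (left_mem_Icc.2 (ht.1.trans ht.2).le) ht'

theorem norm_sq_eq_of_initial_eq_zero (h : IsEvolution ι a b u g w) (hw : w a = 0)
    (ht : t ∈ Icc a b) : ‖w t‖ ^ 2 = 2 * ∫ r in a..t, ⟪g r, u r⟫_ℝ := by
  rcases (ht.1.trans ht.2).eq_or_lt with hab | hab
  · obtain rfl : t = a := le_antisymm (hab ▸ ht.2) ht.1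
    simp only [hw, norm_zero, intervalIntegral.integral_same, mul_zero]
    norm_num
  obtain ⟨ζ, hζ, -, hζu, henergy⟩ :=
    exists_continuous_representative hab.le ι (h.gram_eq_volterra hw)
  have hζw : EqOn ζ w (Icc a b) := by
    refine eqOn_Icc_of_ae_eq_timeMeasure hab hζ h.continuousOn ?_
    filter_upwards [hζu, h.memLp_state.coeFn_toLp, h.ae_eq] with r hζr hur hwr
    rw [hζr, hur, hwr]
  rw [← hζw ht, henergy t ht]
  congr 1
  refine intervalIntegral_congr_timeMeasure ?_ le_rfl ht.1 ht.2
  filter_upwards [h.memLp_state.coeFn_toLp, h.memLp_deriv.coeFn_toLp] with r hur hgr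
  rw [hur, hgr]

theorem norm_sq_sub_of_initial_eq (h : IsEvolution ι a b u g w) {v : E} (hv : w a = ι v)
    (ht : t ∈ Icc a b) : ‖w t‖ ^ 2 - ‖w a‖ ^ 2 = 2 * ∫ r in a..t, ⟪g r, u r⟫_ℝ := by
  have ha := left_mem_Icc.2 (ht.1.trans ht.2)
  have henergy := (h.sub_const v).norm_sq_eq_of_initial_eq_zero (sub_eq_zero.2 hv) ht
  have hincrement := h.inner_sub_initial t ht v
  simp only [inner_sub_right] at henergy
  rw [intervalIntegral.integral_sub (h.intervalIntegrable_inner ha ht)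
    (h.intervalIntegrable_inner_const v ha ht), ← hincrement, ← hv, norm_sub_sq_real,
    inner_sub_left, real_inner_self_eq_norm_sq] at henergy
  linarith

/-- The initial value need not lie in the range of `ι`, but almost every other value does. -/
theorem norm_sq_sub_norm_sq_eq (h : IsEvolution ι a b u g w) (ht : t ∈ Icc a b) :
    ‖w t‖ ^ 2 - ‖w a‖ ^ 2 = 2 * ∫ r in a..t, ⟪g r, u r⟫_ℝ := by
  rcases (ht.1.trans ht.2).eq_or_lt with hab | hab
  · obtain rfl : t = a := le_antisymm (hab ▸ ht.2) ht.1
    simp only [sub_self, intervalIntegral.integral_same, mul_zero]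
  have ha := left_mem_Icc.2 hab.le
  have hb := right_mem_Icc.2 hab.le
  set Q : ℝ → ℝ := fun t => ‖w t‖ ^ 2 - 2 * primitive a (fun r => ⟪g r, u r⟫_ℝ) t with hQ
  have hQ_cont : ContinuousOn Q (Icc a b) := (h.continuousOn.norm.pow 2).sub
    ((continuousOn_primitive (integrable_inner_of_memLp h.memLp_deriv h.memLp_state)).const_mul 2)
  have hQ_ae : ∀ᵐ s ∂(timeMeasure a b), Q s = Q b := by
    filter_upwards [h.ae_eq, ae_restrict_mem measurableSet_Ioo] with s hws hs
    have hs' := Ioo_subset_Icc_self hs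
    have henergy := (h.restrict hs').norm_sq_sub_of_initial_eq hws (right_mem_Icc.2 hs.2.le)
    have hadd := intervalIntegral.integral_add_adjacent_intervals
      (h.intervalIntegrable_inner ha hs') (h.intervalIntegrable_inner hs' hb)
    simp only [hQ, primitive]
    linarith
  have hQ_eq := eqOn_Icc_of_ae_eq_timeMeasure hab hQ_cont continuousOn_const hQ_ae
  have hQta := (hQ_eq ht).trans (hQ_eq ha).symm
  simp only [hQ, primitive, intervalIntegral.integral_same] at hQta
  linarith

end IsEvolution

variable [CompleteSpace E] [CompleteSpace G]

theorem exists_isEvolution_of_gram_eq_volterra (hab : a < b) {z k : TimeL2 a b E}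
    (h : gram a b ι z = volterra a b E k) : ∃ ζ, IsEvolution ι a b z k ζ ∧ ζ a = 0 := by
  obtain ⟨ζ, hζ, hζ₀, hζz, -⟩ := exists_continuous_representative hab.le ι h
  refine ⟨ζ, ⟨Lp.memLp z, Lp.memLp k, hζ, hζz, fun t ht ψ => ?_⟩, hζ₀⟩
  rw [hζ₀, sub_zero, intervalIntegral_inner_const
    (k.intervalIntegrable (left_mem_Icc.2 hab.le) ht)]
  refine eqOn_Icc_of_ae_eq_timeMeasure hab (f := fun t => ⟪ζ t, ι ψ⟫_ℝ)
    (h := fun t => ⟪primitive a k t, ψ⟫_ℝ) (hζ.inner continuousOn_const)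
    ((continuousOn_primitive k.integrable).inner continuousOn_const) ?_ ht
  filter_upwards [inner_coeFn_gram ι z, coeFn_volterra k, hζz] with r hgram hvolterra hζr
  rw [hζr, ← hgram, h, hvolterra]

theorem exists_perturbed_evolution (hab : a < b) {A : E →L[ℝ] E} {c : ℝ}
    (hc : 0 < c) (hA : ∀ v, c * ‖v‖ ^ 2 ≤ ⟪A v, v⟫_ℝ) {B : E →L[ℝ] E →L[ℝ] E} {K : ℝ}
    (hB : IsAdvection ι B K) {D₀ D₁ : E →L[ℝ] E} (hD₀ : ∀ v, 0 ≤ ⟪D₀ v, v⟫_ℝ)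
    (hD₁ : ∀ v, 0 ≤ ⟪D₁ v, v⟫_ℝ) (h : IsEvolution ι a b u g w) :
    ∃ u' g' w', IsEvolution ι a b u' g' w' ∧ w' a = w a ∧
      ∀ᵐ t ∂(timeMeasure a b), g' t + (A (u' t) + D₁ (u' t)) + B (u' t) (u' t) =
        g t + (A (u t) + D₀ (u t)) + B (u t) (u t) := by
  obtain ⟨C, hC⟩ := isCompact_Icc.exists_bound_of_continuousOn h.continuousOn
  have hbound : ∀ᵐ t ∂(timeMeasure a b), ‖ι (h.memLp_state.toLp u t)‖ ≤ C := by
    filter_upwards [h.ae_eq, h.memLp_state.coeFn_toLp, ae_restrict_mem measurableSet_Ioo]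
      with t hwt hut ht
    rw [hut, ← hwt]
    exact hC t (Ioo_subset_Icc_self ht)
  obtain ⟨p, hp⟩ := energySpace.exists_fst_eq hbound
  obtain ⟨k, z, hz, hk⟩ := exists_perturbed_solution hab.le hc hA hB hD₀ hD₁ p
  obtain ⟨ζ, hζ, hζ₀⟩ := exists_isEvolution_of_gram_eq_volterra hab hz
  refine ⟨_, _, _, h.add hζ, by rw [hζ₀, add_zero], ?_⟩
  filter_upwards [hk, h.memLp_state.coeFn_toLp, Lp.coeFn_sub k (A.compLpL 2 _ z),
    A.coeFn_compLpL (p := 2) z] with t hkt hut hsub hAz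
  rw [hp, hut] at hkt
  rw [← add_assoc (g t) (A (u t)), add_assoc (g t + A (u t)), ← hkt, hsub, Pi.sub_apply, hAz,
    map_add A]
  abel

end Evolution

/-! ### Time-dependent states -/

section TimeStates

variable {Ω : Set Plane} {c_P c_L μ T : ℝ} {α : ℝ → ℝ} {f : ℝ → L2 Ω Plane} {u₀ : L2 Ω Plane}
  {φ : L2 Ω ℝ × L2 Ω Plane} {u g : ℝ → V Ω} {w : ℝ → L2 Ω Plane}

theorem memLp_toDual {X E : Type*} [MeasurableSpace X] {m : Measure X} [NormedAddCommGroup E]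
    [InnerProductSpace ℝ E] [CompleteSpace E] {p : ENNReal} {h : X → E} (hh : MemLp h p m) :
    MemLp (fun x => InnerProductSpace.toDual ℝ E (h x)) p m :=
  (InnerProductSpace.toDual ℝ E).lipschitz.comp_memLp (map_zero _) hh

theorem memLp_symm_toDual {X E : Type*} [MeasurableSpace X] {m : Measure X}
    [NormedAddCommGroup E] [InnerProductSpace ℝ E] [CompleteSpace E] {p : ENNReal}
    {h : X → StrongDual ℝ E} (hh : MemLp h p m) :
    MemLp (fun x => (InnerProductSpace.toDual ℝ E).symm (h x)) p m :=
  (InnerProductSpace.toDual ℝ E).symm.lipschitz.comp_memLp (map_zero _) hh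

theorem IsEvolution.isWeakTimeDeriv (hT : 0 ≤ T) (h : IsEvolution (embedL Ω) 0 T u g w) :
    IsWeakTimeDeriv T u fun t => InnerProductSpace.toDual ℝ (V Ω) (g t) := by
  intro θ hθ _ hs ψ
  have hsub : ∀ t ∈ Icc 0 T,
      ⟪w t, embedL Ω ψ⟫_ℝ - ⟪w 0, embedL Ω ψ⟫_ℝ = ∫ r in 0..t, ⟪g r, ψ⟫_ℝ := fun t ht => by
    rw [← inner_sub_left, h.inner_sub_initial t ht]
  simp only [InnerProductSpace.toDual_apply_apply]
  rw [← integral_deriv_mul_of_sub_eq_integral hT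
    ((h.memLp_deriv.integrable one_le_two).inner_const ψ) hsub hθ hs]
  refine integral_congr_ae ?_
  filter_upwards [h.ae_eq] with t ht
  simp only [ht, embedL_apply]

theorem IsWeakTimeDeriv.isEvolution (hT : 0 < T) {du : ℝ → StrongDual ℝ (V Ω)}
    (h : IsWeakTimeDeriv T u du) (hu : MemLp u 2 (timeMeasure 0 T))
    (hdu : MemLp du 2 (timeMeasure 0 T)) (hw : ContinuousOn w (Icc 0 T))
    (hwu : ∀ᵐ t ∂(timeMeasure 0 T), w t = (u t).1.fst) :
    IsEvolution (embedL Ω) 0 T u (fun t => (InnerProductSpace.toDual ℝ (V Ω)).symm (du t)) w where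
  memLp_state := hu
  memLp_deriv := memLp_symm_toDual hdu
  continuousOn := hw
  ae_eq := hwu
  inner_sub_initial := by
    intro t ht ψ
    have hg := memLp_symm_toDual hdu
    rw [inner_sub_left]
    refine sub_eq_integral_of_weak_deriv hT (y := fun t => ⟪w t, embedL Ω ψ⟫_ℝ)
      (hw.inner continuousOn_const) ((hg.integrable one_le_two).inner_const ψ)
      (fun θ hθ hc hs => ?_) ht
    simp only [InnerProductSpace.toDual_symm_apply]
    rw [← h θ hθ hc hs ψ]
    refine integral_congr_ae ?_
    filter_upwards [hwu] with t ht
    simp only [ht, embedL_apply]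

theorem isTimeState_iff (hT : 0 < T) (hL : IsLadyzhenskayaConstant Ω c_L)
    (hα : IsPorousCoefficient α) (hφ : φ ∈ Admissible Ω) :
    IsTimeState μ α f u₀ T φ.1 u ↔ ∃ g w, IsEvolution (embedL Ω) 0 T u g w ∧ w 0 = u₀ ∧
      ∀ᵐ t ∂(timeMeasure 0 T), g t + (diffusionL Ω μ (u t) + brinkmanL hα hφ (u t)) +
        advection hL (u t) (u t) = (embedL Ω).adjoint (f t) := by
  have hequation : ∀ (g v : V Ω) (F : L2 Ω Plane),
      (∀ ψ : V Ω, ⟪g, ψ⟫_ℝ + aForm μ α φ.1 v ψ + bForm (v : FieldPair Ω) v ψ =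
        ∫ x in Ω, ⟪F x, ψ.1.fst x⟫_ℝ) ↔
      g + (diffusionL Ω μ v + brinkmanL hα hφ v) + advection hL v v = (embedL Ω).adjoint F := by
    intro g v F
    simp only [aForm_eq_inner μ hα hφ, ← inner_advection hL, ← inner_adjoint_embedL,
      ← inner_add_left]
    exact ⟨ext_inner_right ℝ, fun h ψ => congrArg (⟪·, ψ⟫_ℝ) h⟩
  constructor
  · rintro ⟨hu, ⟨du, hdu, hweak, heq⟩, w, hw, hwu, hw₀⟩
    refine ⟨_, w, hweak.isEvolution hT hu hdu hw hwu, hw₀, ?_⟩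
    filter_upwards [heq] with t ht
    simpa only [← hequation, InnerProductSpace.toDual_symm_apply] using ht
  · rintro ⟨g, w, h, hw₀, heq⟩
    refine ⟨h.memLp_state, ⟨_, memLp_toDual h.memLp_deriv,
      h.isWeakTimeDeriv hT.le, ?_⟩, w, h.continuousOn, h.ae_eq, hw₀⟩
    filter_upwards [heq] with t ht
    exact (hequation _ _ _).2 ht

theorem exists_timeState (hT : 0 < T) (hμ : 0 < μ) (hP : IsPoincareConstant Ω c_P)
    (hL : IsLadyzhenskayaConstant Ω c_L) (hα : IsPorousCoefficient α)
    {φ₀ φ₁ : L2 Ω ℝ × L2 Ω Plane} (hφ₀ : φ₀ ∈ Admissible Ω) (hφ₁ : φ₁ ∈ Admissible Ω)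
    (h : IsTimeState μ α f u₀ T φ₀.1 u) : ∃ u', IsTimeState μ α f u₀ T φ₁.1 u' := by
  obtain ⟨g, w, hevolution, hw₀, heq⟩ := (isTimeState_iff hT hL hα hφ₀).1 h
  obtain ⟨u', g', w', hevolution', hw₀', heq'⟩ := exists_perturbed_evolution hT
    (by positivity : 0 < μ / (1 + c_P ^ 2)) (diffusionL_coercive hμ.le hP)
    (isAdvection_advection hL) (inner_brinkmanL_self_nonneg hα hφ₀)
    (inner_brinkmanL_self_nonneg hα hφ₁) hevolution
  refine ⟨u', (isTimeState_iff hT hL hα hφ₁).2 ⟨g', w', hevolution', hw₀'.trans hw₀, ?_⟩⟩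
  filter_upwards [heq, heq'] with t ht ht'
  rw [ht', ht]

end TimeStates

/-! ### Distance of the time-dependent state to the stationary one -/

theorem IsEvolution.mul_integral_norm_sq_le {E G : Type*} [NormedAddCommGroup E]
    [InnerProductSpace ℝ E] [CompleteSpace E] [NormedAddCommGroup G] [InnerProductSpace ℝ G]
    [CompleteSpace G] {ι : E →L[ℝ] G} {a b : ℝ} {u g : ℝ → E} {w : ℝ → G} {η : ℝ → ℝ} {κ : ℝ}
    (hab : a ≤ b) (h : IsEvolution ι a b u g w) (hη : Integrable η (timeMeasure a b))
    (hdissipation : ∀ᵐ t ∂(timeMeasure a b), ⟪g t, u t⟫_ℝ ≤ η t - κ * ‖ι (u t)‖ ^ 2) :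
    2 * κ * ∫ t in Ioo a b, ‖ι (u t)‖ ^ 2 ≤ ‖w a‖ ^ 2 + 2 * ∫ t in Ioo a b, η t := by
  have hι : Integrable (fun t => ‖ι (u t)‖ ^ 2) (timeMeasure a b) :=
    (ι.comp_memLp' h.memLp_state).integrable_norm_pow two_ne_zero
  have hmono := integral_mono_ae (integrable_inner_of_memLp h.memLp_deriv h.memLp_state)
    (hη.sub (hι.const_mul κ)) hdissipation
  rw [integral_Ioo_eq_intervalIntegral (fun t => ⟪g t, u t⟫_ℝ) hab] at hmono
  simp only [Pi.sub_apply] at hmono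
  rw [integral_sub hη (hι.const_mul κ), integral_const_mul] at hmono
  have henergy := h.norm_sq_sub_norm_sq_eq (right_mem_Icc.2 hab)
  linarith [sq_nonneg ‖w b‖]

theorem inner_deriv_sub_eq {E : Type*} [NormedAddCommGroup E] [InnerProductSpace ℝ E]
    {L : E →L[ℝ] E} {B : E →L[ℝ] E →L[ℝ] E} (hB : ∀ u v, ⟪B u v, v⟫_ℝ = 0) {g u v p q : E}
    (hu : g + L u + B u u = p) (hv : L v + B v v = q) :
    ⟪g, u - v⟫_ℝ = ⟪p - q, u - v⟫_ℝ - ⟪L (u - v), u - v⟫_ℝ - ⟪B (u - v) v, u - v⟫_ℝ := by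
  have hskew := hB u (u - v)
  have hg : g = p - q - L (u - v) - B (u - v) v - B u (u - v) := by
    rw [← hu, ← hv, map_sub L, map_sub B, map_sub (B u), _root_.sub_apply]
    abel
  rw [hg, inner_sub_left, inner_sub_left, inner_sub_left, hskew, sub_zero]

section Turnpike

variable {Ω : Set Plane} {c_P c_L μ T K : ℝ} {α : ℝ → ℝ} {f : ℝ → L2 Ω Plane}
  {u₀ f_s : L2 Ω Plane} {φ : L2 Ω ℝ × L2 Ω Plane} {v : V Ω}

theorem IsStationaryState.norm_embedL_le (hμ : 0 < μ) (hP : IsPoincareConstant Ω c_P)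
    (hL : IsLadyzhenskayaConstant Ω c_L) (hα : IsPorousCoefficient α) (hφ : φ ∈ Admissible Ω)
    (hv : IsStationaryState μ α f_s φ.1 v) :
    ‖embedL Ω v‖ ≤ c_P * (μ⁻¹ * (c_P * ‖f_s‖)) :=
  (hP.norm_embedL_le v).trans
    (mul_le_mul_of_nonneg_left (hv.norm_gradL_le hμ hP hL hα hφ) hP.1.le)

/-- The smallness of `f_s` lets half of the viscosity absorb the advection of the stationary
state. -/
theorem IsStationaryState.abs_inner_advection_le (hμ : 0 < μ) (hP : IsPoincareConstant Ω c_P)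
    (hL : IsLadyzhenskayaConstant Ω c_L) (hα : IsPorousCoefficient α) (hφ : φ ∈ Admissible Ω)
    (hsmall : 2 * c_P ^ 2 * c_L * ‖f_s‖ < μ ^ 2) (hv : IsStationaryState μ α f_s φ.1 v) (w : V Ω) :
    |⟪advection hL w v, w⟫_ℝ| ≤ μ / 2 * ‖gradL Ω w‖ ^ 2 := by
  have hP₀ := hP.1
  have hL₀ := hL.1
  have hhalf : c_L * c_P * (μ⁻¹ * (c_P * ‖f_s‖)) ≤ μ / 2 := by
    field_simp
    linarith
  calc |⟪advection hL w v, w⟫_ℝ| ≤ c_L * c_P * (‖gradL Ω w‖ * ‖gradL Ω w‖) * ‖gradL Ω v‖ :=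
        PhaseFieldNS.abs_inner_advection_le hP hL w v w
    _ ≤ c_L * c_P * (‖gradL Ω w‖ * ‖gradL Ω w‖) * (μ⁻¹ * (c_P * ‖f_s‖)) :=
        mul_le_mul_of_nonneg_left (hv.norm_gradL_le hμ hP hL hα hφ) (by positivity)
    _ = c_L * c_P * (μ⁻¹ * (c_P * ‖f_s‖)) * ‖gradL Ω w‖ ^ 2 := by ring
    _ ≤ μ / 2 * ‖gradL Ω w‖ ^ 2 := mul_le_mul_of_nonneg_right hhalf (sq_nonneg _)

theorem inner_adjoint_embedL_le_young (hμ : 0 < μ) (hP : IsPoincareConstant Ω c_P)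
    (F : L2 Ω Plane) (w : V Ω) :
    ⟪(embedL Ω).adjoint F, w⟫_ℝ ≤ c_P ^ 2 / μ * ‖F‖ ^ 2 + μ / 4 * ‖gradL Ω w‖ ^ 2 := by
  have hsq : c_P ^ 2 / μ * ‖F‖ ^ 2 + μ / 4 * ‖gradL Ω w‖ ^ 2 - c_P * ‖F‖ * ‖gradL Ω w‖ =
      (c_P * ‖F‖ - μ / 2 * ‖gradL Ω w‖) ^ 2 / μ := by
    field_simp
    ring
  have hnonneg : 0 ≤ (c_P * ‖F‖ - μ / 2 * ‖gradL Ω w‖) ^ 2 / μ := by positivity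
  linarith [inner_adjoint_embedL_le hP F w]

theorem inner_deriv_sub_le (hμ : 0 < μ) (hP : IsPoincareConstant Ω c_P)
    (hL : IsLadyzhenskayaConstant Ω c_L) (hα : IsPorousCoefficient α) (hφ : φ ∈ Admissible Ω)
    (hsmall : 2 * c_P ^ 2 * c_L * ‖f_s‖ < μ ^ 2) (hv : IsStationaryState μ α f_s φ.1 v)
    {u g : V Ω} {F : L2 Ω Plane}
    (hu : g + (diffusionL Ω μ + brinkmanL hα hφ) u + advection hL u u = (embedL Ω).adjoint F) :
    ⟪g, u - v⟫_ℝ ≤ c_P ^ 2 / μ * ‖F - f_s‖ ^ 2 - μ / (4 * c_P ^ 2) * ‖embedL Ω (u - v)‖ ^ 2 := by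
  have hP₀ := hP.1
  have hsource := inner_adjoint_embedL_le_young hμ hP (F - f_s) (u - v)
  have hviscosity := mul_norm_gradL_sq_le μ hα hφ (u - v)
  have hadvection := (abs_le.1 (hv.abs_inner_advection_le hμ hP hL hα hφ hsmall (u - v))).1
  have hpoincare : μ / (4 * c_P ^ 2) * ‖embedL Ω (u - v)‖ ^ 2 ≤
      μ / 4 * ‖gradL Ω (u - v)‖ ^ 2 := by
    calc μ / (4 * c_P ^ 2) * ‖embedL Ω (u - v)‖ ^ 2
        ≤ μ / (4 * c_P ^ 2) * (c_P * ‖gradL Ω (u - v)‖) ^ 2 := by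
          gcongr
          exact hP.norm_embedL_le (u - v)
      _ = _ := by field_simp
  rw [inner_deriv_sub_eq (isAdvection_advection hL).inner_eq_zero hu
    ((isStationaryState_iff hL hα hφ).1 hv), ← map_sub (embedL Ω).adjoint]
  linarith

theorem decayRate_nonneg (hμ : 0 < μ) (hP : 0 < c_P) (hL : 0 < c_L) {F : ℝ} (hF : 0 ≤ F)
    (hsmall : 2 * c_P ^ 2 * c_L * F < μ ^ 2) : 0 ≤ decayRate μ c_P c_L F := by
  refine div_nonneg ?_ (by positivity)
  have hsq := pow_le_pow_left₀ (by positivity) hsmall.le 2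
  nlinarith [sq_nonneg (c_L * c_P ^ 2 * F)]

theorem integral_le_integral_exp_mul {r : ℝ} {h : ℝ → ℝ} (hr : 0 ≤ r)
    (hh : Integrable h (timeMeasure 0 T)) (hh₀ : ∀ t, 0 ≤ h t) :
    ∫ t in Ioo 0 T, h t ≤ ∫ t in Ioo 0 T, Real.exp (r * t) * h t := by
  refine setIntegral_mono_on hh ?_ measurableSet_Ioo fun t ht => ?_
  · refine hh.bdd_mul (c := Real.exp (r * T)) (by fun_prop) ?_
    filter_upwards [ae_restrict_mem measurableSet_Ioo] with t ht
    rw [Real.norm_eq_abs, Real.abs_exp]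
    exact Real.exp_le_exp.2 (mul_le_mul_of_nonneg_left ht.2.le hr)
  · exact le_mul_of_one_le_left (hh₀ t) (Real.one_le_exp (mul_nonneg hr ht.1.le))

theorem IsTimeState.integral_norm_embedL_sub_sq_le (hT : 0 < T) (hμ : 0 < μ)
    (hP : IsPoincareConstant Ω c_P) (hL : IsLadyzhenskayaConstant Ω c_L)
    (hα : IsPorousCoefficient α) (hφ : φ ∈ Admissible Ω)
    (hsmall : 2 * c_P ^ 2 * c_L * ‖f_s‖ < μ ^ 2) (hf : MemLp f 2 (timeMeasure 0 T))
    (hK : ∫ t in Ioo 0 T, ‖f t - f_s‖ ^ 2 ≤ K) (hv : IsStationaryState μ α f_s φ.1 v)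
    {u : ℝ → V Ω} (hu : IsTimeState μ α f u₀ T φ.1 u) :
    ∫ t in Ioo 0 T, ‖embedL Ω (u t - v)‖ ^ 2 ≤ 2 * c_P ^ 2 / μ *
      ((‖u₀‖ + c_P * (μ⁻¹ * (c_P * ‖f_s‖))) ^ 2 + 2 * (c_P ^ 2 / μ * K)) := by
  have hP₀ := hP.1
  obtain ⟨g, w, hevolution, hw₀, heq⟩ := (isTimeState_iff hT hL hα hφ).1 hu
  have hsource : Integrable (fun t => c_P ^ 2 / μ * ‖f t - f_s‖ ^ 2) (timeMeasure 0 T) :=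
    ((hf.sub (memLp_const f_s)).integrable_norm_pow two_ne_zero).const_mul _
  have hdecay := (hevolution.sub_const v).mul_integral_norm_sq_le hT.le hsource
    (κ := μ / (4 * c_P ^ 2)) (by
      filter_upwards [heq] with t ht
      exact inner_deriv_sub_le hμ hP hL hα hφ hsmall hv ht)
  rw [integral_const_mul, hw₀] at hdecay
  have hinitial : ‖u₀ - embedL Ω v‖ ≤ ‖u₀‖ + c_P * (μ⁻¹ * (c_P * ‖f_s‖)) :=
    (norm_sub_le _ _).trans (add_le_add_right (hv.norm_embedL_le hμ hP hL hα hφ) _)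
  calc ∫ t in Ioo 0 T, ‖embedL Ω (u t - v)‖ ^ 2
      = 2 * c_P ^ 2 / μ *
          (2 * (μ / (4 * c_P ^ 2)) * ∫ t in Ioo 0 T, ‖embedL Ω (u t - v)‖ ^ 2) := by
        field_simp
        ring
    _ ≤ 2 * c_P ^ 2 / μ * (‖u₀ - embedL Ω v‖ ^ 2 +
          2 * (c_P ^ 2 / μ * ∫ t in Ioo 0 T, ‖f t - f_s‖ ^ 2)) := by gcongr
    _ ≤ _ := by gcongr

end Turnpike

/-! ### The objectives -/

section Cost

open scoped ENNReal

theorem abs_inner_map_self_sub_le {X : Type*} [NormedAddCommGroup X] [InnerProductSpace ℝ X]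
    {S : X →L[ℝ] X} {M : ℝ} (hS : ∀ x, ‖S x‖ ≤ M * ‖x‖) (x y : X) :
    |⟪S x, x⟫_ℝ - ⟪S y, y⟫_ℝ| ≤ M * ‖x - y‖ ^ 2 + 2 * (M * ‖y‖) * ‖x - y‖ := by
  have hinner : ∀ p q : X, |⟪S p, q⟫_ℝ| ≤ M * ‖p‖ * ‖q‖ := fun p q =>
    (abs_real_inner_le_norm _ _).trans (mul_le_mul_of_nonneg_right (hS p) (norm_nonneg q))
  calc |⟪S x, x⟫_ℝ - ⟪S y, y⟫_ℝ|
      = |⟪S (x - y), x - y⟫_ℝ + ⟪S y, x - y⟫_ℝ + ⟪S (x - y), y⟫_ℝ| := by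
        simp only [map_sub, inner_sub_right, inner_sub_left]
        ring_nf
    _ ≤ M * ‖x - y‖ * ‖x - y‖ + M * ‖y‖ * ‖x - y‖ + M * ‖x - y‖ * ‖y‖ :=
        (abs_add_three _ _ _).trans (by gcongr <;> exact hinner _ _)
    _ = _ := by ring

variable {Ω D : Set Plane} {β : ℝ → ℝ} {φ : L2 Ω ℝ × L2 Ω Plane}

theorem memLp_indicator (Ω : Set Plane) (hD : MeasurableSet D) (g : L2 D Plane) :
    MemLp (D.indicator g) 2 (volume.restrict Ω) :=
  ((memLp_indicator_iff_restrict hD).2 (Lp.memLp g)).mono_measure Measure.restrict_le_self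

/-- A field on `D`, extended by zero and restricted to `Ω`. -/
def extendByZero (Ω : Set Plane) (hD : MeasurableSet D) (g : L2 D Plane) : L2 Ω Plane :=
  (memLp_indicator Ω hD g).toLp

theorem sub_extendByZero_ae_eq (hD : MeasurableSet D) (g : L2 D Plane) (x : L2 Ω Plane) :
    x - extendByZero Ω hD g =ᵐ[volume.restrict Ω] fun y => x y - D.indicator g y := by
  filter_upwards [Lp.coeFn_sub x (extendByZero Ω hD g), (memLp_indicator Ω hD g).coeFn_toLp]
    with y hy hext
  rw [hy, Pi.sub_apply, extendByZero, hext]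

theorem abs_indicator_fluidFraction_le (D : Set Plane) (hφ : φ ∈ Admissible Ω) :
    ∀ᵐ x ∂(volume.restrict Ω), |D.indicator (fun x => (φ.1 x + 1) / 2) x| ≤ 1 := by
  filter_upwards [hφ.2] with x hx
  obtain ⟨hlower, hupper⟩ := abs_le.1 hx
  refine (norm_indicator_le_norm_self (fun x => (φ.1 x + 1) / 2) x).trans ?_
  rw [Real.norm_eq_abs, abs_le]
  constructor <;> linarith

theorem memLp_indicator_fluidFraction (hD : MeasurableSet D) (hφ : φ ∈ Admissible Ω) :
    MemLp (D.indicator fun x => (φ.1 x + 1) / 2) ∞ (volume.restrict Ω) :=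
  memLp_top_of_bound (((by fun_prop : Continuous fun s : ℝ => (s + 1) / 2).comp_aestronglyMeasurable
    (Lp.aestronglyMeasurable φ.1)).indicator hD) 1 (abs_indicator_fluidFraction_le D hφ)

theorem runningCost_eq_inner (hD : MeasurableSet D) (hβ : IsPorousCoefficient β)
    (u_d : L2 D Plane) (hφ : φ ∈ Admissible Ω) (x : L2 Ω Plane) :
    runningCost β u_d φ.1 x =
      ⟪mulL Plane (memLp_indicator_fluidFraction hD hφ)
        (x - extendByZero Ω hD u_d), x - extendByZero Ω hD u_d⟫_ℝ +
      ⟪mulL Plane (hβ.memLp_top hφ) x, x⟫_ℝ := by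
  have hsub := sub_extendByZero_ae_eq hD u_d x
  rw [integral_inner_eq_of_ae_eq ((coeFn_mulL _ _).trans (Filter.EventuallyEq.rfl.smul hsub)) hsub,
    integral_inner_eq_of_ae_eq (coeFn_mulL _ x) .rfl]
  simp only [runningCost, real_inner_smul_left, real_inner_self_eq_norm_sq]
  congr 2 with y
  by_cases hy : y ∈ D
  · simp only [indicator_of_mem hy]
  · simp only [indicator_of_notMem hy, zero_mul]

theorem continuous_runningCost (hD : MeasurableSet D) (hβ : IsPorousCoefficient β)
    (u_d : L2 D Plane) (hφ : φ ∈ Admissible Ω) :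
    Continuous fun x : L2 Ω Plane => runningCost β u_d φ.1 x := by
  simp only [runningCost_eq_inner hD hβ u_d hφ]
  fun_prop

theorem exists_abs_runningCost_sub_le (hD : MeasurableSet D) (hβ : IsPorousCoefficient β)
    (u_d : L2 D Plane) (r : ℝ) : ∃ k, 0 < k ∧ ∀ φ ∈ Admissible Ω, ∀ x y : L2 Ω Plane, ‖y‖ ≤ r →
      |runningCost β u_d φ.1 x - runningCost β u_d φ.1 y| ≤ k * (‖x - y‖ ^ 2 + ‖x - y‖) := by
  obtain ⟨M, hM₀, hM⟩ := hβ.exists_bound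
  set e : L2 Ω Plane := extendByZero Ω hD u_d
  refine ⟨1 + M + 2 * (|r| + ‖e‖) + 2 * (M * |r|), by positivity, fun φ hφ x y hy => ?_⟩
  have hy' : ‖y‖ ≤ |r| := hy.trans (le_abs_self r)
  have htracking := abs_inner_map_self_sub_le
    (norm_mulL_le (E := Plane) (memLp_indicator_fluidFraction hD hφ)
      (abs_indicator_fluidFraction_le D hφ)) (x - e) (y - e)
  have hpenalty := abs_inner_map_self_sub_le
    (norm_mulL_le (E := Plane) (hβ.memLp_top hφ) (hφ.2.mono fun z => hM _)) x y
  rw [sub_sub_sub_cancel_right] at htracking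
  rw [runningCost_eq_inner hD hβ u_d hφ, runningCost_eq_inner hD hβ u_d hφ, add_sub_add_comm]
  calc _ ≤ 1 * ‖x - y‖ ^ 2 + 2 * (1 * ‖y - e‖) * ‖x - y‖ +
        (M * ‖x - y‖ ^ 2 + 2 * (M * ‖y‖) * ‖x - y‖) :=
        (abs_add_le _ _).trans (add_le_add htracking hpenalty)
    _ ≤ 1 * ‖x - y‖ ^ 2 + 2 * (1 * (|r| + ‖e‖)) * ‖x - y‖ +
        (M * ‖x - y‖ ^ 2 + 2 * (M * |r|) * ‖x - y‖) := by
        gcongr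
        exact (norm_sub_le _ _).trans (by gcongr)
    _ ≤ _ := by
        have hsq : 0 ≤ (2 * (|r| + ‖e‖) + 2 * (M * |r|)) * ‖x - y‖ ^ 2 := by positivity
        have hlin : 0 ≤ (1 + M) * ‖x - y‖ := by positivity
        linarith

end Cost

section MeanCost

theorem abs_average_le {α : Type*} [MeasurableSpace α] {ν : Measure α} [IsFiniteMeasure ν]
    [NeZero ν] {d r : α → ℝ} {k : ℝ} (hk : 0 ≤ k) (hd : MemLp d 2 ν)
    (hr : ∀ᵐ t ∂ν, |r t| ≤ k * (d t ^ 2 + d t)) :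
    |⨍ t, r t ∂ν| ≤ k * (⨍ t, d t ^ 2 ∂ν + √(⨍ t, d t ^ 2 ∂ν)) := by
  have hjensen : (⨍ t, d t ∂ν) ^ 2 ≤ ⨍ t, d t ^ 2 ∂ν :=
    even_two.convexOn_pow.map_average_le (continuous_pow 2).continuousOn isClosed_univ
      (.of_forall fun _ => mem_univ _) (hd.integrable one_le_two) hd.integrable_sq
  calc |⨍ t, r t ∂ν| ≤ ⨍ t, k * (d t ^ 2 + d t) ∂ν := by
        rw [← Real.norm_eq_abs]
        exact norm_integral_le_of_norm_le (((hd.integrable_sq.add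
          (hd.integrable one_le_two)).const_mul k).to_average) 
          (Measure.ae_smul_measure hr _)
    _ = k * (⨍ t, d t ^ 2 ∂ν + ⨍ t, d t ∂ν) := by
        rw [average_eq, average_eq, average_eq, integral_const_mul,
          integral_add hd.integrable_sq (hd.integrable one_le_two)]
        simp only [smul_eq_mul]
        ring
    _ ≤ _ := by
        gcongr
        exact Real.le_sqrt_of_sq_le hjensen

variable {Ω D : Set Plane} {c_P c_L μ : ℝ} {α β : ℝ → ℝ}

/-- The time average over `(0, T)` of the running cost, which is the part of the time-dependent
objective that depends on the state. -/
def meanRunningCost (β : ℝ → ℝ) (u_d : L2 D Plane) (T : ℝ) (u : ℝ → V Ω) (φ : L2 Ω ℝ) : ℝ :=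
  1 / T * ∫ t in Ioo 0 T, runningCost β u_d φ (u t).1.fst

theorem meanRunningCost_sub_eq_average {T : ℝ} (hT : 0 < T) {u_d : L2 D Plane} {u : ℝ → V Ω}
    {φ : L2 Ω ℝ}
    (hu : Integrable (fun t => runningCost β u_d φ (u t).1.fst) (timeMeasure 0 T)) (c : ℝ) :
    meanRunningCost β u_d T u φ - c = ⨍ t in Ioo 0 T, (runningCost β u_d φ (u t).1.fst - c) := by
  rw [meanRunningCost, setAverage_eq, Real.volume_real_Ioo_of_le hT.le, sub_zero,
    integral_sub hu (integrable_const c), setIntegral_const, Real.volume_real_Ioo_of_le hT.le,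
    sub_zero, smul_eq_mul, smul_eq_mul]
  field_simp

theorem integrable_runningCost (hD : MeasurableSet D) (hβ : IsPorousCoefficient β)
    (u_d : L2 D Plane) {φ : L2 Ω ℝ × L2 Ω Plane} (hφ : φ ∈ Admissible Ω) {T : ℝ} {u : ℝ → V Ω}
    (hu : MemLp u 2 (timeMeasure 0 T)) :
    Integrable (fun t => runningCost β u_d φ.1 (u t).1.fst) (timeMeasure 0 T) := by
  obtain ⟨k, -, hcost⟩ := exists_abs_runningCost_sub_le (Ω := Ω) hD hβ u_d 0
  have hι : MemLp (fun t => embedL Ω (u t)) 2 (timeMeasure 0 T) := (embedL Ω).comp_memLp' hu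
  have hbound : Integrable (fun t => k * (‖embedL Ω (u t)‖ ^ 2 + ‖embedL Ω (u t)‖) +
      |runningCost β u_d φ.1 (0 : L2 Ω Plane)|) (timeMeasure 0 T) :=
    (((hι.integrable_norm_pow two_ne_zero).add (hι.norm.integrable one_le_two)).const_mul k).add
      (integrable_const _)
  refine hbound.mono' ((continuous_runningCost hD hβ u_d hφ).comp_aestronglyMeasurable hι.1)
    (.of_forall fun t => ?_)
  have hsub := (abs_sub_abs_le_abs_sub _ _).trans (hcost φ hφ (embedL Ω (u t)) 0 norm_zero.le)
  rw [sub_zero] at hsub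
  exact sub_le_iff_le_add.1 hsub

theorem div_add_sqrt_div_le {C T : ℝ} (hC : 0 ≤ C) (hT : 0 < T) :
    C / T + √(C / T) ≤ (C + 1) * (1 / √T + 1 / T) := by
  have hsqrt : √C ≤ C + 1 := Real.sqrt_le_iff.2 ⟨by positivity, by nlinarith⟩
  calc C / T + √(C / T) = C * (1 / T) + √C * (1 / √T) := by
        rw [Real.sqrt_div hC]
        ring
    _ ≤ (C + 1) * (1 / T) + (C + 1) * (1 / √T) := by
        gcongr
        linarith
    _ = _ := by ring

theorem exists_abs_meanRunningCost_sub_le (hD : MeasurableSet D) (hβ : IsPorousCoefficient β)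
    (u_d : L2 D Plane) (r C : ℝ) : ∃ c, 0 < c ∧ ∀ T : ℝ, 0 < T → ∀ φ ∈ Admissible Ω,
      ∀ (u : ℝ → V Ω) (v : V Ω), MemLp u 2 (timeMeasure 0 T) → ‖embedL Ω v‖ ≤ r →
        ∫ t in Ioo 0 T, ‖embedL Ω (u t - v)‖ ^ 2 ≤ C →
        |meanRunningCost β u_d T u φ.1 - runningCost β u_d φ.1 v.1.fst| ≤
          c * (1 / √T + 1 / T) := by
  obtain ⟨k, hk, hcost⟩ := exists_abs_runningCost_sub_le (Ω := Ω) hD hβ u_d r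
  refine ⟨k * (|C| + 1), by positivity, fun T hT φ hφ u v hu hv hC => ?_⟩
  have hι : MemLp (fun t => embedL Ω (u t - v)) 2 (timeMeasure 0 T) :=
    (embedL Ω).comp_memLp' (hu.sub (memLp_const v))
  have hdiff : ∀ t, |runningCost β u_d φ.1 (u t).1.fst - runningCost β u_d φ.1 v.1.fst| ≤
      k * (‖embedL Ω (u t - v)‖ ^ 2 + ‖embedL Ω (u t - v)‖) := fun t => by
    rw [map_sub]
    exact hcost φ hφ _ _ hv
  have hC₀ : 0 ≤ C := (integral_nonneg fun t => sq_nonneg _).trans hC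
  have haverage : ⨍ t in Ioo 0 T, ‖embedL Ω (u t - v)‖ ^ 2 ≤ C / T := by
    rw [setAverage_eq, Real.volume_real_Ioo_of_le hT.le, sub_zero, smul_eq_mul, inv_mul_eq_div]
    gcongr
  have : NeZero (timeMeasure 0 T) := ⟨by simpa using hT⟩
  calc |meanRunningCost β u_d T u φ.1 - runningCost β u_d φ.1 v.1.fst|
      ≤ k * ((⨍ t in Ioo 0 T, ‖embedL Ω (u t - v)‖ ^ 2) +
          √(⨍ t in Ioo 0 T, ‖embedL Ω (u t - v)‖ ^ 2)) := by
        rw [meanRunningCost_sub_eq_average hT (integrable_runningCost hD hβ u_d hφ hu)]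
        exact abs_average_le hk.le hι.norm (.of_forall hdiff)
    _ ≤ k * (C / T + √(C / T)) := by gcongr
    _ ≤ k * ((C + 1) * (1 / √T + 1 / T)) := by
        gcongr
        exact div_add_sqrt_div_le hC₀ hT
    _ ≤ k * (|C| + 1) * (1 / √T + 1 / T) := by
        rw [← mul_assoc]
        gcongr
        exact le_abs_self C

end MeanCost

section SameDesign

variable {Ω D : Set Plane} {c_P c_L μ K : ℝ} {α β : ℝ → ℝ} {f_s : L2 Ω Plane}
  {f : ℝ → L2 Ω Plane}

theorem exists_abs_meanRunningCost_sub_stationary_le (hD : MeasurableSet D) (hμ : 0 < μ)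
    (hα : IsPorousCoefficient α) (hβ : IsPorousCoefficient β) (u_d : L2 D Plane) (u₀ : L2 Ω Plane)
    (hf : ∀ T : ℝ, 0 < T → MemLp f 2 (timeMeasure 0 T)) (hP : IsPoincareConstant Ω c_P)
    (hL : IsLadyzhenskayaConstant Ω c_L) (hsmall : 2 * c_P ^ 2 * c_L * ‖f_s‖ < μ ^ 2)
    (hK : ∀ T : ℝ, 0 < T → ∫ t in Ioo 0 T, ‖f t - f_s‖ ^ 2 ≤ K) :
    ∃ c, 0 < c ∧ ∀ T : ℝ, 0 < T → ∀ φ ∈ Admissible Ω, ∀ (u : ℝ → V Ω) (v : V Ω),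
      IsTimeState μ α f u₀ T φ.1 u → IsStationaryState μ α f_s φ.1 v →
      |meanRunningCost β u_d T u φ.1 - runningCost β u_d φ.1 v.1.fst| ≤
        c * (1 / √T + 1 / T) := by
  obtain ⟨c, hc, hcost⟩ := exists_abs_meanRunningCost_sub_le (Ω := Ω) hD hβ u_d
    (c_P * (μ⁻¹ * (c_P * ‖f_s‖)))
    (2 * c_P ^ 2 / μ * ((‖u₀‖ + c_P * (μ⁻¹ * (c_P * ‖f_s‖))) ^ 2 + 2 * (c_P ^ 2 / μ * K)))
  exact ⟨c, hc, fun T hT φ hφ u v hu hv => hcost T hT φ hφ u v hu.memLp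
    (hv.norm_embedL_le hμ hP hL hα hφ)
    (hu.integral_norm_embedL_sub_sq_le hT hμ hP hL hα hφ hsmall (hf T hT) (hK T hT) hv)⟩

theorem integral_norm_sub_sq_le_of_integral_exp_mul_le (hμ : 0 < μ) (hP : 0 < c_P) (hL : 0 < c_L)
    (hsmall : 2 * c_P ^ 2 * c_L * ‖f_s‖ < μ ^ 2) {T : ℝ} (hf : MemLp f 2 (timeMeasure 0 T))
    (hK : ∫ t in Ioo 0 T, Real.exp (decayRate μ c_P c_L ‖f_s‖ * t) * ‖f t - f_s‖ ^ 2 ≤ K) :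
    ∫ t in Ioo 0 T, ‖f t - f_s‖ ^ 2 ≤ K :=
  (integral_le_integral_exp_mul (decayRate_nonneg hμ hP hL (norm_nonneg f_s) hsmall)
    ((hf.sub (memLp_const f_s)).integrable_norm_pow two_ne_zero) fun _ => sq_nonneg _).trans hK

end SameDesign

end PhaseFieldNS

end

/-- `𝓔` stands for `γ 𝔼_ε`, the part of both objectives that depends on the design alone. -/
theorem theorem5p1_general
    (Ω D : Set Plane) (hD_meas : MeasurableSet D) (μ : ℝ) (hμ : 0 < μ)
    (α β : ℝ → ℝ) (hα : IsPorousCoefficient α) (hβ : IsPorousCoefficient β)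
    (u_d : L2 D Plane) (u₀ f_s : L2 Ω Plane) (f : ℝ → L2 Ω Plane)
    (hf : ∀ T : ℝ, 0 < T → MemLp f 2 (volume.restrict (Ioo 0 T)))
    (c_P c_L : ℝ) (hP : IsPoincareConstant Ω c_P) (hL : IsLadyzhenskayaConstant Ω c_L)
    (hsmall : 2 * c_P ^ 2 * c_L * ‖f_s‖ < μ ^ 2)
    (hsource : ∃ K : ℝ, ∀ T : ℝ, 0 < T → ∫ t in Ioo 0 T, ‖f t - f_s‖ ^ 2 ≤ K) :
    ∃ c : ℝ, 0 < c ∧ ∀ (𝓔 : L2 Ω ℝ × L2 Ω Plane → ℝ) (T : ℝ), 0 < T →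
      ∀ (φT : L2 Ω ℝ × L2 Ω Plane) (uT : ℝ → V Ω) (φs : L2 Ω ℝ × L2 Ω Plane) (vs : V Ω),
        φT ∈ Admissible Ω → IsTimeState μ α f u₀ T φT.1 uT →
        (∀ φ ∈ Admissible Ω, ∀ u, IsTimeState μ α f u₀ T φ.1 u →
          meanRunningCost β u_d T uT φT.1 + 𝓔 φT ≤ meanRunningCost β u_d T u φ.1 + 𝓔 φ) →
        φs ∈ Admissible Ω → IsStationaryState μ α f_s φs.1 vs →
        (∀ φ ∈ Admissible Ω, ∀ v : V Ω, IsStationaryState μ α f_s φ.1 v →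
          runningCost β u_d φs.1 vs.1.fst + 𝓔 φs ≤ runningCost β u_d φ.1 v.1.fst + 𝓔 φ) →
        |meanRunningCost β u_d T uT φT.1 + 𝓔 φT - (runningCost β u_d φs.1 vs.1.fst + 𝓔 φs)| ≤
          c * (1 / √T + 1 / T) := by
  obtain ⟨K, hK⟩ := hsource
  obtain ⟨c, hc, hclose⟩ := exists_abs_meanRunningCost_sub_stationary_le hD_meas hμ hα hβ u_d u₀
    hf hP hL hsmall hK
  refine ⟨c, hc, fun 𝓔 T hT φT uT φs vs hφT huT hminT hφs hvs hmins => ?_⟩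
  have hsmall' : c_P ^ 2 * c_L * ‖f_s‖ < μ ^ 2 := by
    have hP₀ := hP.1
    have hL₀ := hL.1
    linarith [show 0 ≤ c_P ^ 2 * c_L * ‖f_s‖ by positivity]
  obtain ⟨v, hv⟩ := exists_stationaryState hμ hP hL hα hsmall' hφT
  obtain ⟨u, hu⟩ := exists_timeState hT hμ hP hL hα hφT hφs huT
  have hT_close := abs_le.1 (hclose T hT φT hφT uT v huT hv)
  have hs_close := abs_le.1 (hclose T hT φs hφs u vs hu hvs)
  exact abs_le.2 ⟨by linarith [hmins φT hφT v hv], by linarith [hminT φs hφs u hu]⟩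

theorem theorem5p1
    (Ω D : Set Plane) (hΩ_open : IsOpen Ω) (hΩ_bdd : Bornology.IsBounded Ω)
    (hD_meas : MeasurableSet D) (hD_sub : D ⊆ Ω)
    (ε γ μ : ℝ) (hε : 0 < ε) (hγ : 0 < γ) (hμ : 0 < μ)
    (α β : ℝ → ℝ) (hα : IsPorousCoefficient α) (hβ : IsPorousCoefficient β)
    (u_d : L2 D Plane) (u₀ : L2 Ω Plane) (hu₀ : u₀ ∈ H Ω)
    (f_s : L2 Ω Plane) (f : ℝ → L2 Ω Plane)
    (hf : ∀ T : ℝ, 0 < T → MemLp f 2 (volume.restrict (Ioo 0 T)))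
    (c_P c_L : ℝ) (hP : IsPoincareConstant Ω c_P) (hL : IsLadyzhenskayaConstant Ω c_L)
    (hsmall : 2 * c_P ^ 2 * c_L * ‖f_s‖ < μ ^ 2)
    (hsource : ∃ K : ℝ, 0 < K ∧ ∀ T : ℝ, 0 < T →
      ∫ t in Ioo 0 T, Real.exp (decayRate μ c_P c_L ‖f_s‖ * t) * ‖f t - f_s‖ ^ 2 ≤ K) :
    ∃ c : ℝ, 0 < c ∧ ∀ T : ℝ, 0 < T →
      ∀ (φT : L2 Ω ℝ × L2 Ω Plane) (uT : ℝ → V Ω) (φs : L2 Ω ℝ × L2 Ω Plane) (vs : V Ω),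
        IsTimeMinimizer ε γ μ α β u_d f u₀ T φT uT →
        IsStationaryMinimizer ε γ μ α β u_d f_s φs vs →
        |JT ε γ β u_d T uT φT - Js ε γ β u_d vs φs| ≤ c * (1 / √T + 1 / T) := by
  obtain ⟨K, -, hK⟩ := hsource
  obtain ⟨c, hc, h⟩ := theorem5p1_general Ω D hD_meas μ hμ α β hα hβ u_d u₀ f_s f hf c_P c_L hP hL
    hsmall ⟨K, fun T hT => integral_norm_sub_sq_le_of_integral_exp_mul_le hμ hP.1 hL.1 hsmall
      (hf T hT) (hK T hT)⟩
  exact ⟨c, hc, fun T hT φT uT φs vs hφT hφs => h (fun φ => γ * energy ε φ) T hT φT uT φs vs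
    hφT.admissible hφT.state hφT.minimal hφs.admissible hφs.state hφs.minimal⟩
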